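/- **Setting.** Let $0<\alpha<1$, $d\in\{1,2\}$, and let $\Omega\subset\mathbb R^d$ be a bounded domain. Let $Au=-\nabla\cdot(a\nabla u)+q\,u$, with homogeneous Dirichlet boundary condition, be a self-adjoint positive definite second-order elliptic operator with real, bounded, measurable coefficients ($a$ symmetric and uniformly elliptic; no sign of $q$ is assumed), with bilinear form $A(u,v)=\int_\Omega (a\nabla u\cdot\nabla v+q\,uv)\,dx$. Let $\mathcal T_h$ be a finite conforming triangulation by $d$-simplices contained in $\overline\Omega$ (covering $\overline\Omega$ if $\Omega$ is polygonal), let $X_h\subset H^1_0(\Omega)$ be the space of continuous functions that are affine on each simplex and vanish outside $\Omega$ and outside the triangulated region, let $P_h:L^2(\Omega)\to X_h$ be the $L^2$-projection, and let $A_h:X_h\to X_h$ be given by $(A_h\varphi,\psi)=A(\varphi,\psi)$ for $\varphi,\psi\in X_h$. $\|\cdot\|$ is the norm of $L^2(\Omega)$. Let $T>0$, $u^0\in L^2(\Omega)$, $f:[0,T]\to L^2(\Omega)$, and $f_h=P_hf$. The semidiscrete solution $u_h:[0,T]\to X_h$ is the absolutely continuous solution of $$\frac1{\Gamma(1-\alpha)}\int_0^t(t-\zeta)^{-\alpha}u_h'(\zeta)\,d\zeta+A_hu_h(t)=f_h(t)\quad\text{for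 a.e. }t\in(0,T),\qquad u_h(0)=P_hu^0 .$$ **Scheme CN-I.** Let $N\ge1$, $\tau=T/N$, $t_n=n\tau$, $F_h^n=\int_0^{t_n}f_h(\xi)\,d\xi$, $\sigma_0=1$, $\sigma_j=(1-\frac{\alpha+1}{j})\sigma_{j-1}$, and $D_\tau v(t)=\tau^{-1}\big(\tfrac32v(t)-2v(t-\tau)+\tfrac12v(t-2\tau)\big)$, where $t^{2-\alpha}$ is replaced by $0$ for $t\le0$. Put $\tilde U_h^n=0$ for $n\le0$, and for $1\le n\le N$ let $$\tau^{-\alpha}\sum_{j=0}^n\sigma_j\tilde U_h^{n-j}+(1-\tfrac\alpha2)A_h\tilde U_h^n+\tfrac\alpha2A_h\tilde U_h^{n-1}=(1-\tfrac\alpha2)F_h^n+\tfrac\alpha2F_h^{n-1}+(1-\tfrac\alpha2)D_\tau\tfrac{t_n^{2-\alpha}}{\Gamma(3-\alpha)}P_hu^0+\tfrac\alpha2D_\tau\tfrac{t_{n-1}^{2-\alpha}}{\Gamma(3-\alpha)}P_hu^0,$$ $$\tilde u_h^n=\tau^{-1}\big(\tfrac32\tilde U_h^n-2\tilde U_h^{n-1}+\tfrac12\tilde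 U_h^{n-2}\big).$$ **Theorem.** There is a constant $c>0$ depending only on $\alpha$ such that the following holds for all data as above. Assume $u^0\in L^2(\Omega)$, $f\in W^{1,\infty}(0,T;L^2(\Omega))$, that $f'$ has a weak derivative $f''\in L^1(0,T;L^2(\Omega))$ (so that $f$ and $f'$ are taken as their continuous representatives on $[0,T]$), and $\int_0^t(t-\zeta)^{\alpha-1}\|f''(\zeta)\|\,d\zeta<\infty$ for all $t\in(0,T]$. Then for $1\le n\le N$, $$\|u_h(t_n)-\tilde u_h^n\|\le c\,\tau^2\Big(t_n^{-2}\|u^0\|+t_n^{\alpha-2}\|f(0)\|+t_n^{\alpha-1}\|f'(0)\|+\int_0^{t_n}(t_n-\zeta)^{\alpha-1}\|f''(\zeta)\|\,d\zeta\Big).$$ -/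

import Mathlib

open MeasureTheory

namespace SubDiff

/-! ### The spatial setting: elliptic operator and linear finite elements -/

/-- The Hilbert space `L²(Ω)` for a set `Ω ⊆ ℝ^d`. -/
abbrev L2 {d : ℕ} (Ω : Set (EuclideanSpace ℝ (Fin d))) : Type :=
  Lp ℝ 2 (volume.restrict Ω)

/-- The partial derivative `∂u/∂x_i`; it exists almost everywhere if `u` is Lipschitz, and is then
the weak derivative. -/
noncomputable def pderiv {d : ℕ} (i : Fin d) (u : EuclideanSpace ℝ (Fin d) → ℝ)
    (x : EuclideanSpace ℝ (Fin d)) : ℝ :=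
  fderiv ℝ u x (EuclideanSpace.single i 1)

/-- The bilinear form `A(u, v) = ∫_Ω (a ∇u · ∇v + q u v) dx` of the second-order operator
`A u = - ∇ · (a ∇u) + q u`. -/
noncomputable def ellipticForm {d : ℕ} (Ω : Set (EuclideanSpace ℝ (Fin d)))
    (a : EuclideanSpace ℝ (Fin d) → Matrix (Fin d) (Fin d) ℝ) (q : EuclideanSpace ℝ (Fin d) → ℝ)
    (u v : EuclideanSpace ℝ (Fin d) → ℝ) : ℝ :=
  ∫ x in Ω, ((∑ i, ∑ j, a x i j * pderiv j u x * pderiv i v x) + q x * u x * v x)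

/-- `A u = - ∇ · (a ∇u) + q u`, with homogeneous Dirichlet boundary condition, is a self-adjoint
positive definite second-order elliptic operator on `Ω`: the coefficients are measurable and
bounded, `a` is symmetric and uniformly elliptic, and the form is positive definite.
Positivity is only asked for on the Lipschitz functions that vanish outside `Ω`, which are dense
in `H¹₀(Ω)`. No sign of `q` is assumed. -/
structure IsElliptic {d : ℕ} (Ω : Set (EuclideanSpace ℝ (Fin d)))
    (a : EuclideanSpace ℝ (Fin d) → Matrix (Fin d) (Fin d) ℝ)
    (q : EuclideanSpace ℝ (Fin d) → ℝ) : Prop where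
  meas_a : ∀ i j, AEStronglyMeasurable (fun x => a x i j) (volume.restrict Ω)
  meas_q : AEStronglyMeasurable q (volume.restrict Ω)
  bdd_a : ∃ M : ℝ, ∀ x ∈ Ω, ∀ i j, |a x i j| ≤ M
  bdd_q : ∃ M : ℝ, ∀ x ∈ Ω, |q x| ≤ M
  symm : ∀ x ∈ Ω, (a x).IsSymm
  elliptic : ∃ ν : ℝ, 0 < ν ∧ ∀ x ∈ Ω, ∀ ξ : Fin d → ℝ,
    ν * ∑ i, ξ i ^ 2 ≤ ∑ i, ∑ j, a x i j * ξ j * ξ i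
  posDef : ∀ v : EuclideanSpace ℝ (Fin d) → ℝ, (∃ C, LipschitzWith C v) → (∀ x ∉ Ω, v x = 0) →
    v ≠ 0 → 0 < ellipticForm Ω a q v v

/-- A triangulation of the domain `Ω`: a finite conforming family of `d`-simplices (with all their
faces) contained in the closure of `Ω`. For a polygonal `Ω` the union `K.space` of the simplices
may be all of the closure of `Ω`; for a curved boundary it is the polygonal approximation from
inside that makes the finite element space a subspace of `H¹₀(Ω)`. -/
structure Triangulation {d : ℕ} (Ω : Set (EuclideanSpace ℝ (Fin d))) where
  K : Geometry.SimplicialComplex ℝ (EuclideanSpace ℝ (Fin d))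
  finite_faces : K.faces.Finite
  pure : ∀ s ∈ K.faces, ∃ t ∈ K.faces, s ⊆ t ∧ t.card = d + 1
  space_subset : K.space ⊆ closure Ω

/-- The continuous functions that are affine on every simplex of the triangulation and vanish
outside `Ω` (in particular on `∂Ω`) and outside the triangulated region. -/
def plSpace {d : ℕ} {Ω : Set (EuclideanSpace ℝ (Fin d))} (𝒯 : Triangulation Ω) :
    Submodule ℝ (EuclideanSpace ℝ (Fin d) → ℝ) where
  carrier := {u | Continuous u ∧ (∀ x ∉ Ω, u x = 0) ∧ (∀ x ∉ 𝒯.K.space, u x = 0) ∧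
    ∀ s ∈ 𝒯.K.faces, ∃ ℓ : EuclideanSpace ℝ (Fin d) →ᵃ[ℝ] ℝ,
      Set.EqOn u ℓ (convexHull ℝ (s : Set (EuclideanSpace ℝ (Fin d))))}
  zero_mem' := ⟨continuous_zero, fun _ _ => rfl, fun _ _ => rfl, fun _ _ => ⟨0, fun _ _ => rfl⟩⟩
  add_mem' := by
    rintro u v ⟨hu, hu1, hu2, hu3⟩ ⟨hv, hv1, hv2, hv3⟩
    refine ⟨hu.add hv, fun x hx => ?_, fun x hx => ?_, fun s hs => ?_⟩
    · simp [hu1 x hx, hv1 x hx]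
    · simp [hu2 x hx, hv2 x hx]
    · obtain ⟨ℓ, hℓ⟩ := hu3 s hs
      obtain ⟨m, hm⟩ := hv3 s hs
      exact ⟨ℓ + m, fun x hx => by simp [hℓ hx, hm hx]⟩
  smul_mem' := by
    rintro r u ⟨hu, hu1, hu2, hu3⟩
    refine ⟨hu.const_smul r, fun x hx => ?_, fun x hx => ?_, fun s hs => ?_⟩
    · simp [hu1 x hx]
    · simp [hu2 x hx]
    · obtain ⟨ℓ, hℓ⟩ := hu3 s hs
      exact ⟨r • ℓ, fun x hx => by simp [hℓ hx]⟩

section facts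

variable {d : ℕ} {Ω : Set (EuclideanSpace ℝ (Fin d))} {𝒯 : Triangulation Ω}

theorem isCompact_space (𝒯 : Triangulation Ω) : IsCompact 𝒯.K.space :=
  𝒯.finite_faces.isCompact_biUnion fun s _ => s.finite_toSet.isCompact_convexHull ℝ

theorem plSpace_memLp {u : EuclideanSpace ℝ (Fin d) → ℝ} (hu : u ∈ plSpace 𝒯) :
    MemLp u 2 (volume.restrict Ω) :=
  hu.1.memLp_of_hasCompactSupport
    (HasCompactSupport.intro (isCompact_space 𝒯) fun x hx => hu.2.2.1 x hx)

/-- Finite element functions are Lipschitz. -/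
theorem plSpace_lipschitz {u : EuclideanSpace ℝ (Fin d) → ℝ} (hu : u ∈ plSpace 𝒯) :
    ∃ C, LipschitzWith C u := by
  obtain ⟨hc, -, h0, haff⟩ := hu
  choose! ℓ hℓ using haff
  obtain ⟨C, hC⟩ : ∃ C : ℝ, 0 ≤ C ∧ ∀ s ∈ 𝒯.K.faces, ∀ v,
      |(ℓ s).linear v| ≤ C * ‖v‖ := by
    refine ⟨∑ s ∈ 𝒯.finite_faces.toFinset, ‖(ℓ s).linear.toContinuousLinearMap‖,
      Finset.sum_nonneg fun _ _ => norm_nonneg _, fun s hs v => ?_⟩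
    refine ((ℓ s).linear.toContinuousLinearMap.le_opNorm v).trans ?_
    gcongr
    exact Finset.single_le_sum
      (f := fun s => ‖(ℓ s).linear.toContinuousLinearMap‖)
      (fun _ _ => norm_nonneg _) (𝒯.finite_faces.mem_toFinset.2 hs)
  obtain ⟨hC0, hC⟩ := hC
  have key : ∀ x y, u y - u x ≤ C * ‖y - x‖ := by
    intro x y
    set p : ℝ → EuclideanSpace ℝ (Fin d) := fun t => x + t • (y - x) with hp
    have hpc : Continuous p := by fun_prop
    have := image_le_of_liminf_slope_right_le_deriv_boundary (f := fun t => u (p t)) (a := 0)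
      (b := 1) (B := fun t => u x + C * ‖y - x‖ * t) (B' := fun _ => C * ‖y - x‖)
      (hc.comp hpc).continuousOn (by simp [hp]) (by fun_prop)
      (fun t _ => by
        simpa using (((hasDerivAt_id t).const_mul (C * ‖y - x‖)).const_add (u x)).hasDerivWithinAt)
      (fun t _ r hr => by
        by_cases hfr : ∃ s ∈ 𝒯.K.faces, ∃ᶠ z in nhdsWithin t (Set.Ioi t),
            p z ∈ convexHull ℝ (s : Set (EuclideanSpace ℝ (Fin d)))
        · obtain ⟨s, hs, hfr⟩ := hfr
          have hcl : IsClosed (convexHull ℝ (s : Set (EuclideanSpace ℝ (Fin d)))) :=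
            (s.finite_toSet.isCompact_convexHull ℝ).isClosed
          have ht : p t ∈ convexHull ℝ (s : Set (EuclideanSpace ℝ (Fin d))) := by
            have h2 : ∃ᶠ z in nhds t, z ∈ p ⁻¹' convexHull ℝ (s : Set _) :=
              hfr.filter_mono nhdsWithin_le_nhds
            have h3 : t ∈ closure (p ⁻¹' convexHull ℝ (s : Set _)) :=
              mem_closure_iff_frequently.2 h2
            rwa [(hcl.preimage hpc).closure_eq] at h3
          refine (hfr.and_eventually self_mem_nhdsWithin).mono fun z hz => ?_
          have hz' : 0 < z - t := sub_pos.2 hz.2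
          rw [slope_def_field, hℓ s hs hz.1, hℓ s hs ht, div_lt_iff₀ hz']
          have e : ℓ s (p z) - ℓ s (p t) = (z - t) * (ℓ s).linear (y - x) := by
            have := (ℓ s).linearMap_vsub (p z) (p t)
            rw [vsub_eq_sub, vsub_eq_sub] at this
            rw [← this, ← smul_eq_mul, ← map_smul]
            congr 1
            simp only [hp]
            module
          rw [e]
          have := (le_abs_self _).trans (hC s hs (y - x))
          nlinarith
        · push Not at hfr
          have hall : ∀ᶠ z in nhdsWithin t (Set.Ioi t), u (p z) = 0 := by
            have := (Filter.eventually_all_finite 𝒯.finite_faces).2 hfr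
            filter_upwards [this] with z hz
            apply h0
            rw [Geometry.SimplicialComplex.mem_space_iff]
            rintro ⟨s, hs, h⟩
            exact hz s hs h
          have ht : u (p t) = 0 := by
            have h1 : Filter.Tendsto (fun z => u (p z)) (nhdsWithin t (Set.Ioi t))
              (nhds (u (p t))) := ((hc.comp hpc).tendsto t).mono_left nhdsWithin_le_nhds
            exact tendsto_nhds_unique h1 ((Filter.tendsto_congr' hall).2 tendsto_const_nhds)
          refine Filter.Eventually.frequently ?_
          filter_upwards [hall] with z hz
          rw [slope_def_field, hz, ht]
          have : 0 ≤ C * ‖y - x‖ := by positivity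
          simpa using this.trans_lt hr)
    have h1 := this (x := 1) (by simp)
    simp only [hp, one_smul, add_sub_cancel, mul_one] at h1
    linarith
  refine ⟨C.toNNReal, LipschitzWith.of_dist_le_mul fun x y => ?_⟩
  rw [Real.dist_eq, dist_eq_norm, abs_le, Real.coe_toNNReal C hC0]
  have h1 := key x y
  have h2 := key y x
  rw [norm_sub_rev] at h1
  constructor <;> linarith

end facts

/-- The inclusion of the finite element functions into `L²(Ω)`. -/
noncomputable def plToL2 {d : ℕ} {Ω : Set (EuclideanSpace ℝ (Fin d))} (𝒯 : Triangulation Ω) :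
    plSpace 𝒯 →ₗ[ℝ] L2 Ω where
  toFun u := (plSpace_memLp u.2).toLp u
  map_add' _ _ := rfl
  map_smul' _ _ := rfl

/-- The finite element space `X_h`, as a subspace of `L²(Ω)`. -/
noncomputable def femSpace {d : ℕ} {Ω : Set (EuclideanSpace ℝ (Fin d))} (𝒯 : Triangulation Ω) :
    Submodule ℝ (L2 Ω) :=
  LinearMap.range (plToL2 𝒯)

/-- The continuous piecewise linear representative of an element of `X_h`. -/
noncomputable def rep {d : ℕ} {Ω : Set (EuclideanSpace ℝ (Fin d))} {𝒯 : Triangulation Ω}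
    (φ : femSpace 𝒯) : plSpace 𝒯 :=
  φ.2.choose

theorem plToL2_rep {d : ℕ} {Ω : Set (EuclideanSpace ℝ (Fin d))} {𝒯 : Triangulation Ω}
    (φ : femSpace 𝒯) : plToL2 𝒯 (rep φ) = φ :=
  φ.2.choose_spec

instance finiteDimensional_plSpace {d : ℕ} {Ω : Set (EuclideanSpace ℝ (Fin d))}
    (𝒯 : Triangulation Ω) : FiniteDimensional ℝ (plSpace 𝒯) := by
  classical
  set S : Finset (EuclideanSpace ℝ (Fin d)) := 𝒯.finite_faces.toFinset.biUnion id with hS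
  let L : plSpace 𝒯 →ₗ[ℝ] (S → ℝ) :=
    { toFun := fun u x => u.1 x
      map_add' := fun _ _ => rfl
      map_smul' := fun _ _ => rfl }
  refine FiniteDimensional.of_injective L ((injective_iff_map_eq_zero L).2 fun u hu => ?_)
  obtain ⟨u, hc, h1, h2, h3⟩ := u
  have hv : ∀ s ∈ 𝒯.K.faces, ∀ x ∈ s, u x = 0 := fun s hs x hx =>
    congrFun hu ⟨x, Finset.mem_biUnion.2 ⟨s, 𝒯.finite_faces.mem_toFinset.2 hs, hx⟩⟩
  ext x
  change u x = 0
  by_cases hx : x ∈ 𝒯.K.space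
  · obtain ⟨s, hs, hxs⟩ := Geometry.SimplicialComplex.mem_space_iff.1 hx
    obtain ⟨ℓ, hℓ⟩ := h3 s hs
    rw [hℓ hxs]
    have hsub : convexHull ℝ (s : Set (EuclideanSpace ℝ (Fin d))) ⊆ ℓ ⁻¹' {0} :=
      convexHull_min (fun y hy => by
        have : ℓ y = 0 := by rw [← hℓ (subset_convexHull ℝ _ hy)]; exact hv s hs y hy
        exact this) ((convex_singleton (0 : ℝ)).affine_preimage ℓ)
    exact hsub hxs
  · exact h2 x hx

instance finiteDimensional_femSpace {d : ℕ} {Ω : Set (EuclideanSpace ℝ (Fin d))}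
    (𝒯 : Triangulation Ω) : FiniteDimensional ℝ (femSpace 𝒯) := by
  unfold femSpace; infer_instance

/-- The discrete operator `A_h : X_h → X_h`, determined by `(A_h φ, ψ) = A(φ, ψ)` for all
`ψ ∈ X_h` (see `inner_discreteOp` below), written in an orthonormal basis of `X_h`. -/
noncomputable def discreteOp {d : ℕ} {Ω : Set (EuclideanSpace ℝ (Fin d))} (𝒯 : Triangulation Ω)
    (a : EuclideanSpace ℝ (Fin d) → Matrix (Fin d) (Fin d) ℝ) (q : EuclideanSpace ℝ (Fin d) → ℝ)
    (φ : femSpace 𝒯) : femSpace 𝒯 :=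
  ∑ i, ellipticForm Ω a q (rep φ) (rep (stdOrthonormalBasis ℝ (femSpace 𝒯) i)) •
    stdOrthonormalBasis ℝ (femSpace 𝒯) i

section facts

variable {d : ℕ} {Ω : Set (EuclideanSpace ℝ (Fin d))} {𝒯 : Triangulation Ω}

theorem plToL2_injective (hΩ : IsOpen Ω) : Function.Injective (plToL2 𝒯) := by
  intro u v h
  have hae : (u : EuclideanSpace ℝ (Fin d) → ℝ) =ᵐ[volume.restrict Ω] v :=
    (MemLp.toLp_eq_toLp_iff (plSpace_memLp u.2) (plSpace_memLp v.2)).1 h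
  have hon := Measure.eqOn_open_of_ae_eq hae hΩ u.2.1.continuousOn v.2.1.continuousOn
  ext x
  by_cases hx : x ∈ Ω
  · exact hon hx
  · rw [u.2.2.1 x hx, v.2.2.1 x hx]

theorem integrable_ellipticForm {a : EuclideanSpace ℝ (Fin d) → Matrix (Fin d) (Fin d) ℝ}
    {q : EuclideanSpace ℝ (Fin d) → ℝ} (hΩ : IsOpen Ω) (hb : Bornology.IsBounded Ω)
    (hA : IsElliptic Ω a q) {u v : EuclideanSpace ℝ (Fin d) → ℝ} (hu : u ∈ plSpace 𝒯)
    (hv : v ∈ plSpace 𝒯) :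
    Integrable (fun x => (∑ i, ∑ j, a x i j * pderiv j u x * pderiv i v x) + q x * u x * v x)
      (volume.restrict Ω) := by
  obtain ⟨Ma, hMa⟩ := hA.bdd_a
  obtain ⟨Mq, hMq⟩ := hA.bdd_q
  have hfin : IsFiniteMeasure (volume.restrict Ω) :=
    ⟨by rw [Measure.restrict_apply_univ]; exact hb.measure_lt_top⟩
  have hpd : ∀ {w : EuclideanSpace ℝ (Fin d) → ℝ}, w ∈ plSpace 𝒯 → ∀ i,
      ∃ C : ℝ, Measurable (pderiv i w) ∧ ∀ x, ‖pderiv i w x‖ ≤ C := by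
    intro w hw i
    obtain ⟨C, hC⟩ := plSpace_lipschitz hw
    refine ⟨C * ‖(EuclideanSpace.single i (1 : ℝ) : EuclideanSpace ℝ (Fin d))‖,
      measurable_fderiv_apply_const ℝ w _, fun x => ?_⟩
    refine ((fderiv ℝ w x).le_opNorm _).trans ?_
    gcongr
    exact norm_fderiv_le_of_lipschitz ℝ hC
  have hbd : ∀ {w : EuclideanSpace ℝ (Fin d) → ℝ}, w ∈ plSpace 𝒯 → ∃ C : ℝ, ∀ x, ‖w x‖ ≤ C :=
    fun {w} hw => hw.1.bounded_above_of_compact_support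
      (HasCompactSupport.intro (isCompact_space 𝒯) fun x hx => hw.2.2.1 x hx)
  have h3 : ∀ {p r s : EuclideanSpace ℝ (Fin d) → ℝ} {P R S : ℝ},
      AEStronglyMeasurable p (volume.restrict Ω) → AEStronglyMeasurable r (volume.restrict Ω) →
      AEStronglyMeasurable s (volume.restrict Ω) → (∀ x ∈ Ω, ‖p x‖ ≤ P) → (∀ x, ‖r x‖ ≤ R) →
      (∀ x, ‖s x‖ ≤ S) → Integrable (fun x => p x * r x * s x) (volume.restrict Ω) := by
    intro p r s P R S hp hr hs hP hR hS
    refine Integrable.of_bound ((hp.mul hr).mul hs) (P * R * S) ?_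
    filter_upwards [ae_restrict_mem hΩ.measurableSet] with x hx
    rw [norm_mul, norm_mul]
    have hP' := hP x hx
    have hR' := hR x
    have hS' := hS x
    have := (norm_nonneg _).trans hP'
    have := (norm_nonneg _).trans hR'
    gcongr
  refine Integrable.add (integrable_finsetSum _ fun i _ => integrable_finsetSum _ fun j _ => ?_) ?_
  · obtain ⟨C, h1, h2⟩ := hpd hu j
    obtain ⟨C', h1', h2'⟩ := hpd hv i
    exact h3 (hA.meas_a i j) h1.aestronglyMeasurable h1'.aestronglyMeasurable
      (fun x hx => hMa x hx i j) h2 h2'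
  · obtain ⟨C, h1⟩ := hbd hu
    obtain ⟨C', h1'⟩ := hbd hv
    exact h3 hA.meas_q hu.1.aestronglyMeasurable hv.1.aestronglyMeasurable hMq h1 h1'

/-- The form, as a linear functional of its second argument. -/
noncomputable def formRight {a : EuclideanSpace ℝ (Fin d) → Matrix (Fin d) (Fin d) ℝ}
    {q : EuclideanSpace ℝ (Fin d) → ℝ} (hΩ : IsOpen Ω) (hb : Bornology.IsBounded Ω)
    (hA : IsElliptic Ω a q) (u : plSpace 𝒯) : plSpace 𝒯 →ₗ[ℝ] ℝ where
  toFun v := ellipticForm Ω a q u v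
  map_add' v w := by
    unfold ellipticForm
    rw [← integral_add (integrable_ellipticForm hΩ hb hA u.2 v.2)
      (integrable_ellipticForm hΩ hb hA u.2 w.2)]
    obtain ⟨C, hC⟩ := plSpace_lipschitz v.2
    obtain ⟨D, hD⟩ := plSpace_lipschitz w.2
    refine integral_congr_ae (ae_restrict_of_ae ?_)
    filter_upwards [hC.ae_differentiableAt (μ := volume), hD.ae_differentiableAt (μ := volume)]
      with x hx hy
    have e : ∀ i, pderiv i (v.1 + w.1) x =
        pderiv i v x + pderiv i w x := fun i => by
      simp only [pderiv, fderiv_add hx hy]; rfl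
    simp only [Submodule.coe_add, e, mul_add, Finset.sum_add_distrib, Pi.add_apply]
    ring
  map_smul' r v := by
    unfold ellipticForm
    rw [RingHom.id_apply, smul_eq_mul, ← integral_const_mul]
    obtain ⟨C, hC⟩ := plSpace_lipschitz v.2
    refine integral_congr_ae (ae_restrict_of_ae ?_)
    filter_upwards [hC.ae_differentiableAt (μ := volume)] with x hx
    have e : ∀ i, pderiv i (r • (v : EuclideanSpace ℝ (Fin d) → ℝ)) x =
        r * pderiv i v x := fun i => by
      simp only [pderiv, fderiv_const_smul hx]; rfl
    simp only [Submodule.coe_smul, e, Pi.smul_apply, smul_eq_mul, mul_add, Finset.mul_sum]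
    congr 1
    · exact Finset.sum_congr rfl fun i _ => Finset.sum_congr rfl fun j _ => by ring
    · ring

/-- `(A_h φ, ψ) = A(φ, ψ)` for all `φ, ψ ∈ X_h`. -/
theorem inner_discreteOp {a : EuclideanSpace ℝ (Fin d) → Matrix (Fin d) (Fin d) ℝ}
    {q : EuclideanSpace ℝ (Fin d) → ℝ} (hΩ : IsOpen Ω) (hb : Bornology.IsBounded Ω)
    (hA : IsElliptic Ω a q) (φ ψ : femSpace 𝒯) :
    inner ℝ (discreteOp 𝒯 a q φ) ψ = ellipticForm Ω a q (rep φ) (rep ψ) := by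
  set b := stdOrthonormalBasis ℝ (femSpace 𝒯) with hbdef
  have hrep : rep ψ = ∑ i, inner ℝ (b i) ψ • rep (b i) := by
    apply plToL2_injective hΩ
    rw [plToL2_rep, map_sum]
    simp only [map_smul, plToL2_rep]
    conv_lhs => rw [← b.sum_repr' ψ]
    simp
  have h : ellipticForm Ω a q (rep φ) (rep ψ) = formRight hΩ hb hA (rep φ) (rep ψ) := rfl
  rw [h, hrep, map_sum, discreteOp, sum_inner]
  refine Finset.sum_congr rfl fun i _ => ?_
  rw [map_smul, smul_eq_mul, mul_comm]
  exact real_inner_smul_left (F := femSpace 𝒯) _ _ _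

end facts

/-! ### Time derivatives, the semidiscrete problem and the Crank-Nicolson scheme -/

/-- On `[0,T]`, `g` is (the continuous representative of) a function in `W^{1,1}(0,T;G)` and `g'`
is its weak derivative. -/
def HasWeakDeriv {G : Type*} [NormedAddCommGroup G] [NormedSpace ℝ G] (T : ℝ) (g g' : ℝ → G) :
    Prop :=
  IntervalIntegrable g' volume 0 T ∧ ∀ t ∈ Set.Icc 0 T, g t = g 0 + ∫ ζ in 0..t, g' ζ

/-- The Caputo derivative `(1/Γ(1-α)) ∫_0^t (t-ζ)^(-α) u'(ζ) dζ`. -/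
noncomputable def caputo {V : Type*} [NormedAddCommGroup V] [NormedSpace ℝ V] (α : ℝ) (u : ℝ → V)
    (t : ℝ) : V :=
  (Real.Gamma (1 - α))⁻¹ • ∫ ζ in 0..t, (t - ζ) ^ (-α) • deriv u ζ

/-- `u` is an absolutely continuous solution on `[0,T]` of `D^α u + A u = f`, `u(0) = u₀`. For an
absolutely continuous `u` the integral defining the Caputo derivative converges at almost every
`t`, and the equation is required almost everywhere. -/
structure IsSemidiscreteSolution {V : Type*} [NormedAddCommGroup V] [NormedSpace ℝ V]
    (α T : ℝ) (A : V → V) (f : ℝ → V) (u₀ : V) (u : ℝ → V) : Prop where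
  abs_cont : HasWeakDeriv T u (deriv u)
  eqn : ∀ᵐ t ∂(volume.restrict (Set.Ioc 0 T)), caputo α u t + A (u t) = f t
  init : u 0 = u₀

/-- The Grünwald-Letnikov coefficients `σ_0 = 1`, `σ_j = (1 - (α+1)/j) σ_{j-1}`. -/
noncomputable def glCoeff (α : ℝ) : ℕ → ℝ
  | 0 => 1
  | j + 1 => (1 - (α + 1) / (j + 1)) * glCoeff α j

/-- `D_τ t^{2-α} / Γ(3-α)` at `t`, where `D_τ v(t) = τ⁻¹ (3/2 v(t) - 2 v(t-τ) + 1/2 v(t-2τ))` is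
the second-order BDF operator and the function `t^{2-α}` is prescribed by zero for `t ≤ 0`. -/
noncomputable def bdfPower (α τ t : ℝ) : ℝ :=
  τ⁻¹ * (3 / 2 * max t 0 ^ (2 - α) - 2 * max (t - τ) 0 ^ (2 - α)
    + 1 / 2 * max (t - 2 * τ) 0 ^ (2 - α)) / Real.Gamma (3 - α)

/-- The Crank-Nicolson scheme without corrections for `D^α u + A u = f`, `u(0) = u₀`, with step
size `τ = T / N`. The values `U n` for `n ≤ 0` are prescribed by zero, and `F(t) = ∫_0^t f`. -/
structure IsCrankNicolson {V : Type*} [NormedAddCommGroup V] [NormedSpace ℝ V]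
    (α τ : ℝ) (N : ℕ) (A : V → V) (f : ℝ → V) (u₀ : V) (U : ℤ → V) (u : ℕ → V) : Prop where
  nonpos : ∀ n : ℤ, n ≤ 0 → U n = 0
  step : ∀ n : ℕ, 1 ≤ n → n ≤ N →
    τ ^ (-α) • (∑ j ∈ Finset.range (n + 1), glCoeff α j • U ((n : ℤ) - j))
        + (1 - α / 2) • A (U n) + (α / 2) • A (U ((n : ℤ) - 1))
      = (1 - α / 2) • (∫ ξ in 0..((n : ℝ) * τ), f ξ)
        + (α / 2) • (∫ ξ in 0..(((n : ℝ) - 1) * τ), f ξ)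
        + ((1 - α / 2) * bdfPower α τ ((n : ℝ) * τ)) • u₀
        + ((α / 2) * bdfPower α τ (((n : ℝ) - 1) * τ)) • u₀
  value : ∀ n : ℕ, 1 ≤ n → n ≤ N →
    u n = τ⁻¹ • ((3 / 2 : ℝ) • U n - (2 : ℝ) • U ((n : ℤ) - 1) + (1 / 2 : ℝ) • U ((n : ℤ) - 2))

end SubDiff

/-!
The proof diagonalises `A_h`, compares the exact and the discrete solution of the resulting scalar
equations through their transforms, and takes care that every constant is uniform in the eigenvalue.

*Reduction to scalars.* `A_h` is symmetric and positive semidefinite on the finite-dimensional space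
`X_h` (`inner_discreteOp_comm`, `inner_discreteOp_self_nonneg`). In an orthonormal eigenbasis both
the semidiscrete problem and the scheme decouple into scalar ones with `μ ≥ 0` in place of `A_h`.
Since `f` is its Taylor polynomial of degree one plus `∫₀^t (t - ζ) f''(ζ) dζ`, the error in each
component is a superposition of three kernels that do not involve the data: the errors for the
initial value `1`, for the source `1` and for the source `(t - ζ)₊` (`scalar_error_eq`). Bounds for these
kernels that are uniform in `μ` (`exists_error_bounds`) are bounds for multipliers in the
eigenbasis, hence for operators (`abs_sum_multiplier_le`, `exists_norm_error_le`).

*Exact and discrete solution.* The exact scalar solution is given by variation of constants with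
Mittag-Leffler functions (`variation_of_constants`). The scheme is a convolution equation, so that
its solution is a coefficient of a quotient of power series (`IsCrankNicolson.eq_coeff`). Both
scale, which reduces the kernel bounds to `τ = 1`, and a source `(t - ζ)₊` may be shifted by full
steps until it sets in within the first step (`truncSqSeries_eq`).

*Kernel bounds.* For `τ = 1` the exact response at `t = n` is an inverse Laplace integral over the
line `Re z = 1 / n`, and the discrete one is Cauchy's integral for the `n`-th coefficient over the
segment `|Im z| ≤ π` of the same line, by the substitution `ζ = exp (-z)`; here `exp (n z)` is
bounded. With `x = 1 - exp (-z)` and `Θ = 1 - α x / 2` the solution operators are `1 / (z ^ α + μ)`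
and `Θ / (x ^ α + μ Θ)`. Because `x ^ α = z ^ α (1 - α z / 2 + O(z ^ 2))`, they agree up to a factor
`1 + O(z ^ 2)` (`cpow_bdiff_expansion`, `exists_sector`), and so do the transformed data
(`powSymbol_expansion`, `linSymbol_expansion`, `quadSymbol_expansion`), the first of them by Poisson
summation (`psum_powSeries`). All of this holds in a sector slightly larger than the right
half-plane, where `z ^ α`, `x ^ α` and `Θ` still have positive real part; this makes the bounds
uniform in `μ ≥ 0`, and gives bounds for derivatives by Cauchy's estimate. Integrating by parts `k`
times produces a factor `n ^ (-k)` and makes the integrals converge; two extra powers of `z` in the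
difference of the transforms become two extra powers of `1 / n` (`norm_sub_coeff_le`).
-/

namespace SubDiff

open Set Filter Topology

/-! ### Laplace transforms of powers and their inversion -/

theorem norm_rpow_mul_cexp (s : ℝ) (z : ℂ) {t : ℝ} (ht : t ∈ Ioi (0 : ℝ)) :
    ‖((t ^ s : ℝ) : ℂ) * Complex.exp (-(z * t))‖ = t ^ s * Real.exp (-z.re * t) := by
  rw [norm_mul, Complex.norm_real, Complex.norm_exp, Real.norm_of_nonneg
    (Real.rpow_nonneg (le_of_lt ht) _)]
  simp

theorem measurable_rpow_mul_cexp (s : ℝ) (z : ℂ) :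
    Measurable fun t : ℝ => ((t ^ s : ℝ) : ℂ) * Complex.exp (-(z * t)) := by
  fun_prop

theorem integrableOn_rpow_mul_exp_neg {s b : ℝ} (hs : -1 < s) (hb : 0 < b) :
    IntegrableOn (fun t : ℝ => t ^ s * Real.exp (-b * t)) (Ioi 0) := by
  simpa using integrableOn_rpow_mul_exp_neg_mul_rpow (p := 1) hs one_pos hb

theorem integrableOn_rpow_mul_cexp {s : ℝ} (hs : -1 < s) {z : ℂ} (hz : 0 < z.re) :
    IntegrableOn (fun t : ℝ => ((t ^ s : ℝ) : ℂ) * Complex.exp (-(z * t))) (Ioi 0) := by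
  refine (integrableOn_rpow_mul_exp_neg hs hz).mono'
    (measurable_rpow_mul_cexp s z).aestronglyMeasurable ?_
  filter_upwards [ae_restrict_mem measurableSet_Ioi] with t ht
  rw [norm_rpow_mul_cexp s z ht]

theorem isOpen_re_pos : IsOpen {z : ℂ | 0 < z.re} :=
  isOpen_lt continuous_const Complex.continuous_re

/-- The Laplace transform of `t ^ s` on the open right half-plane; it is the analytic continuation
of the case of real `z`, which is the definition of the Gamma function. -/
theorem laplace_rpow {s : ℝ} (hs : -1 < s) {z : ℂ} (hz : 0 < z.re) :
    ∫ t in Ioi (0 : ℝ), ((t ^ s : ℝ) : ℂ) * Complex.exp (-(z * t))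
      = (Real.Gamma (s + 1) : ℂ) * z ^ ((-(s + 1) : ℝ) : ℂ) := by
  have hd1 : DifferentiableOn ℂ (fun z : ℂ => ∫ t in Ioi (0 : ℝ),
      ((t ^ s : ℝ) : ℂ) * Complex.exp (-(z * t))) {z : ℂ | 0 < z.re} := by
    intro w (hw : 0 < w.re)
    have hball : {v : ℂ | w.re / 2 < v.re} ∈ 𝓝 w :=
      (isOpen_lt continuous_const Complex.continuous_re).mem_nhds (by simpa using hw)
    refine (hasDerivAt_integral_of_dominated_loc_of_deriv_le
      (F' := fun (v : ℂ) (t : ℝ) => -(((t ^ (s + 1) : ℝ) : ℂ) * Complex.exp (-(v * t))))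
      (bound := fun t => t ^ (s + 1) * Real.exp (-(w.re / 2) * t)) hball
      (Eventually.of_forall fun v => (measurable_rpow_mul_cexp s v).aestronglyMeasurable)
      (integrableOn_rpow_mul_cexp hs hw)
      (measurable_rpow_mul_cexp (s + 1) w).neg.aestronglyMeasurable ?_
      (integrableOn_rpow_mul_exp_neg (by linarith) (by linarith)) ?_).2.differentiableAt
      |>.differentiableWithinAt
    · filter_upwards [ae_restrict_mem measurableSet_Ioi] with t ht v hv
      rw [norm_neg, norm_rpow_mul_cexp _ _ ht]
      have h1 : (0 : ℝ) < t := ht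
      have h2 : w.re / 2 < v.re := hv
      gcongr
    · filter_upwards [ae_restrict_mem measurableSet_Ioi] with t ht v hv
      have h1 : (0 : ℝ) < t := ht
      have h2 : HasDerivAt (fun v : ℂ => -(v * (t : ℂ))) (-(t : ℂ)) v := by
        simpa using ((hasDerivAt_id v).mul_const (t : ℂ)).fun_neg
      convert! h2.cexp.const_mul ((t ^ s : ℝ) : ℂ) using 1
      rw [Real.rpow_add h1, Real.rpow_one]
      push_cast
      ring
  have hd2 : DifferentiableOn ℂ (fun z : ℂ => (Real.Gamma (s + 1) : ℂ) *
      z ^ ((-(s + 1) : ℝ) : ℂ)) {z : ℂ | 0 < z.re} := by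
    intro w (hw : 0 < w.re)
    exact ((differentiableAt_id.cpow_const (Or.inl hw)).const_mul _).differentiableWithinAt
  -- by the identity theorem it suffices to consider real `z`
  refine AnalyticOnNhd.eqOn_of_preconnected_of_frequently_eq (z₀ := 1)
    (hd1.analyticOnNhd isOpen_re_pos) (hd2.analyticOnNhd isOpen_re_pos)
    (convex_halfSpace_re_gt 0).isPreconnected (by simp) ?_ hz
  have hreal : ∀ r : ℝ, 0 < r → ∫ t in Ioi (0 : ℝ), ((t ^ s : ℝ) : ℂ) * Complex.exp (-((r : ℂ) * t))
      = (Real.Gamma (s + 1) : ℂ) * (r : ℂ) ^ ((-(s + 1) : ℝ) : ℂ) := by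
    intro r hr
    have := Complex.integral_cpow_mul_exp_neg_mul_Ioi (a := ((s + 1 : ℝ) : ℂ)) (r := r)
      (by simpa using (by linarith : 0 < s + 1)) hr
    rw [Complex.Gamma_ofReal, mul_comm] at this
    rw [← Complex.ofReal_cpow hr.le, Real.rpow_neg hr.le, ← Real.inv_rpow hr.le,
      Complex.ofReal_cpow (inv_nonneg.2 hr.le)]
    push_cast at this ⊢
    rw [← one_div, ← this]
    refine setIntegral_congr_fun measurableSet_Ioi fun t ht => ?_
    have ht' : (0 : ℝ) ≤ t := le_of_lt ht
    simp only [add_sub_cancel_right]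
    rw [Complex.ofReal_cpow ht']
  have hseq : Tendsto (fun n : ℕ => (((1 + 1 / ((n : ℝ) + 1) : ℝ)) : ℂ)) atTop (𝓝[≠] 1) := by
    refine tendsto_nhdsWithin_iff.2 ⟨?_, Eventually.of_forall fun n => ?_⟩
    · have := (tendsto_one_div_add_atTop_nhds_zero_nat (𝕜 := ℝ)).const_add 1
      rw [add_zero] at this
      exact_mod_cast (Complex.continuous_ofReal.tendsto _).comp this
    · have : (0 : ℝ) < 1 / ((n : ℝ) + 1) := by positivity
      simp only [mem_compl_iff, mem_singleton_iff]
      intro h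
      have h' : (1 + 1 / ((n : ℝ) + 1) : ℝ) = 1 := by exact_mod_cast h
      linarith
  exact hseq.frequently (Eventually.of_forall fun n => hreal _ (by positivity)).frequently

/-- The Fourier transform of the truncated function `x_+ ^ s * exp (-z x)`. -/
theorem fourier_rpow_mul_cexp {s : ℝ} (hs : -1 < s) {z : ℂ} (hz : 0 < z.re) (ξ : ℝ) :
    FourierTransform.fourier (fun x : ℝ => (Ioi (0 : ℝ)).indicator
      (fun x : ℝ => ((x ^ s : ℝ) : ℂ) * Complex.exp (-(z * x))) x) ξ
      = (Real.Gamma (s + 1) : ℂ) *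
        (z + ((2 * Real.pi * ξ : ℝ) : ℂ) * Complex.I) ^ ((-(s + 1) : ℝ) : ℂ) := by
  rw [Real.fourier_real_eq_integral_exp_smul, ← laplace_rpow hs
    (by simpa using hz), ← integral_indicator measurableSet_Ioi]
  congr 1
  ext x
  simp only [indicator_apply]
  split_ifs
  · rw [smul_eq_mul, mul_left_comm, ← Complex.exp_add]
    congr 2
    push_cast
    ring
  · simp

/-! ### Integrals along vertical lines -/

/-- The point of the line `Re z = c` with imaginary part `θ`. -/
noncomputable def vline (c θ : ℝ) : ℂ := (c : ℂ) + θ * Complex.I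

@[simp] theorem vline_re (c θ : ℝ) : (vline c θ).re = c := by simp [vline]

@[simp] theorem vline_im (c θ : ℝ) : (vline c θ).im = θ := by simp [vline]

theorem continuous_vline (c : ℝ) : Continuous (vline c) := by unfold vline; fun_prop

theorem hasDerivAt_vline (c θ : ℝ) : HasDerivAt (vline c) Complex.I θ := by
  change HasDerivAt (fun x : ℝ => (c : ℂ) + x * Complex.I) _ _
  simpa using (Complex.ofRealCLM.hasDerivAt (x := θ)).mul_const Complex.I

theorem vline_ne_zero {c : ℝ} (hc : 0 < c) (θ : ℝ) : vline c θ ≠ 0 := fun h => by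
  have := vline_re c θ; rw [h] at this; simp at this; linarith

theorem vline_mem_slitPlane {c : ℝ} (hc : 0 < c) (θ : ℝ) : vline c θ ∈ Complex.slitPlane :=
  Or.inl (by simpa using hc)

theorem le_norm_vline (c θ : ℝ) : c ≤ ‖vline c θ‖ := by
  simpa using Complex.re_le_norm (vline c θ)

theorem norm_vline_pos {c : ℝ} (hc : 0 < c) (θ : ℝ) : 0 < ‖vline c θ‖ :=
  norm_pos_iff.2 (vline_ne_zero hc θ)

theorem norm_cexp_vline (t c θ : ℝ) : ‖Complex.exp (t * vline c θ)‖ = Real.exp (t * c) := by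
  rw [Complex.norm_exp]; simp

theorem norm_vline_scale {c : ℝ} (hc : 0 < c) (θ : ℝ) : ‖vline c θ‖ = c * ‖vline 1 (θ / c)‖ := by
  have : vline c θ = (c : ℂ) * vline 1 (θ / c) := by
    unfold vline
    push_cast
    have : (c : ℂ) ≠ 0 := by exact_mod_cast hc.ne'
    field_simp
  rw [this, norm_mul, Complex.norm_real, Real.norm_of_nonneg hc.le]

theorem integrable_norm_vline_one {p : ℝ} (hp : 1 < p) :
    Integrable fun θ : ℝ => ‖vline 1 θ‖ ^ (-p) := by
  refine (integrable_rpow_neg_one_add_norm_sq (E := ℝ) (μ := volume) (r := p)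
    (by simpa using hp)).congr (Eventually.of_forall fun θ => ?_)
  have : ‖vline 1 θ‖ = (1 + ‖θ‖ ^ 2) ^ (1 / 2 : ℝ) := by
    rw [Complex.norm_eq_sqrt_sq_add_sq, Real.sqrt_eq_rpow]; simp
  simp only
  rw [this, ← Real.rpow_mul (by positivity)]
  congr 1; ring

theorem norm_vline_rpow {c : ℝ} (hc : 0 < c) (p : ℝ) :
    (fun θ : ℝ => ‖vline c θ‖ ^ (-p)) = fun θ => c ^ (-p) * ‖vline 1 (θ / c)‖ ^ (-p) := by
  ext θ
  rw [norm_vline_scale hc, Real.mul_rpow hc.le (norm_nonneg _)]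

theorem integrable_norm_vline {c p : ℝ} (hc : 0 < c) (hp : 1 < p) :
    Integrable fun θ : ℝ => ‖vline c θ‖ ^ (-p) := by
  rw [norm_vline_rpow hc]
  exact ((integrable_norm_vline_one hp).comp_div hc.ne').const_mul _

theorem integral_norm_vline {c : ℝ} (hc : 0 < c) (p : ℝ) :
    ∫ θ : ℝ, ‖vline c θ‖ ^ (-p) = c ^ (1 - p) * ∫ θ : ℝ, ‖vline 1 θ‖ ^ (-p) := by
  rw [norm_vline_rpow hc, integral_const_mul,
    Measure.integral_comp_div (fun θ => ‖vline 1 θ‖ ^ (-p)), abs_of_pos hc, smul_eq_mul,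
    ← mul_assoc, sub_eq_neg_add, Real.rpow_add hc, Real.rpow_one]

theorem continuous_vline_cpow {c : ℝ} (hc : 0 < c) (s : ℂ) :
    Continuous fun θ : ℝ => vline c θ ^ s :=
  (continuous_vline c).cpow continuous_const fun θ => vline_mem_slitPlane hc θ

/-- Inversion of the Laplace transform of a power, on any vertical line. -/
theorem rpow_inversion {s t c : ℝ} (hs : 0 < s) (ht : 0 < t) (hc : 0 < c) :
    ∫ θ : ℝ, Complex.exp (t * vline c θ) * vline c θ ^ ((-(s + 1) : ℝ) : ℂ)
      = ((2 * Real.pi * (t ^ s / Real.Gamma (s + 1)) : ℝ) : ℂ) := by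
  set f : ℝ → ℂ := fun x => (Ioi (0 : ℝ)).indicator
    (fun x : ℝ => ((x ^ s : ℝ) : ℂ) * Complex.exp (-((c : ℂ) * x))) x with hf
  have hfi : Integrable f := (integrable_indicator_iff measurableSet_Ioi).2
    (integrableOn_rpow_mul_cexp (by linarith) (by simpa using hc))
  have hfour : ∀ ξ : ℝ, FourierTransform.fourier f ξ = (Real.Gamma (s + 1) : ℂ) *
      vline c (2 * Real.pi * ξ) ^ ((-(s + 1) : ℝ) : ℂ) := by
    intro ξ
    exact fourier_rpow_mul_cexp (by linarith) (by simpa using hc) ξ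
  have hint : Integrable (FourierTransform.fourier f) := by
    have : FourierTransform.fourier f = fun ξ => (Real.Gamma (s + 1) : ℂ) *
      vline c (2 * Real.pi * ξ) ^ ((-(s + 1) : ℝ) : ℂ) := funext hfour
    rw [this]
    refine Integrable.const_mul ?_ _
    have h2 : Integrable fun θ : ℝ => vline c θ ^ ((-(s + 1) : ℝ) : ℂ) := by
      refine (integrable_norm_vline hc (by linarith : 1 < s + 1)).mono'
        (continuous_vline_cpow hc _).aestronglyMeasurable (Eventually.of_forall fun θ => ?_)
      rw [Complex.norm_cpow_real]
    exact h2.comp_mul_left' (by positivity)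
  have hcont : ContinuousAt f t := by
    have : f =ᶠ[𝓝 t] fun x : ℝ => ((x ^ s : ℝ) : ℂ) * Complex.exp (-((c : ℂ) * x)) := by
      filter_upwards [Ioi_mem_nhds ht] with x hx
      simp only [hf, indicator_of_mem hx]
    refine ContinuousAt.congr ?_ this.symm
    have h1 : ContinuousAt (fun x : ℝ => x ^ s) t :=
      Real.continuousAt_rpow_const _ _ (Or.inl ht.ne')
    have h2 : ContinuousAt (fun x : ℝ => ((x ^ s : ℝ) : ℂ)) t :=
      Complex.continuous_ofReal.continuousAt.comp h1
    exact h2.mul (by fun_prop)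
  have key := hfi.fourierInv_fourier_eq hint hcont
  rw [Real.fourierInv_eq'] at key
  have hft : f t = ((t ^ s : ℝ) : ℂ) * Complex.exp (-((c : ℂ) * t)) := by
    simp only [hf, indicator_of_mem (show t ∈ Ioi (0 : ℝ) from ht)]
  rw [hft] at key
  have hG : (Real.Gamma (s + 1) : ℂ) ≠ 0 := by
    exact_mod_cast (Real.Gamma_pos_of_pos (by linarith)).ne'
  have e1 : ∀ v : ℝ, Complex.exp (((2 * Real.pi * inner ℝ v t : ℝ) : ℂ) * Complex.I) •
      FourierTransform.fourier f v = Complex.exp (-((c : ℂ) * t)) * (Real.Gamma (s + 1) : ℂ) *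
      (fun θ : ℝ => Complex.exp (t * vline c θ) * vline c θ ^ ((-(s + 1) : ℝ) : ℂ))
        (2 * Real.pi * v) := by
    intro v
    rw [hfour, smul_eq_mul]
    simp only
    have : Complex.exp (((2 * Real.pi * inner ℝ v t : ℝ) : ℂ) * Complex.I) =
        Complex.exp (-((c : ℂ) * t)) * Complex.exp (t * vline c (2 * Real.pi * v)) := by
      rw [← Complex.exp_add]
      congr 1
      unfold vline
      simp
      ring
    rw [this]
    ring
  rw [integral_congr_ae (Eventually.of_forall e1), integral_const_mul,
    Measure.integral_comp_mul_left (fun θ : ℝ => Complex.exp (t * vline c θ) *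
      vline c θ ^ ((-(s + 1) : ℝ) : ℂ)) (2 * Real.pi)] at key
  have hE := Complex.exp_ne_zero (-((c : ℂ) * t))
  have key2 : (Real.Gamma (s + 1) : ℂ) * ((|(2 * Real.pi)⁻¹| : ℝ) • ∫ θ : ℝ,
      Complex.exp (t * vline c θ) * vline c θ ^ ((-(s + 1) : ℝ) : ℂ)) = ((t ^ s : ℝ) : ℂ) := by
    apply mul_left_cancel₀ hE
    rw [← mul_assoc, key, mul_comm]
  rw [abs_of_pos (by positivity), Complex.real_smul] at key2
  have hpi : (Real.pi : ℂ) ≠ 0 := by exact_mod_cast Real.pi_ne_zero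
  push_cast at key2 ⊢
  rw [← key2]
  field_simp

/-! ### Shifting the contour and integrating by parts -/

theorem integrable_cexp_mul {t c : ℝ} {G : ℝ → ℂ} (hG : Integrable G) :
    Integrable fun θ : ℝ => Complex.exp (t * vline c θ) * G θ := by
  refine hG.bdd_mul (c := Real.exp (t * c)) ?_ (Eventually.of_forall fun θ => ?_)
  · have := continuous_vline c
    exact Continuous.aestronglyMeasurable (by fun_prop)
  · rw [norm_cexp_vline]

theorem continuous_comp_vline {F : ℂ → ℂ} (hF : DifferentiableOn ℂ F {z | 0 < z.re}) {c : ℝ}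
    (hc : 0 < c) : Continuous fun θ => F (vline c θ) :=
  hF.continuousOn.comp_continuous (continuous_vline c) fun θ => by simpa using hc

theorem integrable_comp_vline {F : ℂ → ℂ} {C p c : ℝ} (hF : DifferentiableOn ℂ F {z | 0 < z.re})
    (hp : 1 < p) (hc : 0 < c) (hb : ∀ θ, ‖F (vline c θ)‖ ≤ C * ‖vline c θ‖ ^ (-p)) :
    Integrable fun θ => F (vline c θ) :=
  ((integrable_norm_vline hc hp).const_mul C).mono'
    (continuous_comp_vline hF hc).aestronglyMeasurable (Eventually.of_forall hb)

/-- The inverse Laplace integral does not depend on the vertical line in the right half-plane. -/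
theorem contour_shift {F : ℂ → ℂ} {C p : ℝ} (hF : DifferentiableOn ℂ F {z | 0 < z.re})
    (hp : 1 < p) (hb : ∀ z : ℂ, 0 < z.re → ‖F z‖ ≤ C * ‖z‖ ^ (-p)) (t : ℝ) {a b : ℝ}
    (ha : 0 < a) (hab : a ≤ b) :
    ∫ θ : ℝ, Complex.exp (t * vline a θ) * F (vline a θ)
      = ∫ θ : ℝ, Complex.exp (t * vline b θ) * F (vline b θ) := by
  set f : ℂ → ℂ := fun z => Complex.exp (t * z) * F z with hf
  have hfd : DifferentiableOn ℂ f {z | 0 < z.re} :=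
    (by fun_prop : Differentiable ℂ fun z : ℂ => Complex.exp (t * z)).differentiableOn.mul hF
  have hC : 0 ≤ C := by
    have := (norm_nonneg _).trans (hb 1 (by simp))
    simpa using this
  have hint : ∀ c : ℝ, 0 < c → Tendsto (fun R : ℝ => ∫ y in (-R)..R, f (vline c y)) atTop
      (𝓝 (∫ θ : ℝ, f (vline c θ))) := fun c hc =>
    intervalIntegral_tendsto_integral (integrable_cexp_mul (integrable_comp_vline hF hp hc
      fun θ => hb _ (by simpa using hc))) tendsto_neg_atTop_atBot tendsto_id
  -- the integrals over the horizontal sides of the rectangle `[a, b] × [-R, R]` vanish as `R → ∞`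
  have hor : ∀ σ : ℝ, σ ^ 2 = 1 →
      Tendsto (fun R : ℝ => ∫ x in a..b, f (x + ((σ * R : ℝ) : ℂ) * Complex.I)) atTop (𝓝 0) := by
    intro σ hσ
    have hσ' : |σ| = 1 := by
      rcases sq_eq_one_iff.1 hσ with h | h <;> simp [h]
    have hlim : Tendsto (fun R : ℝ => (Real.exp (|t| * b) * (C * R ^ (-p))) * |b - a|) atTop
        (𝓝 0) := by
      have := (tendsto_rpow_neg_atTop (y := p) (by linarith)).const_mul
        (Real.exp (|t| * b) * C * |b - a|)
      rw [mul_zero] at this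
      refine this.congr fun R => ?_
      ring
    refine squeeze_zero_norm' ?_ hlim
    filter_upwards [eventually_gt_atTop 0] with R hR
    refine intervalIntegral.norm_integral_le_of_norm_le_const fun x hx => ?_
    rw [uIoc_of_le hab] at hx
    have hx0 : 0 < x := ha.trans hx.1
    have hv : (x : ℂ) + ((σ * R : ℝ) : ℂ) * Complex.I = vline x (σ * R) := rfl
    rw [hv, hf, norm_mul, norm_cexp_vline]
    have h1 : R ≤ ‖vline x (σ * R)‖ := by
      have := Complex.abs_im_le_norm (vline x (σ * R))
      rwa [vline_im, abs_mul, hσ', one_mul, abs_of_pos hR] at this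
    have h2 : t * x ≤ |t| * b :=
      (mul_le_mul_of_nonneg_right (le_abs_self t) hx0.le).trans
        (mul_le_mul_of_nonneg_left hx.2 (abs_nonneg t))
    have h3 : ‖F (vline x (σ * R))‖ ≤ C * R ^ (-p) :=
      (hb _ (by simpa using hx0)).trans (mul_le_mul_of_nonneg_left
        (Real.rpow_le_rpow_of_nonpos hR h1 (by linarith)) hC)
    gcongr
  have hrect : ∀ R : ℝ, (∫ x in a..b, f (x + ((-1 * R : ℝ) : ℂ) * Complex.I))
      - (∫ x in a..b, f (x + ((1 * R : ℝ) : ℂ) * Complex.I))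
      + Complex.I • (∫ y in (-R)..R, f (vline b y))
      - Complex.I • (∫ y in (-R)..R, f (vline a y)) = 0 := by
    intro R
    have := Complex.integral_boundary_rect_eq_zero_of_differentiableOn f (vline a (-R)) (vline b R)
      (hfd.mono fun z hz => ?_)
    · simpa only [vline_re, vline_im, neg_one_mul, one_mul] using! this
    · have h1 := hz.1
      simp only [vline_re, mem_preimage, uIcc_of_le hab] at h1
      exact ha.trans_le h1.1
  have hl := (((hor (-1) (by norm_num)).sub (hor 1 (by norm_num))).add
    ((hint b (ha.trans_le hab)).const_smul Complex.I)).sub ((hint a ha).const_smul Complex.I)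
  have h0 := tendsto_nhds_unique hl (tendsto_const_nhds.congr fun R => (hrect R).symm)
  rw [sub_zero, zero_add, ← smul_sub, smul_eq_zero, sub_eq_zero] at h0
  exact (h0.resolve_left Complex.I_ne_zero).symm

/-- Multiplication of the original by `t` corresponds to `-d/dz` on the transform. -/
theorem vline_integral_by_parts {F : ℂ → ℂ} (hF : DifferentiableOn ℂ F {z | 0 < z.re}) {t c : ℝ}
    (hc : 0 < c) (h0 : Integrable fun θ => F (vline c θ))
    (h1 : Integrable fun θ => deriv F (vline c θ)) :
    (t : ℂ) * ∫ θ : ℝ, Complex.exp (t * vline c θ) * F (vline c θ)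
      = -∫ θ : ℝ, Complex.exp (t * vline c θ) * deriv F (vline c θ) := by
  have hu : ∀ θ : ℝ, HasDerivAt (fun θ : ℝ => Complex.exp (t * vline c θ))
      (Complex.exp (t * vline c θ) * (t * Complex.I)) θ := fun θ =>
    ((hasDerivAt_vline c θ).const_mul (t : ℂ)).cexp
  have hv : ∀ θ : ℝ,
      HasDerivAt (fun θ : ℝ => F (vline c θ)) (deriv F (vline c θ) * Complex.I) θ := by
    intro θ
    have hd : HasDerivAt F (deriv F (vline c θ)) (vline c θ) :=
      (hF.differentiableAt (isOpen_re_pos.mem_nhds (by simpa using hc))).hasDerivAt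
    simpa [mul_comm] using! hd.scomp θ (hasDerivAt_vline c θ)
  have := integral_mul_deriv_eq_deriv_mul_of_integrable (fun θ _ => hu θ) (fun θ _ => hv θ)
    (by simpa [mul_assoc] using! (integrable_cexp_mul (t := t) (c := c) (h1.mul_const Complex.I)))
    (by
      have := (integrable_cexp_mul (t := t) (c := c) h0).const_mul (t * Complex.I)
      refine this.congr (Eventually.of_forall fun θ => ?_)
      simp only [Pi.mul_apply]; ring)
    (integrable_cexp_mul h0)
  have e1 : ∫ θ : ℝ, Complex.exp (t * vline c θ) * (deriv F (vline c θ) * Complex.I) =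
      (∫ θ : ℝ, Complex.exp (t * vline c θ) * deriv F (vline c θ)) * Complex.I := by
    rw [← integral_mul_const]; simp only [mul_assoc]
  have e2 : ∫ θ : ℝ, Complex.exp (t * vline c θ) * (t * Complex.I) * F (vline c θ) =
      (t * ∫ θ : ℝ, Complex.exp (t * vline c θ) * F (vline c θ)) * Complex.I := by
    rw [← integral_const_mul, ← integral_mul_const]
    congr 1; ext θ; ring
  rw [e1, e2, ← neg_mul] at this
  rw [mul_right_cancel₀ Complex.I_ne_zero this, neg_neg]

theorem differentiableOn_iteratedDeriv {F : ℂ → ℂ} {s : Set ℂ} (hs : IsOpen s)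
    (hF : DifferentiableOn ℂ F s) (k : ℕ) : DifferentiableOn ℂ (iteratedDeriv k F) s := by
  induction k with
  | zero => simpa using hF
  | succ k ih => rw [iteratedDeriv_succ]; exact ih.deriv hs

theorem vline_integral_by_parts_iterate {F : ℂ → ℂ} (hF : DifferentiableOn ℂ F {z | 0 < z.re})
    {t c : ℝ} (hc : 0 < c) (k : ℕ)
    (h : ∀ j ≤ k, Integrable fun θ => iteratedDeriv j F (vline c θ)) :
    (t : ℂ) ^ k * ∫ θ : ℝ, Complex.exp (t * vline c θ) * F (vline c θ)
      = (-1) ^ k * ∫ θ : ℝ, Complex.exp (t * vline c θ) * iteratedDeriv k F (vline c θ) := by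
  induction k with
  | zero => simp
  | succ k ih =>
    rw [pow_succ', mul_assoc, ih fun j hj => h j (hj.trans k.le_succ), mul_left_comm,
      vline_integral_by_parts (differentiableOn_iteratedDeriv isOpen_re_pos hF k) hc (h k k.le_succ)
      (by simpa only [← iteratedDeriv_succ] using h (k + 1) le_rfl), ← iteratedDeriv_succ, pow_succ]
    ring

/-! ### Mittag-Leffler functions -/

/-- `t ^ β E_{α, β + 1}(-μ t ^ α)`, with the two-parameter Mittag-Leffler function `E`. -/
noncomputable def mlf (α β μ t : ℝ) : ℝ :=
  ∑' k : ℕ, (-μ) ^ k * (t ^ (α * k + β) / Real.Gamma (α * k + β + 1))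

/-- This follows from `Γ(s + 1) ≥ ∫_t^∞ exp (-x) x ^ s dx ≥ t ^ s exp (-t)`. -/
theorem rpow_div_Gamma_le {s t : ℝ} (hs : 0 ≤ s) (ht : 0 ≤ t) :
    t ^ s / Real.Gamma (s + 1) ≤ Real.exp t := by
  have hG : 0 < Real.Gamma (s + 1) := Real.Gamma_pos_of_pos (by linarith)
  rw [div_le_iff₀ hG, Real.Gamma_eq_integral (by linarith)]
  have hi := Real.GammaIntegral_convergent (s := s + 1) (by linarith)
  have h1 : ∫ x in Ioi t, Real.exp (-x) * t ^ s ≤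
      ∫ x in Ioi t, Real.exp (-x) * x ^ (s + 1 - 1) := by
    refine setIntegral_mono_on ((integrableOn_exp_neg_Ioi t).mul_const _)
      (hi.mono_set (Ioi_subset_Ioi ht)) measurableSet_Ioi fun x hx => ?_
    have : t ≤ x := le_of_lt hx
    rw [add_sub_cancel_right]
    gcongr
  have h2 : ∫ x in Ioi t, Real.exp (-x) * x ^ (s + 1 - 1) ≤
      ∫ x in Ioi 0, Real.exp (-x) * x ^ (s + 1 - 1) :=
    setIntegral_mono_set hi (by
      filter_upwards [ae_restrict_mem measurableSet_Ioi] with x hx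
      have : (0 : ℝ) < x := hx
      simp only [Pi.zero_apply]
      positivity) (Ioi_subset_Ioi ht).eventuallyLE
  rw [integral_mul_const, integral_exp_neg_Ioi] at h1
  calc t ^ s = Real.exp t * (Real.exp (-t) * t ^ s) := by
        rw [← mul_assoc, ← Real.exp_add]; simp
    _ ≤ _ := by gcongr; exact h1.trans h2

theorem rpow_div_Gamma_le_scaled {s t c : ℝ} (hs : 0 ≤ s) (ht : 0 ≤ t) (hc : 0 < c) :
    t ^ s / Real.Gamma (s + 1) ≤ c ^ (-s) * Real.exp (c * t) := by
  have := rpow_div_Gamma_le hs (mul_nonneg hc.le ht)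
  rw [Real.mul_rpow hc.le ht, mul_div_assoc] at this
  calc t ^ s / Real.Gamma (s + 1) = c ^ (-s) * (c ^ s * (t ^ s / Real.Gamma (s + 1))) := by
        rw [← mul_assoc, ← Real.rpow_add hc]; simp
    _ ≤ _ := by gcongr

/-- The terms of the Mittag-Leffler series are dominated by a geometric series, which converges if
`c` is large. -/
theorem mlf_term_bound {α β μ t c : ℝ} (hα : 0 ≤ α) (hβ : 0 ≤ β) (ht : 0 ≤ t) (hc : 0 < c)
    (k : ℕ) :
    ‖(-μ) ^ k * (t ^ (α * k + β) / Real.Gamma (α * k + β + 1))‖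
      ≤ (|μ| * c ^ (-α)) ^ k * (c ^ (-β) * Real.exp (c * t)) := by
  have hs : 0 ≤ α * k + β := by positivity
  have hG : 0 < Real.Gamma (α * k + β + 1) := Real.Gamma_pos_of_pos (by linarith)
  rw [norm_mul, norm_pow, norm_neg, Real.norm_eq_abs, Real.norm_of_nonneg (by positivity), mul_pow,
    mul_assoc]
  refine mul_le_mul_of_nonneg_left ((rpow_div_Gamma_le_scaled hs ht hc).trans_eq ?_) (by positivity)
  rw [neg_add, Real.rpow_add hc, ← neg_mul, Real.rpow_mul hc.le, Real.rpow_natCast, mul_assoc]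

theorem exists_geometric_rate {α : ℝ} (hα : 0 < α) (μ : ℝ) :
    ∃ c₀ : ℝ, 0 < c₀ ∧ ∀ c, c₀ ≤ c → |μ| * c ^ (-α) < 1 := by
  refine ⟨(|μ| + 1) ^ α⁻¹, by positivity, fun c hc => ?_⟩
  have hc0 : 0 < (|μ| + 1) ^ α⁻¹ := by positivity
  have h1 : c ^ (-α) ≤ (|μ| + 1)⁻¹ := by
    refine (Real.rpow_le_rpow_of_nonpos hc0 hc (by linarith)).trans_eq ?_
    rw [← Real.rpow_mul (by positivity), mul_neg, inv_mul_cancel₀ hα.ne', Real.rpow_neg_one]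
  calc |μ| * c ^ (-α) ≤ |μ| * (|μ| + 1)⁻¹ := by gcongr
    _ < 1 := by rw [← div_eq_mul_inv, div_lt_one (by positivity)]; linarith

theorem mlf_hasSum {α β t : ℝ} (hα : 0 < α) (hβ : 0 ≤ β) (μ : ℝ) (ht : 0 ≤ t) :
    HasSum (fun k : ℕ => (-μ) ^ k * (t ^ (α * k + β) / Real.Gamma (α * k + β + 1)))
      (mlf α β μ t) := by
  obtain ⟨c, hc, hr⟩ := exists_geometric_rate hα μ
  exact (Summable.of_norm_bounded ((summable_geometric_of_lt_one (by positivity)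
    (hr c le_rfl)).mul_right _) fun k => mlf_term_bound hα.le hβ ht hc k).hasSum

theorem continuousOn_mlf {α β : ℝ} (hα : 0 < α) (hβ : 0 < β) (μ : ℝ) (T : ℝ) :
    ContinuousOn (mlf α β μ) (Icc 0 T) := by
  obtain ⟨c, hc, hr⟩ := exists_geometric_rate hα μ
  refine continuousOn_tsum (u := fun k => (|μ| * c ^ (-α)) ^ k * (c ^ (-β) * Real.exp (c * T)))
    (fun k => ?_) ((summable_geometric_of_lt_one (by positivity) (hr c le_rfl)).mul_right _)
    fun k t ht => (mlf_term_bound hα.le hβ.le ht.1 hc k).trans ?_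
  · have : Continuous fun t : ℝ => t ^ (α * k + β) :=
      Real.continuous_rpow_const (by positivity)
    exact ((this.div_const _).const_mul _).continuousOn
  · have := ht.2
    gcongr

/-- Self-similarity of the Mittag-Leffler functions, used to reduce to a unit time step. -/
theorem mlf_scale {α τ : ℝ} (hτ : 0 < τ) (β μ : ℝ) {t : ℝ} (ht : 0 ≤ t) :
    mlf α β μ (τ * t) = τ ^ β * mlf α β (μ * τ ^ α) t := by
  unfold mlf
  rw [← tsum_mul_left]
  congr 1
  ext k
  rw [Real.mul_rpow hτ.le ht, Real.rpow_add hτ, Real.rpow_mul hτ.le, Real.rpow_natCast, ← neg_mul,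
    mul_pow]
  ring

/-- The Laplace transform of `mlf α β μ`, analytically continued to the right half-plane. -/
noncomputable def mlfLaplace (α β μ : ℝ) (z : ℂ) : ℂ :=
  z ^ ((-(β + 1) : ℝ) : ℂ) * (z ^ (α : ℂ) / (z ^ (α : ℂ) + μ))

/-- Termwise inversion on a line so far to the right that the geometric series
`∑ (-μ z ^ (-α)) ^ k = z ^ α / (z ^ α + μ)` converges on it. -/
theorem mlf_inversion_far {α β μ t c : ℝ} (hα : 0 < α) (hβ : 0 < β) (ht : 0 < t)
    (hc : 0 < c) (hr : |μ| * c ^ (-α) < 1) :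
    ∫ θ : ℝ, Complex.exp (t * vline c θ) * mlfLaplace α β μ (vline c θ)
      = ((2 * Real.pi * mlf α β μ t : ℝ) : ℂ) := by
  set F : ℕ → ℝ → ℂ := fun k θ => ((-μ : ℝ) : ℂ) ^ k * (Complex.exp (t * vline c θ) *
    vline c θ ^ ((-(α * k + β + 1) : ℝ) : ℂ)) with hF
  have hint : ∀ s : ℝ, 0 < s → Integrable fun θ : ℝ => Complex.exp (t * vline c θ) *
      vline c θ ^ ((-(s + 1) : ℝ) : ℂ) := fun s hs => by
    refine integrable_cexp_mul ((integrable_norm_vline hc (by linarith : 1 < s + 1)).mono'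
        (continuous_vline_cpow hc _).aestronglyMeasurable (Eventually.of_forall fun θ => ?_))
    rw [Complex.norm_cpow_real]
  have hpos : ∀ k : ℕ, 0 < α * k + β := fun k => by positivity
  have hFi : ∀ k, Integrable (F k) := fun k => (hint _ (hpos k)).const_mul _
  have hnorm : ∀ k θ, ‖F k θ‖ ≤ (|μ| * c ^ (-α)) ^ k *
      (Real.exp (t * c) * ‖vline c θ‖ ^ (-(β + 1))) := by
    intro k θ
    have hn := norm_vline_pos hc θ
    rw [hF]
    simp only
    rw [norm_mul, norm_pow, Complex.norm_real, norm_neg, Real.norm_eq_abs, norm_mul,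
      norm_cexp_vline, Complex.norm_cpow_real, mul_pow, mul_assoc]
    have e : ‖vline c θ‖ ^ (-(α * k + β + 1)) =
        (‖vline c θ‖ ^ (-α)) ^ k * ‖vline c θ‖ ^ (-(β + 1)) := by
      rw [← Real.rpow_natCast, ← Real.rpow_mul hn.le, ← Real.rpow_add hn]
      congr 1; ring
    rw [e, mul_left_comm (Real.exp _)]
    have : ‖vline c θ‖ ^ (-α) ≤ c ^ (-α) :=
      Real.rpow_le_rpow_of_nonpos hc (le_norm_vline c θ) (by linarith)
    gcongr
  have hsum : Summable fun k => ∫ θ, ‖F k θ‖ := by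
    refine Summable.of_nonneg_of_le (fun k => integral_nonneg fun θ => norm_nonneg _)
      (fun k => integral_mono (hFi k).norm
        (((integrable_norm_vline hc (by linarith : 1 < β + 1)).const_mul _).const_mul _)
        (hnorm k)) ?_
    simp only [integral_const_mul]
    exact (summable_geometric_of_lt_one (by positivity) hr).mul_right _
  have h1 := hasSum_integral_of_summable_integral_norm hFi hsum
  have e1 : ∀ θ, ∑' k, F k θ = Complex.exp (t * vline c θ) * mlfLaplace α β μ (vline c θ) := by
    intro θ
    have hz := vline_ne_zero hc θ
    set z := vline c θ
    have e : ∀ k, F k θ = (-(μ : ℂ) * z ^ ((-α : ℝ) : ℂ)) ^ k *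
        (Complex.exp (t * z) * z ^ ((-(β + 1) : ℝ) : ℂ)) := by
      intro k
      have : z ^ ((-(α * k + β + 1) : ℝ) : ℂ) =
          (z ^ ((-α : ℝ) : ℂ)) ^ k * z ^ ((-(β + 1) : ℝ) : ℂ) := by
        rw [← Complex.cpow_mul_nat, ← Complex.cpow_add _ _ hz]
        congr 1; push_cast; ring
      simp only [hF]
      rw [this, mul_pow]
      push_cast
      ring
    simp only [e]
    have hlt : ‖-(μ : ℂ) * z ^ ((-α : ℝ) : ℂ)‖ < 1 := by
      rw [norm_mul, norm_neg, Complex.norm_real, Real.norm_eq_abs, Complex.norm_cpow_real]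
      refine lt_of_le_of_lt ?_ hr
      exact mul_le_mul_of_nonneg_left
        (Real.rpow_le_rpow_of_nonpos hc (le_norm_vline c θ) (by linarith)) (abs_nonneg μ)
    rw [tsum_mul_right, tsum_geometric_of_norm_lt_one hlt, mlfLaplace]
    have h1 : z ^ ((-α : ℝ) : ℂ) = (z ^ (α : ℂ))⁻¹ := by rw [Complex.ofReal_neg, Complex.cpow_neg]
    have h2 : z ^ (α : ℂ) ≠ 0 := by simp [Complex.cpow_eq_zero_iff, hz]
    have h3 : (1 - -(μ : ℂ) * (z ^ (α : ℂ))⁻¹)⁻¹ = z ^ (α : ℂ) / (z ^ (α : ℂ) + μ) := by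
      rw [show (1 - -(μ : ℂ) * (z ^ (α : ℂ))⁻¹) = (z ^ (α : ℂ) + μ) / z ^ (α : ℂ) by
        field_simp; ring, inv_div]
    rw [h1, h3]
    ring
  simp only [e1] at h1
  have h2 : HasSum (fun k => ∫ θ, F k θ) ((2 * Real.pi * mlf α β μ t : ℝ) : ℂ) := by
    have := ((mlf_hasSum hα hβ.le μ ht.le).mul_left (2 * Real.pi))
    have := (Complex.hasSum_ofReal).2 this
    convert! this using 1
    ext k
    simp only [hF]
    rw [integral_const_mul, rpow_inversion (hpos k) ht hc]
    push_cast
    ring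
  exact h1.unique h2

/-! ### Estimates in a sector slightly larger than the right half-plane -/

/-- The function `1 - ζ` in the variable `z` with `ζ = exp (-z)`: the symbol of the backward
difference. -/
noncomputable def bdiff (z : ℂ) : ℂ := 1 - Complex.exp (-z)

theorem differentiable_bdiff : Differentiable ℂ bdiff := by unfold bdiff; fun_prop

theorem norm_bdiff_sub_quadratic {z : ℂ} (hz : ‖z‖ ≤ 4) :
    ‖bdiff z - z + z ^ 2 / 2‖ ≤ Real.exp 4 * ‖z‖ ^ 3 := by
  have h := Complex.norm_exp_sub_sum_le_norm_mul_exp (-z) 3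
  rw [norm_neg] at h
  have e : bdiff z - z + z ^ 2 / 2 =
      -(Complex.exp (-z) - ∑ m ∈ Finset.range 3, (-z) ^ m / (m.factorial : ℂ)) := by
    simp [bdiff, Finset.sum_range_succ, Nat.factorial]
    ring
  rw [e, norm_neg]
  refine h.trans ?_
  rw [mul_comm]
  gcongr

theorem norm_bdiff_sub_self {z : ℂ} (hz : ‖z‖ ≤ 4) : ‖bdiff z - z‖ ≤ Real.exp 4 * ‖z‖ ^ 2 := by
  have h := Complex.norm_exp_sub_sum_le_norm_mul_exp (-z) 2
  rw [norm_neg] at h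
  have e : bdiff z - z =
      -(Complex.exp (-z) - ∑ m ∈ Finset.range 2, (-z) ^ m / (m.factorial : ℂ)) := by
    simp [bdiff, Finset.sum_range_succ]
    ring
  rw [e, norm_neg]
  refine h.trans ?_
  rw [mul_comm]
  gcongr

theorem norm_bdiff_le {z : ℂ} (hz : ‖z‖ ≤ 4) : ‖bdiff z‖ ≤ Real.exp 4 * ‖z‖ := by
  have h := Complex.norm_exp_sub_sum_le_norm_mul_exp (-z) 1
  rw [norm_neg] at h
  have e : bdiff z = -(Complex.exp (-z) - ∑ m ∈ Finset.range 1, (-z) ^ m / (m.factorial : ℂ)) := by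
    simp [bdiff]
  rw [e, norm_neg]
  refine h.trans ?_
  rw [mul_comm, pow_one]
  gcongr

/-- The zero of `1 - exp (-z)` at the origin is simple and the other zeros have modulus at least
`2π > 4`. -/
theorem exists_le_norm_bdiff : ∃ m : ℝ, 0 < m ∧ ∀ z : ℂ, ‖z‖ ≤ 4 → m * ‖z‖ ≤ ‖bdiff z‖ := by
  have hcont : ContinuousOn (dslope bdiff 0) (Metric.closedBall 0 4) :=
    (continuousOn_dslope (Metric.closedBall_mem_nhds 0 (by norm_num))).2
      ⟨differentiable_bdiff.continuous.continuousOn, differentiable_bdiff 0⟩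
  have hd0 : bdiff 0 = 0 := by simp [bdiff]
  obtain ⟨w, hw, hmin⟩ := (isCompact_closedBall (0 : ℂ) 4).exists_isMinOn
    ⟨0, by simp⟩ hcont.norm
  refine ⟨‖dslope bdiff 0 w‖, norm_pos_iff.2 ?_, fun z hz => ?_⟩
  · by_cases h : w = 0
    · have hd : HasDerivAt bdiff 1 0 := by
        have := (((hasDerivAt_id (0 : ℂ)).neg).cexp).const_sub 1
        simpa [bdiff] using! this
      rw [h, dslope_same, hd.deriv]
      exact one_ne_zero
    · rw [dslope_of_ne _ h, slope_def_field, hd0, sub_zero, sub_zero]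
      refine div_ne_zero ?_ h
      intro h0
      have h1 : Complex.exp (-w) = 1 := (sub_eq_zero.1 h0).symm
      obtain ⟨n, hn⟩ := Complex.exp_eq_one_iff.1 h1
      have hn0 : n ≠ 0 := by
        rintro rfl
        apply h
        simpa using hn
      have hnorm : ‖w‖ = |(n : ℝ)| * (2 * Real.pi) := by
        rw [← norm_neg, hn]
        simp [abs_of_pos Real.pi_pos]
      have h2 : (1 : ℝ) ≤ |(n : ℝ)| := by exact_mod_cast Int.one_le_abs hn0
      have h3 : ‖w‖ ≤ 4 := by simpa using hw
      have h4 := Real.pi_gt_three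
      nlinarith
  · by_cases h : z = 0
    · simp [h]
    · have : ‖dslope bdiff 0 w‖ ≤ ‖dslope bdiff 0 z‖ :=
        hmin (show z ∈ Metric.closedBall (0 : ℂ) 4 by simpa using hz)
      rw [dslope_of_ne _ h (a := 0), slope_def_field, hd0, sub_zero, sub_zero, norm_div] at this
      rwa [← le_div_iff₀ (norm_pos_iff.2 h)]

/-- In a sector of half-angle slightly above `π / 2`, the power `w ^ α` with `α < 1` still has
positive real part, comparable with its modulus. -/
theorem exists_sector_cpow {α : ℝ} (hα0 : 0 < α) (hα1 : α < 1) :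
    ∃ ε κ : ℝ, 0 < ε ∧ ε < 1 ∧ 0 < κ ∧ ∀ w : ℂ, w ≠ 0 → -ε * ‖w‖ ≤ w.re →
      w ∈ Complex.slitPlane ∧ |w.arg| ≤ 3 * Real.pi / 4 ∧ κ * ‖w‖ ^ α ≤ (w ^ (α : ℂ)).re := by
  have hpi := Real.pi_pos
  set η : ℝ := min (Real.pi / 2 * (2 - α)) (3 * Real.pi / 4) with hη
  have h1 : Real.pi / 2 < η := lt_min (by nlinarith) (by linarith)
  have h2 : η ≤ 3 * Real.pi / 4 := min_le_right _ _
  have h3 : η * α < Real.pi / 2 := by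
    have : η ≤ Real.pi / 2 * (2 - α) := min_le_left _ _
    nlinarith [sq_nonneg (1 - α), mul_pos hpi (pow_pos (sub_pos.2 hα1) 2)]
  have hcos : Real.cos η < 0 := Real.cos_neg_of_pi_div_two_lt_of_lt h1 (by linarith)
  have hcos' : -1 < Real.cos η := by
    rw [← Real.cos_pi]
    exact Real.cos_lt_cos_of_nonneg_of_le_pi (by linarith) le_rfl (by linarith)
  refine ⟨-Real.cos η, Real.cos (η * α), by linarith, by linarith,
    Real.cos_pos_of_mem_Ioo ⟨by nlinarith, h3⟩, fun w hw hre => ?_⟩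
  have harg : |w.arg| ≤ η := by
    by_contra! hlt
    have := Real.cos_lt_cos_of_nonneg_of_le_pi (by linarith) (Complex.abs_arg_le_pi w) hlt
    rw [Real.cos_abs] at this
    rw [neg_neg, ← Complex.norm_mul_cos_arg w, mul_comm] at hre
    exact absurd (le_of_mul_le_mul_left hre (norm_pos_iff.2 hw)) (not_le.2 this)
  refine ⟨Complex.mem_slitPlane_iff_arg.2 ⟨fun h => ?_, hw⟩, harg.trans h2, ?_⟩
  · rw [h, abs_of_pos hpi] at harg
    linarith
  · rw [Complex.cpow_ofReal_re, mul_comm]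
    refine mul_le_mul_of_nonneg_left ?_ (by positivity)
    rw [← Real.cos_abs (w.arg * α), abs_mul, abs_of_pos hα0]
    exact Real.cos_le_cos_of_nonneg_of_le_pi (by positivity) (by linarith) (by gcongr)

/-- The part of the sector `-δ ‖z‖ ≤ Re z` in the punctured disc of radius `4`. -/
def nearSector (δ : ℝ) : Set ℂ := {z | z ≠ 0 ∧ ‖z‖ ≤ 4 ∧ -δ * ‖z‖ ≤ z.re}

/-- The symbol of the shift `v ↦ (1 - α/2) v(t) + (α/2) v(t - τ)`. -/
noncomputable def shiftSymbol (α : ℝ) (z : ℂ) : ℂ := 1 - (α / 2 : ℝ) * bdiff z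

/-- The symbol of the discrete operator: Grünwald-Letnikov plus `μ` times the shift. -/
noncomputable def schemeSymbol (α μ : ℝ) (z : ℂ) : ℂ := bdiff z ^ (α : ℂ) + μ * shiftSymbol α z

/-- The map `z ↦ 1 - exp (-z)` sends the part of a narrow enough sector near the origin into a given
sector, and `Re Θ` stays positive there: `Re (1 - exp (-z))` is at least `-2 δ |z|` and at most
`2 + 2 δ |z|`, since `|exp (-z)| ≤ 1 + 2 δ |z|`. -/
theorem exists_bdiff_sector {α ε : ℝ} (hα0 : 0 < α) (hα1 : α < 1) (hε : 0 < ε) :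
    ∃ δ : ℝ, 0 < δ ∧ δ ≤ ε ∧ δ ≤ 1 / 5 ∧ ∀ z ∈ nearSector δ,
      -ε * ‖bdiff z‖ ≤ (bdiff z).re ∧ (1 - α) / 2 ≤ (shiftSymbol α z).re := by
  obtain ⟨m, hm, hmb⟩ := exists_le_norm_bdiff
  refine ⟨min (min (ε * m / 2) ((1 - α) / 8)) (min (1 / 5) ε), ?_, ?_, ?_, ?_⟩
  · have : 0 < 1 - α := by linarith
    exact lt_min (lt_min (by positivity) (by positivity)) (lt_min (by norm_num) hε)
  · exact (min_le_right _ _).trans (min_le_right _ _)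
  · exact (min_le_right _ _).trans (min_le_left _ _)
  rintro z ⟨hz0, hz4, hzre⟩
  set δ := min (min (ε * m / 2) ((1 - α) / 8)) (min (1 / 5) ε)
  have hδ0 : 0 < δ := by
    have : 0 < 1 - α := by linarith
    exact lt_min (lt_min (by positivity) (by positivity)) (lt_min (by norm_num) hε)
  have d1 : δ ≤ ε * m / 2 := (min_le_left _ _).trans (min_le_left _ _)
  have d2 : δ ≤ (1 - α) / 8 := (min_le_left _ _).trans (min_le_right _ _)
  have d3 : δ ≤ 1 / 5 := (min_le_right _ _).trans (min_le_left _ _)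
  have hre : (bdiff z).re = 1 - Real.exp (-z.re) * Real.cos z.im := by
    simp [bdiff, Complex.exp_re]
  have hE : Real.exp (-z.re) ≤ 1 + 2 * (δ * ‖z‖) := by
    have h1 : δ * ‖z‖ ≤ 1 := by nlinarith [norm_nonneg z]
    have h0 : 0 ≤ δ * ‖z‖ := by positivity
    have h2 : Real.exp (-z.re) ≤ Real.exp (δ * ‖z‖) := Real.exp_le_exp.2 (by linarith)
    have h3 := Real.abs_exp_sub_one_le (x := δ * ‖z‖) (by rwa [abs_of_nonneg h0])
    rw [abs_of_nonneg h0] at h3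
    linarith [le_abs_self (Real.exp (δ * ‖z‖) - 1)]
  have hE0 := Real.exp_pos (-z.re)
  constructor
  · rw [hre]
    have h1 : Real.exp (-z.re) * Real.cos z.im ≤ Real.exp (-z.re) :=
      mul_le_of_le_one_right hE0.le (Real.cos_le_one _)
    have h2 : 2 * (δ * ‖z‖) ≤ ε * ‖bdiff z‖ := by
      have := hmb z hz4
      nlinarith [norm_nonneg z]
    linarith
  · have h1 : -Real.exp (-z.re) ≤ Real.exp (-z.re) * Real.cos z.im := by
      nlinarith [Real.neg_one_le_cos z.im]
    have h2 : (shiftSymbol α z).re = 1 - α / 2 * (bdiff z).re := by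
      simp [shiftSymbol, Complex.mul_re]
    rw [h2, hre]
    have h3 : 2 * (δ * ‖z‖) ≤ 1 - α := by nlinarith [norm_nonneg z]
    nlinarith

/-- With `x = 1 - exp (-z) = z (1 - z / 2 + O(z ^ 2))` the symbol of the Grünwald-Letnikov
difference is `x ^ α = z ^ α (1 - α z / 2 + O(z ^ 2))`. It is accurate to first order only, but its
leading error is that of the shift symbol `Θ = 1 - α x / 2`. -/
theorem cpow_bdiff_expansion {α ε : ℝ} (hα0 : 0 < α) (hα1 : α < 1)
    (hε : ∀ w : ℂ, w ≠ 0 → -ε * ‖w‖ ≤ w.re → |w.arg| ≤ 3 * Real.pi / 4) :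
    ∃ C : ℝ, 0 < C ∧ ∀ z : ℂ, z ≠ 0 → ‖z‖ ≤ 4 → bdiff z ≠ 0 → -ε * ‖z‖ ≤ z.re →
      -ε * ‖bdiff z‖ ≤ (bdiff z).re →
      ‖shiftSymbol α z * z ^ (α : ℂ) - bdiff z ^ (α : ℂ)‖ ≤ C * ‖z‖ ^ (α + 2) := by
  set K := Real.exp 4 with hK
  have hK1 : 1 ≤ K := Real.one_le_exp (by norm_num)
  set ρ : ℝ := 1 / (2 * (4 * K + 1)) with hρ
  have hρ0 : 0 < ρ := by positivity
  have hpi := Real.pi_pos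
  -- for `‖z‖ ≥ ρ` the triangle inequality suffices; for `‖z‖ < ρ`, `x = z (1 + w)` with `|w| ≤ 1/2`
  refine ⟨max ((1 + 4 * K + K ^ α) * (ρ ^ 2)⁻¹) (4 * (4 * K + 1) ^ 2 + 2 * K), by positivity,
    fun z hz hz4 hx hzre hxre => ?_⟩
  have hzn : 0 < ‖z‖ := norm_pos_iff.2 hz
  have hsplit : ‖z‖ ^ (α + 2) = ‖z‖ ^ α * ‖z‖ ^ 2 := by
    rw [Real.rpow_add hzn]; norm_cast
  have hα2 : ‖((α / 2 : ℝ) : ℂ)‖ ≤ 1 := by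
    rw [Complex.norm_real, Real.norm_of_nonneg (by positivity)]; linarith
  rcases le_or_gt ρ ‖z‖ with hfar | hclose
  · have h1 : ‖shiftSymbol α z‖ ≤ 1 + 4 * K := by
      unfold shiftSymbol
      refine (norm_sub_le _ _).trans ?_
      rw [norm_one, norm_mul]
      have h5 := norm_bdiff_le hz4
      have : ‖((α / 2 : ℝ) : ℂ)‖ * ‖bdiff z‖ ≤ 1 * (K * 4) := by
        gcongr
        exact h5.trans (by gcongr)
      linarith
    have h2 : ‖bdiff z ^ (α : ℂ)‖ ≤ K ^ α * ‖z‖ ^ α := by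
      rw [Complex.norm_cpow_real, ← Real.mul_rpow (by positivity) hzn.le]
      exact Real.rpow_le_rpow (norm_nonneg _) (norm_bdiff_le hz4) hα0.le
    have h3 : ‖shiftSymbol α z * z ^ (α : ℂ) - bdiff z ^ (α : ℂ)‖ ≤
        (1 + 4 * K + K ^ α) * ‖z‖ ^ α := by
      refine (norm_sub_le _ _).trans ?_
      rw [norm_mul, Complex.norm_cpow_real z, add_mul]
      gcongr
    have h4 : 1 ≤ (ρ ^ 2)⁻¹ * ‖z‖ ^ 2 := by
      rw [inv_mul_eq_div, one_le_div (by positivity)]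
      gcongr
    calc _ ≤ (1 + 4 * K + K ^ α) * ‖z‖ ^ α * 1 := by rw [mul_one]; exact h3
      _ ≤ (1 + 4 * K + K ^ α) * ‖z‖ ^ α * ((ρ ^ 2)⁻¹ * ‖z‖ ^ 2) := by gcongr
      _ = (1 + 4 * K + K ^ α) * (ρ ^ 2)⁻¹ * ‖z‖ ^ (α + 2) := by rw [hsplit]; ring
      _ ≤ _ := by gcongr; exact le_max_left _ _
  · set w : ℂ := bdiff z / z - 1 with hw
    have hxw : bdiff z = z * (1 + w) := by rw [hw]; field_simp; ring
    have hwn : ‖w‖ ≤ (4 * K + 1) * ‖z‖ := by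
      have e : w = (bdiff z - z) / z := by rw [hw]; field_simp
      rw [e, norm_div, div_le_iff₀ hzn]
      have := norm_bdiff_sub_self hz4
      nlinarith [sq_nonneg ‖z‖]
    have hw2 : ‖w‖ ≤ 1 / 2 := by
      refine hwn.trans ?_
      have : (4 * K + 1) * ρ = 1 / 2 := by rw [hρ]; field_simp
      rw [← this]
      gcongr
    have hre : 0 < (1 + w).re := by
      have := Complex.abs_re_le_norm w
      have := neg_abs_le w.re
      simp only [Complex.add_re, Complex.one_re]
      linarith
    have h1w : 1 + w ≠ 0 := fun h => by rw [h] at hre; simp at hre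
    -- no multiple of `2πi` appears: the arguments of `z` and `x` are at most `3π/4` in modulus and
    -- that of `1 + w` is less than `π/2`
    have hlog : Complex.log (bdiff z) = Complex.log z + Complex.log (1 + w) := by
      have h1 : Complex.exp (Complex.log (bdiff z)) =
          Complex.exp (Complex.log z + Complex.log (1 + w)) := by
        rw [Complex.exp_add, Complex.exp_log hx, Complex.exp_log hz, Complex.exp_log h1w, hxw]
      obtain ⟨n, hn⟩ := Complex.exp_eq_exp_iff_exists_int.1 h1
      have him := congrArg Complex.im hn
      simp [Complex.log_im] at him
      have a1 := abs_le.1 (hε z hz hzre)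
      have a2 := abs_le.1 (hε _ hx hxre)
      have a3 := abs_lt.1 (Complex.abs_arg_lt_pi_div_two_iff.2 (Or.inl hre))
      have hn0 : n = 0 := by
        have u1 : (n : ℝ) < 1 := by
          by_contra! hge
          nlinarith
        have u2 : (-1 : ℝ) < n := by
          by_contra! hge
          nlinarith
        have u1' : n < 1 := by exact_mod_cast u1
        have u2' : -1 < n := by exact_mod_cast u2
        omega
      rw [hn, hn0]; simp
    have hcp : bdiff z ^ (α : ℂ) = z ^ (α : ℂ) * Complex.exp (α * Complex.log (1 + w)) := by
      rw [Complex.cpow_def_of_ne_zero hx, Complex.cpow_def_of_ne_zero hz, ← Complex.exp_add, hlog]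
      congr 1; ring
    have hl1 : ‖Complex.log (1 + w) - w‖ ≤ ‖w‖ ^ 2 := by
      refine (Complex.norm_log_one_add_sub_self_le (by linarith)).trans ?_
      have : (1 - ‖w‖)⁻¹ ≤ 2 := by
        rw [inv_le_comm₀ (by linarith) (by norm_num)]; linarith
      calc ‖w‖ ^ 2 * (1 - ‖w‖)⁻¹ / 2 ≤ ‖w‖ ^ 2 * 2 / 2 := by gcongr
        _ = _ := by ring
    set ξ : ℂ := α * Complex.log (1 + w) with hξ
    have hαn : ‖(α : ℂ)‖ ≤ 1 := by
      rw [Complex.norm_real, Real.norm_of_nonneg hα0.le]; exact hα1.le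
    have hξw : ‖ξ - α * w‖ ≤ ‖w‖ ^ 2 := by
      rw [hξ, ← mul_sub, norm_mul]
      calc _ ≤ 1 * ‖w‖ ^ 2 := by gcongr
        _ = _ := one_mul _
    have hξn : ‖ξ‖ ≤ 3 / 2 * ‖w‖ := by
      have h1 : ‖ξ‖ ≤ ‖ξ - α * w‖ + ‖(α : ℂ) * w‖ := by
        simpa using norm_add_le (ξ - α * w) (α * w)
      have h2 : ‖(α : ℂ) * w‖ ≤ ‖w‖ := by
        rw [norm_mul]
        exact mul_le_of_le_one_left (norm_nonneg _) hαn
      nlinarith [norm_nonneg w]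
    have hexp : ‖Complex.exp ξ - 1 - ξ‖ ≤ (3 / 2 * ‖w‖) ^ 2 :=
      (Complex.norm_exp_sub_one_sub_id_le (by linarith)).trans (by gcongr)
    have hquad : ‖w + bdiff z / 2‖ ≤ 2 * K * ‖z‖ ^ 2 := by
      have e : w + bdiff z / 2 = (bdiff z - z + z ^ 2 / 2) / z + (bdiff z - z) / 2 := by
        rw [hw]; field_simp; ring
      rw [e]
      refine (norm_add_le _ _).trans ?_
      rw [norm_div, norm_div, Complex.norm_two]
      have h1 := norm_bdiff_sub_quadratic hz4
      have h2 := norm_bdiff_sub_self hz4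
      have h3 : ‖bdiff z - z + z ^ 2 / 2‖ / ‖z‖ ≤ K * ‖z‖ ^ 2 := by
        rw [div_le_iff₀ hzn]; linarith
      have : 0 ≤ K * ‖z‖ ^ 2 := by positivity
      linarith
    have hdiff : ‖shiftSymbol α z - Complex.exp ξ‖ ≤ (4 * (4 * K + 1) ^ 2 + 2 * K) * ‖z‖ ^ 2 := by
      have e : shiftSymbol α z - Complex.exp ξ =
          -(Complex.exp ξ - 1 - ξ) - (ξ - α * w) - α * (w + bdiff z / 2) := by
        unfold shiftSymbol
        push_cast
        ring
      rw [e]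
      refine (norm_sub_le _ _).trans ((add_le_add_left (norm_sub_le _ _) _).trans ?_)
      rw [norm_neg, norm_mul]
      have h1 : ‖(α : ℂ)‖ * ‖w + bdiff z / 2‖ ≤ 1 * (2 * K * ‖z‖ ^ 2) := by gcongr
      have h2 : ‖w‖ ^ 2 ≤ ((4 * K + 1) * ‖z‖) ^ 2 := by gcongr
      nlinarith
    rw [hcp, mul_comm, ← mul_sub, norm_mul, Complex.norm_cpow_real, hsplit]
    calc ‖z‖ ^ α * ‖shiftSymbol α z - Complex.exp ξ‖
        ≤ ‖z‖ ^ α * ((4 * (4 * K + 1) ^ 2 + 2 * K) * ‖z‖ ^ 2) := by gcongr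
      _ = (4 * (4 * K + 1) ^ 2 + 2 * K) * (‖z‖ ^ α * ‖z‖ ^ 2) := by ring
      _ ≤ _ := by gcongr; exact le_max_right _ _

/-- Let `x = 1 - exp (-z)` and let `Θ = 1 - α x / 2` be the shift symbol. The solution operators
`1 / (z ^ α + μ)` of the continuous problem and `Θ / (x ^ α + μ Θ)` of the scheme, multiplied by
`z ^ α`, are bounded uniformly in `μ ≥ 0` in a sector that contains the closed right half-plane
without the origin (for the scheme, near the origin), and they differ by `O(z ^ 2)`. -/
theorem exists_sector {α : ℝ} (hα0 : 0 < α) (hα1 : α < 1) :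
    ∃ δ C : ℝ, 0 < δ ∧ δ ≤ 1 / 5 ∧ 0 < C ∧
      (∀ z : ℂ, z ≠ 0 → -δ * ‖z‖ ≤ z.re → z ∈ Complex.slitPlane ∧ ∀ μ : ℝ, 0 ≤ μ →
        z ^ (α : ℂ) + μ ≠ 0 ∧ ‖z ^ (α : ℂ) / (z ^ (α : ℂ) + μ)‖ ≤ C) ∧
      (∀ z ∈ nearSector δ, bdiff z ∈ Complex.slitPlane ∧ ∀ μ : ℝ, 0 ≤ μ →
        schemeSymbol α μ z ≠ 0 ∧
        ‖z ^ (α : ℂ) * shiftSymbol α z / schemeSymbol α μ z‖ ≤ C ∧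
        ‖z ^ (α : ℂ) * shiftSymbol α z / schemeSymbol α μ z - z ^ (α : ℂ) / (z ^ (α : ℂ) + μ)‖
          ≤ C * ‖z‖ ^ 2) := by
  obtain ⟨ε, κ, hε0, hε1, hκ, hsec⟩ := exists_sector_cpow hα0 hα1
  obtain ⟨δ, hδ0, hδε, hδ5, hnear⟩ := exists_bdiff_sector hα0 hα1 hε0
  obtain ⟨C₀, hC₀, hexp⟩ := cpow_bdiff_expansion (ε := ε) hα0 hα1 fun w h0 h1 => (hsec w h0 h1).2.1
  obtain ⟨m, hm, hmb⟩ := exists_le_norm_bdiff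
  have hα' : 0 < 1 - α := by linarith
  set K := Real.exp 4 with hK
  have hK1 : 1 ≤ K := Real.one_le_exp (by norm_num)
  have hsec' : ∀ z : ℂ, -δ * ‖z‖ ≤ z.re → -ε * ‖z‖ ≤ z.re := fun z hz => by
    nlinarith [norm_nonneg z]
  -- `μ ≥ 0` only increases the real parts of the denominators
  have hlow : ∀ z : ℂ, z ≠ 0 → -δ * ‖z‖ ≤ z.re → ∀ μ : ℝ, 0 ≤ μ →
      κ * ‖z‖ ^ α ≤ ‖z ^ (α : ℂ) + μ‖ := fun z hz hre μ hμ => by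
    refine ((hsec z hz (hsec' z hre)).2.2.trans ?_).trans (Complex.re_le_norm _)
    simp [hμ]
  have hlow2 : ∀ z ∈ nearSector δ, ∀ μ : ℝ, 0 ≤ μ →
      κ * m ^ α * ‖z‖ ^ α ≤ ‖schemeSymbol α μ z‖ := fun z hz μ hμ => by
    have hx : 0 < ‖bdiff z‖ := lt_of_lt_of_le (mul_pos hm (norm_pos_iff.2 hz.1)) (hmb z hz.2.1)
    refine le_trans ?_ (Complex.re_le_norm _)
    have h1 := (hsec _ (norm_pos_iff.1 hx) (hnear z hz).1).2.2
    have h2 : 0 ≤ μ * (shiftSymbol α z).re :=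
      mul_nonneg hμ ((by positivity : 0 ≤ (1 - α) / 2).trans (hnear z hz).2)
    have h3 : κ * m ^ α * ‖z‖ ^ α ≤ κ * ‖bdiff z‖ ^ α := by
      rw [mul_assoc, ← Real.mul_rpow hm.le (norm_nonneg _)]
      exact mul_le_mul_of_nonneg_left
        (Real.rpow_le_rpow (by positivity) (hmb z hz.2.1) hα0.le) hκ.le
    have h4 : (schemeSymbol α μ z).re = (bdiff z ^ (α : ℂ)).re + μ * (shiftSymbol α z).re := by
      simp [schemeSymbol, Complex.mul_re]
    linarith
  have hshift : ∀ z ∈ nearSector δ, ‖shiftSymbol α z‖ ≤ 1 + 4 * K := fun z hz => by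
    have hα2 : ‖((α / 2 : ℝ) : ℂ)‖ ≤ 1 := by
      rw [Complex.norm_real, Real.norm_of_nonneg (by positivity)]; linarith
    unfold shiftSymbol
    refine (norm_sub_le _ _).trans ?_
    rw [norm_one, norm_mul]
    have h5 := norm_bdiff_le hz.2.1
    have : ‖((α / 2 : ℝ) : ℂ)‖ * ‖bdiff z‖ ≤ 1 * (K * 4) := by
      gcongr
      exact h5.trans (mul_le_mul_of_nonneg_left hz.2.1 (by positivity))
    linarith
  have hmα : 0 < m ^ α := by positivity
  refine ⟨δ, max κ⁻¹ (max ((1 + 4 * K) / (κ * m ^ α)) (C₀ / (κ * m ^ α * κ))), hδ0, hδ5,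
    by positivity, fun z hz hre => ⟨(hsec z hz (hsec' z hre)).1, fun μ hμ => ?_⟩,
    fun z hz => ⟨?_, fun μ hμ => ?_⟩⟩
  · have hzn : 0 < ‖z‖ ^ α := Real.rpow_pos_of_pos (norm_pos_iff.2 hz) _
    have h := hlow z hz hre μ hμ
    have hp : 0 < ‖z ^ (α : ℂ) + μ‖ := lt_of_lt_of_le (by positivity) h
    refine ⟨norm_pos_iff.1 hp, le_trans ?_ (le_max_left _ _)⟩
    rw [norm_div, Complex.norm_cpow_real, div_le_iff₀ hp, inv_mul_eq_div, le_div_iff₀ hκ]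
    linarith
  · have hx : 0 < ‖bdiff z‖ := lt_of_lt_of_le (mul_pos hm (norm_pos_iff.2 hz.1)) (hmb z hz.2.1)
    exact (hsec _ (norm_pos_iff.1 hx) (hnear z hz).1).1
  · have hx : 0 < ‖bdiff z‖ := lt_of_lt_of_le (mul_pos hm (norm_pos_iff.2 hz.1)) (hmb z hz.2.1)
    have hzn : 0 < ‖z‖ ^ α := Real.rpow_pos_of_pos (norm_pos_iff.2 hz.1) _
    have h1 := hlow z hz.1 hz.2.2 μ hμ
    have h2 := hlow2 z hz μ hμ
    have hp1 : 0 < ‖z ^ (α : ℂ) + μ‖ := lt_of_lt_of_le (by positivity) h1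
    have hp2 : 0 < ‖schemeSymbol α μ z‖ := lt_of_lt_of_le (by positivity) h2
    refine ⟨norm_pos_iff.1 hp2, ?_, ?_⟩
    · refine le_trans ?_ ((le_max_left _ _).trans (le_max_right _ _))
      rw [norm_div, norm_mul, Complex.norm_cpow_real, div_le_iff₀ hp2, div_mul_eq_mul_div,
        le_div_iff₀ (by positivity)]
      calc ‖z‖ ^ α * ‖shiftSymbol α z‖ * (κ * m ^ α)
          ≤ ‖z‖ ^ α * (1 + 4 * K) * (κ * m ^ α) := by gcongr; exact hshift z hz
        _ = (1 + 4 * K) * (κ * m ^ α * ‖z‖ ^ α) := by ring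
        _ ≤ _ := by gcongr
    · have e : z ^ (α : ℂ) * shiftSymbol α z / schemeSymbol α μ z
          - z ^ (α : ℂ) / (z ^ (α : ℂ) + μ) = z ^ (α : ℂ) *
          (shiftSymbol α z * z ^ (α : ℂ) - bdiff z ^ (α : ℂ)) /
          (schemeSymbol α μ z * (z ^ (α : ℂ) + μ)) := by
        rw [div_sub_div _ _ (norm_pos_iff.1 hp2) (norm_pos_iff.1 hp1)]
        congr 1
        unfold schemeSymbol
        ring
      have h3 := hexp z hz.1 hz.2.1 (norm_pos_iff.1 hx) (hsec' z hz.2.2) (hnear z hz).1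
      have hsplit : ‖z‖ ^ (α + 2) = ‖z‖ ^ α * ‖z‖ ^ 2 := by
        rw [Real.rpow_add (norm_pos_iff.2 hz.1)]; norm_cast
      refine le_trans ?_ (mul_le_mul_of_nonneg_right
        ((le_max_right _ _).trans (le_max_right κ⁻¹ _)) (by positivity))
      rw [e, norm_div, norm_mul, norm_mul, Complex.norm_cpow_real, div_mul_eq_mul_div,
        div_le_div_iff₀ (by positivity) (by positivity)]
      calc _ ≤ ‖z‖ ^ α * (C₀ * ‖z‖ ^ (α + 2)) * (κ * m ^ α * κ) := by gcongr
        _ = C₀ * ‖z‖ ^ 2 * ((κ * m ^ α * ‖z‖ ^ α) * (κ * ‖z‖ ^ α)) := by rw [hsplit]; ring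
        _ ≤ _ := by gcongr

/-! ### Expansions of the transformed data -/

/-- The symbol of the second-order backward difference formula: `3/2 - 2ζ + ζ²/2 = x + x²/2` for
`ζ = exp (-z)` and `x = 1 - ζ`. -/
noncomputable def bdfSymbol (z : ℂ) : ℂ := bdiff z + bdiff z ^ 2 / 2

/-- The backward difference formula is accurate to second order. -/
theorem norm_bdfSymbol_sub_self : ∃ C : ℝ, 0 < C ∧ ∀ z : ℂ, ‖z‖ ≤ 4 →
    ‖bdfSymbol z - z‖ ≤ C * ‖z‖ ^ 3 ∧ ‖bdfSymbol z‖ ≤ C * ‖z‖ := by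
  set K := Real.exp 4 with hK
  have hK1 : 1 ≤ K := Real.one_le_exp (by norm_num)
  refine ⟨K + 4 * K * (K + 1), by positivity, fun z hz => ?_⟩
  have h1 := norm_bdiff_sub_quadratic hz
  have h2 := norm_bdiff_sub_self hz
  have h3 := norm_bdiff_le hz
  rw [← hK] at h1 h2 h3
  have hn := norm_nonneg z
  constructor
  · have e : bdfSymbol z - z = (bdiff z - z + z ^ 2 / 2) + (bdiff z - z) * (bdiff z + z) / 2 := by
      unfold bdfSymbol; ring
    rw [e]
    refine (norm_add_le _ _).trans ?_
    rw [norm_div, norm_mul, Complex.norm_two]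
    have h4 : ‖bdiff z + z‖ ≤ (K + 1) * ‖z‖ := (norm_add_le _ _).trans (by linarith)
    have h5 : ‖bdiff z - z‖ * ‖bdiff z + z‖ ≤ (K * ‖z‖ ^ 2) * ((K + 1) * ‖z‖) := by gcongr
    have h6 : 0 ≤ K * (K + 1) * ‖z‖ ^ 3 := by positivity
    nlinarith
  · unfold bdfSymbol
    refine (norm_add_le _ _).trans ?_
    rw [norm_div, norm_pow, Complex.norm_two]
    have h5 : ‖bdiff z‖ ^ 2 ≤ (K * ‖z‖) * (K * 4) := by
      rw [sq]; gcongr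
      exact h3.trans (mul_le_mul_of_nonneg_left hz (by positivity))
    have h6 : 0 ≤ K * ‖z‖ := by positivity
    nlinarith

theorem inv_bdiff_expansion : ∃ C : ℝ, 0 < C ∧ ∀ z : ℂ, z ≠ 0 → ‖z‖ ≤ 4 →
    ‖(bdiff z)⁻¹ - z⁻¹ - 1 / 2‖ ≤ C * ‖z‖ := by
  obtain ⟨m, hm, hmb⟩ := exists_le_norm_bdiff
  set K := Real.exp 4 with hK
  have hK1 : 1 ≤ K := Real.one_le_exp (by norm_num)
  refine ⟨2 * K / m, by positivity, fun z hz0 hz => ?_⟩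
  have h1 := norm_bdiff_sub_quadratic hz
  have h2 := norm_bdiff_sub_self hz
  rw [← hK] at h1 h2
  have hn : 0 < ‖z‖ := norm_pos_iff.2 hz0
  have h3 := hmb z hz
  have hx : 0 < ‖bdiff z‖ := lt_of_lt_of_le (by positivity) h3
  have hx0 := norm_pos_iff.1 hx
  have e : (bdiff z)⁻¹ - z⁻¹ - 1 / 2 =
      (-(bdiff z - z + z ^ 2 / 2) - z * (bdiff z - z) / 2) / (bdiff z * z) := by
    field_simp; ring
  rw [e, norm_div, norm_mul, div_le_iff₀ (by positivity)]
  refine (norm_sub_le _ _).trans ?_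
  rw [norm_neg, norm_div, norm_mul, Complex.norm_two]
  have h4 : ‖z‖ * ‖bdiff z - z‖ ≤ ‖z‖ * (K * ‖z‖ ^ 2) := by gcongr
  have h5 : 2 * K / m * ‖z‖ * (m * ‖z‖ * ‖z‖) ≤ 2 * K / m * ‖z‖ * (‖bdiff z‖ * ‖z‖) := by gcongr
  have h6 : 2 * K / m * ‖z‖ * (m * ‖z‖ * ‖z‖) = 2 * K * ‖z‖ ^ 3 := by field_simp
  have h7 : 0 ≤ K * ‖z‖ ^ 3 := by positivity
  nlinarith

/-- The transform of the sequence `n`, which is `ζ / (1 - ζ) ^ 2`, multiplied by the BDF symbol. -/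
noncomputable def linSymbol (z : ℂ) : ℂ := bdfSymbol z * ((1 - bdiff z) / bdiff z ^ 2)

/-- The transform of the sequence `(n - s)² / 2`, `n ≥ 1`, multiplied by the BDF symbol. -/
noncomputable def quadSymbol (s : ℝ) (z : ℂ) : ℂ :=
  bdfSymbol z * ((1 - bdiff z) * (2 - bdiff z) / bdiff z ^ 3 / 2
    - s * ((1 - bdiff z) / bdiff z ^ 2) + s ^ 2 / 2 * ((1 - bdiff z) / bdiff z))

/-- Second-order consistency for the source `1`, whose Laplace transform is `1 / z`. -/
theorem linSymbol_expansion : ∃ C : ℝ, 0 < C ∧ ∀ z : ℂ, z ≠ 0 → ‖z‖ ≤ 4 →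
    ‖linSymbol z - z⁻¹‖ ≤ C * ‖z‖ := by
  obtain ⟨m, hm, hmb⟩ := exists_le_norm_bdiff
  obtain ⟨C, hC, h⟩ := inv_bdiff_expansion
  refine ⟨C + Real.exp 4, by positivity, fun z hz0 hz => ?_⟩
  have hx0 : bdiff z ≠ 0 :=
    norm_pos_iff.1 (lt_of_lt_of_le (mul_pos hm (norm_pos_iff.2 hz0)) (hmb z hz))
  have e : linSymbol z - z⁻¹ = ((bdiff z)⁻¹ - z⁻¹ - 1 / 2) - bdiff z / 2 := by
    unfold linSymbol bdfSymbol
    field_simp; ring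
  rw [e]
  refine (norm_sub_le _ _).trans ?_
  rw [norm_div, Complex.norm_two]
  have h1 := h z hz0 hz
  have h2 := norm_bdiff_le hz
  have h3 := norm_nonneg (bdiff z)
  linarith

/-- Second-order consistency for the source `(t - s)₊`, whose Laplace transform is
`exp (-s z) / z ^ 2`, uniformly in the instant `s` at which it sets in. -/
theorem quadSymbol_expansion : ∃ C : ℝ, 0 < C ∧ ∀ s : ℝ, 0 ≤ s → s ≤ 1 → ∀ z : ℂ, z ≠ 0 →
    ‖z‖ ≤ 4 → ‖quadSymbol s z - Complex.exp (-(s * z)) * (z ^ 2)⁻¹‖ ≤ C := by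
  obtain ⟨m, hm, hmb⟩ := exists_le_norm_bdiff
  obtain ⟨C, hC, h⟩ := inv_bdiff_expansion
  set K := Real.exp 4 with hK
  have hK1 : 1 ≤ K := Real.one_le_exp (by norm_num)
  refine ⟨(2 * C + 4 * C + 16 * C ^ 2 + 4 * C + 100 * K ^ 2 + 100) + K, by positivity,
    fun s hs0 hs1 z hz0 hz => ?_⟩
  have hn : 0 < ‖z‖ := norm_pos_iff.2 hz0
  have hx0 : bdiff z ≠ 0 :=
    norm_pos_iff.1 (lt_of_lt_of_le (mul_pos hm hn) (hmb z hz))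
  set v := (bdiff z)⁻¹ - z⁻¹ - 1 / 2 with hv
  have hvn : ‖v‖ ≤ C * ‖z‖ := h z hz0 hz
  have hv4 : ‖v‖ ≤ 4 * C := by nlinarith
  have hxn : ‖bdiff z‖ ≤ 4 * K := by
    have := norm_bdiff_le hz
    nlinarith
  have hsn : ‖(s : ℂ)‖ ≤ 1 := by rw [Complex.norm_real, Real.norm_of_nonneg hs0]; exact hs1
  have hexp : ‖Complex.exp (-(s * z)) - (1 - s * z)‖ ≤ K * ‖z‖ ^ 2 := by
    have h1 := Complex.norm_exp_sub_sum_le_norm_mul_exp (-(s * z)) 2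
    have h2 : |s| * ‖z‖ ≤ ‖z‖ := by
      rw [abs_of_nonneg hs0]; exact mul_le_of_le_one_left hn.le hs1
    simp only [Finset.sum_range_succ, Finset.sum_range_zero, Nat.factorial] at h1
    norm_num at h1
    rw [sub_eq_add_neg (1 : ℂ)]
    refine h1.trans ?_
    rw [mul_comm]
    have : Real.exp (|s| * ‖z‖) ≤ K := Real.exp_le_exp.2 (h2.trans hz)
    gcongr
  have hinv : (bdiff z)⁻¹ = z⁻¹ + 1 / 2 + v := by rw [hv]; ring
  have e : quadSymbol s z - Complex.exp (-(s * z)) * (z ^ 2)⁻¹ =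
      ((2 * v * z⁻¹ + v ^ 2 - 1 / 2 + bdiff z / 4)
        - s * (v - bdiff z / 2)
        + s ^ 2 / 2 * (1 - bdiff z / 2 - bdiff z ^ 2 / 2))
      - (Complex.exp (-(s * z)) - (1 - s * z)) * (z ^ 2)⁻¹ := by
    have e1 : quadSymbol s z = ((bdiff z)⁻¹ ^ 2 - (bdiff z)⁻¹ - 1 / 4 + bdiff z / 4)
        - s * ((bdiff z)⁻¹ - 1 / 2 - bdiff z / 2)
        + s ^ 2 / 2 * (1 - bdiff z / 2 - bdiff z ^ 2 / 2) := by
      unfold quadSymbol bdfSymbol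
      field_simp; ring
    rw [e1, hinv]
    field_simp
    ring
  have hvz : ‖v * z⁻¹‖ ≤ C := by
    rw [norm_mul, norm_inv, ← div_eq_mul_inv, div_le_iff₀ hn]; exact hvn
  have b1 : ‖2 * v * z⁻¹ + v ^ 2 - 1 / 2 + bdiff z / 4‖ ≤ 2 * C + 16 * C ^ 2 + 1 / 2 + K := by
    refine (norm_add_le _ _).trans (add_le_add ((norm_sub_le _ _).trans
      (add_le_add ((norm_add_le _ _).trans (add_le_add ?_ ?_)) ?_)) ?_)
    · rw [mul_assoc, norm_mul, Complex.norm_two]; linarith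
    · rw [norm_pow]
      calc ‖v‖ ^ 2 ≤ (4 * C) ^ 2 := by gcongr
        _ = _ := by ring
    · norm_num
    · rw [norm_div]; norm_num; linarith
  have b2 : ‖(s : ℂ) * (v - bdiff z / 2)‖ ≤ 4 * C + 2 * K := by
    rw [norm_mul]
    have : ‖v - bdiff z / 2‖ ≤ 4 * C + 2 * K := by
      refine (norm_sub_le _ _).trans (add_le_add hv4 ?_)
      rw [norm_div, Complex.norm_two]; linarith
    exact (mul_le_of_le_one_left (norm_nonneg _) hsn).trans this
  have b3 : ‖(s : ℂ) ^ 2 / 2 * (1 - bdiff z / 2 - bdiff z ^ 2 / 2)‖ ≤ 1 + 2 * K + 8 * K ^ 2 := by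
    rw [norm_mul]
    have h1 : ‖(s : ℂ) ^ 2 / 2‖ ≤ 1 := by
      rw [norm_div, norm_pow, Complex.norm_two]
      have : ‖(s : ℂ)‖ ^ 2 ≤ 1 := pow_le_one₀ (norm_nonneg _) hsn
      linarith
    refine (mul_le_of_le_one_left (norm_nonneg _) h1).trans ?_
    refine (norm_sub_le _ _).trans (add_le_add ((norm_sub_le _ _).trans (add_le_add ?_ ?_)) ?_)
    · simp
    · rw [norm_div, Complex.norm_two]; linarith
    · rw [norm_div, norm_pow, Complex.norm_two]
      have : ‖bdiff z‖ ^ 2 ≤ (4 * K) ^ 2 := by gcongr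
      linarith
  have b4 : ‖(Complex.exp (-(s * z)) - (1 - s * z)) * (z ^ 2)⁻¹‖ ≤ K := by
    rw [norm_mul, norm_inv, norm_pow, ← div_eq_mul_inv, div_le_iff₀ (by positivity)]
    exact hexp
  rw [e]
  refine (norm_sub_le _ _).trans (add_le_add (((norm_add_le _ _).trans
    (add_le_add ((norm_sub_le _ _).trans (add_le_add b1 b2)) b3)).trans ?_) b4)
  nlinarith

/-! ### Cauchy estimates -/

theorem rpow_le_of_comparable {a b : ℝ} (hb : 0 < b) (h1 : b / 2 ≤ a) (h2 : a ≤ 2 * b) (m : ℝ) :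
    a ^ m ≤ 2 ^ |m| * b ^ m := by
  have ha : 0 < a := by linarith
  rw [← div_le_iff₀ (by positivity), ← Real.div_rpow ha.le hb.le]
  rcases le_total 0 m with hm | hm
  · rw [abs_of_nonneg hm]
    refine Real.rpow_le_rpow (by positivity) ?_ hm
    rw [div_le_iff₀ hb]; exact h2
  · rw [abs_of_nonpos hm, Real.rpow_neg (by norm_num), ← Real.inv_rpow (by norm_num)]
    refine Real.rpow_le_rpow_of_nonpos (by norm_num) ?_ hm
    rw [le_div_iff₀ hb]; linarith

/-- A bound by a power of `‖z‖` on a set that contains a disc of radius proportional to `‖z₀‖`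
passes to the derivatives at `z₀`, each derivative costing one power. -/
theorem norm_iteratedDeriv_le_rpow {F : ℂ → ℂ} {S : Set ℂ} {r C m : ℝ} (k : ℕ) {z₀ : ℂ}
    (hz₀ : z₀ ≠ 0) (hr : 0 < r) (hr2 : r ≤ 1 / 2) (hS : Metric.closedBall z₀ (r * ‖z₀‖) ⊆ S)
    (hd : ∀ z ∈ S, DifferentiableAt ℂ F z) (hC : 0 ≤ C) (hb : ∀ z ∈ S, ‖F z‖ ≤ C * ‖z‖ ^ m) :
    ‖iteratedDeriv k F z₀‖ ≤ k.factorial * (C * 2 ^ |m|) / r ^ k * ‖z₀‖ ^ (m - k) := by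
  have hn : 0 < ‖z₀‖ := norm_pos_iff.2 hz₀
  have hR : 0 < r * ‖z₀‖ := by positivity
  have hdc : DiffContOnCl ℂ F (Metric.ball z₀ (r * ‖z₀‖)) := by
    refine DifferentiableOn.diffContOnCl fun z hz => (hd z (hS ?_)).differentiableWithinAt
    exact Metric.closure_ball_subset_closedBall hz
  have := Complex.norm_iteratedDeriv_le_of_forall_mem_sphere_norm_le k hR hdc
    (C := C * (2 ^ |m| * ‖z₀‖ ^ m)) fun z hz => ?_
  · refine this.trans_eq ?_
    rw [Real.rpow_sub hn, Real.rpow_natCast, mul_pow]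
    field_simp
  · refine (hb z (hS (Metric.sphere_subset_closedBall hz))).trans ?_
    have h1 : ‖z - z₀‖ = r * ‖z₀‖ := by simpa [dist_eq_norm] using hz
    have h2 : r * ‖z₀‖ ≤ ‖z₀‖ / 2 := by nlinarith
    have h3 := norm_sub_norm_le z z₀
    have h4 := norm_sub_norm_le z₀ z
    rw [norm_sub_rev] at h4
    refine mul_le_mul_of_nonneg_left (rpow_le_of_comparable hn ?_ ?_ m) hC <;> linarith

theorem closedBall_subset_sector {δ : ℝ} (hδ : 0 < δ) (hδ5 : δ ≤ 1 / 5) {z₀ : ℂ} (hz₀ : 0 < z₀.re) :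
    Metric.closedBall z₀ (δ / 2 * ‖z₀‖) ⊆ {z | z ≠ 0 ∧ -δ * ‖z‖ ≤ z.re} := by
  intro z hz
  have hn : 0 < ‖z₀‖ := norm_pos_iff.2 fun h => by rw [h] at hz₀; simp at hz₀
  have h1 : ‖z - z₀‖ ≤ δ / 2 * ‖z₀‖ := by simpa [dist_eq_norm] using hz
  have h4 := norm_sub_norm_le z₀ z
  rw [norm_sub_rev] at h4
  have h5 : ‖z₀‖ / 2 ≤ ‖z‖ := by nlinarith
  refine ⟨norm_pos_iff.1 (by linarith), ?_⟩
  have h6 := Complex.abs_re_le_norm (z - z₀)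
  have h7 := neg_abs_le (z - z₀).re
  rw [Complex.sub_re] at h6 h7
  nlinarith

/-- The discs for Cauchy's estimate at the points of the segment `|Im z| ≤ π` of a line
`Re z = c ≤ 1` stay within `‖z‖ ≤ 4`, where the expansions of the symbols hold. -/
theorem closedBall_subset_nearSector {δ : ℝ} (hδ : 0 < δ) (hδ5 : δ ≤ 1 / 5) {c θ : ℝ} (hc : 0 < c)
    (hc1 : c ≤ 1) (hθ : |θ| ≤ Real.pi) :
    Metric.closedBall (vline c θ) (δ / 2 * ‖vline c θ‖) ⊆ nearSector δ := by
  intro z hz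
  have h := closedBall_subset_sector hδ hδ5 (z₀ := vline c θ) (by simpa using hc) hz
  refine ⟨h.1, ?_, h.2⟩
  have h1 : ‖z - vline c θ‖ ≤ δ / 2 * ‖vline c θ‖ := by simpa [dist_eq_norm] using hz
  have h2 : ‖vline c θ‖ ≤ 3.4 := by
    rw [Complex.norm_eq_sqrt_sq_add_sq, vline_re, vline_im]
    refine Real.sqrt_le_iff.2 ⟨by norm_num, ?_⟩
    have h3 := Real.pi_lt_d2
    have h4 : θ ^ 2 ≤ 3.15 ^ 2 := by
      rw [← sq_abs]
      exact pow_le_pow_left₀ (abs_nonneg _) (by linarith) 2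
    nlinarith
  have h3 := norm_sub_norm_le z (vline c θ)
  nlinarith [norm_nonneg (vline c θ)]

/-! ### The transforms of the exact and of the discrete response -/

theorem mlfLaplace_differentiableAt {α β μ : ℝ} {z : ℂ} (hz : z ∈ Complex.slitPlane)
    (h : z ^ (α : ℂ) + μ ≠ 0) : DifferentiableAt ℂ (mlfLaplace α β μ) z := by
  have hp : ∀ s : ℂ, DifferentiableAt ℂ (fun z : ℂ => z ^ s) z := fun s =>
    differentiableAt_id.cpow_const hz
  exact (hp _).mul ((hp _).div ((hp _).add_const _) h)

theorem norm_mlfLaplace_le {α β μ C : ℝ} {z : ℂ} (h : ‖z ^ (α : ℂ) / (z ^ (α : ℂ) + μ)‖ ≤ C) :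
    ‖mlfLaplace α β μ z‖ ≤ C * ‖z‖ ^ (-(β + 1)) := by
  unfold mlfLaplace
  rw [norm_mul, Complex.norm_cpow_real, mul_comm]
  gcongr

/-- The symbol of the operator that maps the transform of the time-integrated data, multiplied by
the BDF symbol, to the discrete solution. -/
noncomputable def schemeResolvent (α μ : ℝ) (z : ℂ) : ℂ := shiftSymbol α z / schemeSymbol α μ z

theorem schemeResolvent_differentiableAt {α μ : ℝ} {z : ℂ} (hz : bdiff z ∈ Complex.slitPlane)
    (h : schemeSymbol α μ z ≠ 0) : DifferentiableAt ℂ (schemeResolvent α μ) z := by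
  have h1 := differentiable_bdiff z
  have h2 : DifferentiableAt ℂ (shiftSymbol α) z := (h1.const_mul _).const_sub _
  exact h2.div ((h1.cpow_const hz).add (h2.const_mul _)) h

/-- If the discrete data `E` approximate the exact data `e = O(z ^ r)` with an error
`O(z ^ (r + 2))`, then the discrete solution approximates the exact one with an error
`O(z ^ (r + 2 - α))`. -/
theorem norm_response_sub_le {α μ C C' r : ℝ} {z E e : ℂ} (hz : z ≠ 0) (hC : 0 ≤ C)
    (h1 : ‖z ^ (α : ℂ) * shiftSymbol α z / schemeSymbol α μ z‖ ≤ C)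
    (h2 : ‖z ^ (α : ℂ) * shiftSymbol α z / schemeSymbol α μ z - z ^ (α : ℂ) / (z ^ (α : ℂ) + μ)‖
      ≤ C * ‖z‖ ^ 2)
    (hE : ‖E - e‖ ≤ C' * ‖z‖ ^ (r + 2)) (he : ‖e‖ ≤ C' * ‖z‖ ^ r) :
    ‖schemeResolvent α μ z * E - z ^ ((-α : ℝ) : ℂ) * (z ^ (α : ℂ) / (z ^ (α : ℂ) + μ)) * e‖
      ≤ 2 * C * C' * ‖z‖ ^ (r + 2 - α) := by
  have hn : 0 < ‖z‖ := norm_pos_iff.2 hz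
  have hcp : z ^ ((-α : ℝ) : ℂ) * z ^ (α : ℂ) = 1 := by
    rw [← Complex.cpow_add _ _ hz]; simp
  have e1 : schemeResolvent α μ z * E - z ^ ((-α : ℝ) : ℂ) * (z ^ (α : ℂ) / (z ^ (α : ℂ) + μ)) * e
      = z ^ ((-α : ℝ) : ℂ) * (z ^ (α : ℂ) * shiftSymbol α z / schemeSymbol α μ z * (E - e)
        + (z ^ (α : ℂ) * shiftSymbol α z / schemeSymbol α μ z
          - z ^ (α : ℂ) / (z ^ (α : ℂ) + μ)) * e) := by
    have : schemeResolvent α μ z = z ^ ((-α : ℝ) : ℂ) *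
        (z ^ (α : ℂ) * shiftSymbol α z / schemeSymbol α μ z) := by
      unfold schemeResolvent
      rw [mul_div_assoc, ← mul_assoc, hcp, one_mul]
    rw [this]; ring
  rw [e1, norm_mul, Complex.norm_cpow_real]
  have h3 : ‖z‖ ^ (r + 2) = ‖z‖ ^ 2 * ‖z‖ ^ r := by
    rw [add_comm, Real.rpow_add hn]; norm_cast
  have h4 : ‖z‖ ^ (r + 2 - α) = ‖z‖ ^ (-α) * ‖z‖ ^ (r + 2) := by
    rw [← Real.rpow_add hn]; congr 1; ring
  rw [h4]
  calc _ ≤ ‖z‖ ^ (-α) * (C * (C' * ‖z‖ ^ (r + 2)) + C * ‖z‖ ^ 2 * (C' * ‖z‖ ^ r)) := by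
        gcongr
        refine (norm_add_le _ _).trans ?_
        rw [norm_mul, norm_mul]
        gcongr
    _ = _ := by rw [h3]; ring

/-! ### Power series on the unit disc -/

/-- The power series converges on the open unit disc. -/
def ConvOnDisc (f : PowerSeries ℂ) : Prop :=
  ∀ ζ : ℂ, ‖ζ‖ < 1 → Summable fun n => PowerSeries.coeff n f * ζ ^ n

/-- The sum of a power series. -/
noncomputable def psum (f : PowerSeries ℂ) (ζ : ℂ) : ℂ := ∑' n, PowerSeries.coeff n f * ζ ^ n

theorem ConvOnDisc.mul_hasSum {f g : PowerSeries ℂ} (hf : ConvOnDisc f) (hg : ConvOnDisc g) {ζ : ℂ}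
    (hζ : ‖ζ‖ < 1) :
    HasSum (fun n => PowerSeries.coeff n (f * g) * ζ ^ n) (psum f ζ * psum g ζ) := by
  have h1 := (hf ζ hζ).norm
  have h2 := (hg ζ hζ).norm
  have e : ∀ n, PowerSeries.coeff n (f * g) * ζ ^ n = ∑ kl ∈ Finset.HasAntidiagonal.antidiagonal n,
      (PowerSeries.coeff kl.1 f * ζ ^ kl.1) * (PowerSeries.coeff kl.2 g * ζ ^ kl.2) := by
    intro n
    rw [PowerSeries.coeff_mul, Finset.sum_mul]
    refine Finset.sum_congr rfl fun kl hkl => ?_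
    rw [← Finset.HasAntidiagonal.mem_antidiagonal.1 hkl, pow_add]
    ring
  simp only [e]
  rw [psum, psum, tsum_mul_tsum_eq_tsum_sum_antidiagonal_of_summable_norm h1 h2]
  exact (summable_norm_sum_mul_antidiagonal_of_summable_norm h1 h2).of_norm.hasSum

theorem ConvOnDisc.mul {f g : PowerSeries ℂ} (hf : ConvOnDisc f) (hg : ConvOnDisc g) :
    ConvOnDisc (f * g) := fun _ hζ => (hf.mul_hasSum hg hζ).summable

theorem psum_mul {f g : PowerSeries ℂ} (hf : ConvOnDisc f) (hg : ConvOnDisc g) {ζ : ℂ}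
    (hζ : ‖ζ‖ < 1) : psum (f * g) ζ = psum f ζ * psum g ζ := (hf.mul_hasSum hg hζ).tsum_eq

theorem ConvOnDisc.add {f g : PowerSeries ℂ} (hf : ConvOnDisc f) (hg : ConvOnDisc g) :
    ConvOnDisc (f + g) := fun ζ hζ => by
  simpa [add_mul] using (hf ζ hζ).add (hg ζ hζ)

theorem psum_add {f g : PowerSeries ℂ} (hf : ConvOnDisc f) (hg : ConvOnDisc g) {ζ : ℂ}
    (hζ : ‖ζ‖ < 1) : psum (f + g) ζ = psum f ζ + psum g ζ := by
  simp only [psum, map_add, add_mul]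
  exact (hf ζ hζ).tsum_add (hg ζ hζ)

theorem ConvOnDisc.of_hasSum {f : PowerSeries ℂ} {F : ℂ → ℂ}
    (h : ∀ ζ : ℂ, ‖ζ‖ < 1 → HasSum (fun n => PowerSeries.coeff n f * ζ ^ n) (F ζ)) :
    ConvOnDisc f := fun ζ hζ => (h ζ hζ).summable

theorem hasSum_C (a ζ : ℂ) :
    HasSum (fun n => PowerSeries.coeff n (PowerSeries.C a) * ζ ^ n) a := by
  convert! hasSum_single (f := fun n => PowerSeries.coeff n (PowerSeries.C a) * ζ ^ n) 0
    (fun n hn => by simp [PowerSeries.coeff_C, hn]) using 1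
  simp

theorem hasSum_X (ζ : ℂ) :
    HasSum (fun n => PowerSeries.coeff n (PowerSeries.X : PowerSeries ℂ) * ζ ^ n) ζ := by
  convert! hasSum_single
    (f := fun n => PowerSeries.coeff n (PowerSeries.X : PowerSeries ℂ) * ζ ^ n) 1
    (fun n hn => by simp [PowerSeries.coeff_X, hn]) using 1
  simp

theorem convOnDisc_C (a : ℂ) : ConvOnDisc (PowerSeries.C a) := .of_hasSum fun ζ _ => hasSum_C a ζ

theorem convOnDisc_X : ConvOnDisc PowerSeries.X := .of_hasSum fun ζ _ => hasSum_X ζ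

@[simp] theorem psum_C (a ζ : ℂ) : psum (PowerSeries.C a) ζ = a := (hasSum_C a ζ).tsum_eq

@[simp] theorem psum_X (ζ : ℂ) : psum PowerSeries.X ζ = ζ := (hasSum_X ζ).tsum_eq

/-- The coefficients of a convergent power series are bounded by every geometric sequence with
ratio larger than `1`. -/
theorem ConvOnDisc.bound {f : PowerSeries ℂ} (hf : ConvOnDisc f) {r : ℝ} (hr0 : 0 < r)
    (hr : r < 1) :
    ∃ B : ℝ, ∀ n, ‖PowerSeries.coeff n f‖ * r ^ n ≤ B := by
  obtain ⟨B, hB⟩ := (hf (r : ℂ) (by rwa [Complex.norm_real, Real.norm_of_nonneg hr0.le])).norm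
    |>.tendsto_atTop_zero.bddAbove_range
  refine ⟨B, fun n => ?_⟩
  have := hB ⟨n, rfl⟩
  simpa [abs_of_pos hr0] using this

/-- The Euler derivative `X d/dX`, up to sign: multiplication of the `n`-th coefficient by `-n`. -/
noncomputable def eulerNeg (f : PowerSeries ℂ) : PowerSeries ℂ :=
  PowerSeries.mk fun n => -(n : ℂ) * PowerSeries.coeff n f

theorem ConvOnDisc.eulerNeg {f : PowerSeries ℂ} (hf : ConvOnDisc f) : ConvOnDisc (eulerNeg f) := by
  intro ζ hζ
  obtain ⟨r, h1, h2⟩ := exists_between hζ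
  have hr0 : 0 < r := (norm_nonneg _).trans_lt h1
  obtain ⟨B, hB⟩ := hf.bound hr0 h2
  have hq : ‖(‖ζ‖ / r)‖ < 1 := by
    rw [norm_div, norm_norm, Real.norm_of_nonneg hr0.le, div_lt_one hr0]; exact h1
  refine Summable.of_norm_bounded ((summable_pow_mul_geometric_of_norm_lt_one 1 hq).mul_left B)
    fun n => ?_
  simp only [SubDiff.eulerNeg, PowerSeries.coeff_mk, norm_mul, norm_neg, norm_pow,
    Complex.norm_natCast, pow_one, div_pow]
  calc (n : ℝ) * ‖PowerSeries.coeff n f‖ * ‖ζ‖ ^ n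
      = (‖PowerSeries.coeff n f‖ * r ^ n) * (n * (‖ζ‖ ^ n / r ^ n)) := by field_simp
    _ ≤ B * (n * (‖ζ‖ ^ n / r ^ n)) := by gcongr; exact hB n

theorem norm_cexp_neg_lt_one {z : ℂ} (hz : 0 < z.re) : ‖Complex.exp (-z)‖ < 1 := by
  rw [Complex.norm_exp, Real.exp_lt_one_iff]; simpa using hz

theorem hasDerivAt_psum_exp {f : PowerSeries ℂ} (hf : ConvOnDisc f) {z : ℂ} (hz : 0 < z.re) :
    HasDerivAt (fun z => psum f (Complex.exp (-z))) (psum (eulerNeg f) (Complex.exp (-z))) z := by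
  set U : Set ℂ := {w | z.re / 2 < w.re} with hU
  have hUo : IsOpen U := isOpen_lt continuous_const Complex.continuous_re
  have hzU : z ∈ U := by simpa [hU] using hz
  have hr : Real.exp (-(z.re / 2)) < 1 := Real.exp_lt_one_iff.2 (by linarith)
  have hu := (hf (Real.exp (-(z.re / 2)) : ℝ) (by
    rwa [Complex.norm_real, Real.norm_of_nonneg (Real.exp_pos _).le])).norm
  have hterm : ∀ n, ∀ w : ℂ, HasDerivAt (fun z => PowerSeries.coeff n f * Complex.exp (-z) ^ n)
      (PowerSeries.coeff n (eulerNeg f) * Complex.exp (-w) ^ n) w := by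
    intro n w
    have h1 : HasDerivAt (fun z : ℂ => Complex.exp (n * -z)) (Complex.exp (n * -w) * (n * -1)) w :=
      ((hasDerivAt_neg w).const_mul (n : ℂ)).cexp
    simp only [← Complex.exp_nat_mul]
    convert! h1.const_mul (PowerSeries.coeff n f) using 1
    simp only [eulerNeg, PowerSeries.coeff_mk]
    ring
  have hb : ∀ n, ∀ w ∈ U, ‖PowerSeries.coeff n f * Complex.exp (-w) ^ n‖ ≤
      ‖PowerSeries.coeff n f * ((Real.exp (-(z.re / 2)) : ℝ) : ℂ) ^ n‖ := by
    intro n w hw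
    have hw' : z.re / 2 < w.re := hw
    rw [norm_mul, norm_mul, norm_pow, norm_pow, Complex.norm_exp, Complex.norm_real,
      Real.norm_of_nonneg (Real.exp_pos _).le, Complex.neg_re]
    gcongr
  have hd := Complex.differentiableOn_tsum_of_summable_norm hu
    (fun n => fun w _ => (hterm n w).differentiableAt.differentiableWithinAt) hUo hb
  have hs := Complex.hasSum_deriv_of_summable_norm hu
    (fun n => fun w _ => (hterm n w).differentiableAt.differentiableWithinAt) hUo hb hzU
  have hd' := (hd.differentiableAt (hUo.mem_nhds hzU)).hasDerivAt
  rw [← hs.tsum_eq] at hd'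
  simp only [(hterm _ _).deriv] at hd'
  exact hd'

theorem differentiableOn_psum_exp {f : PowerSeries ℂ} (hf : ConvOnDisc f) :
    DifferentiableOn ℂ (fun z => psum f (Complex.exp (-z))) {z | 0 < z.re} := fun _ hz =>
  (hasDerivAt_psum_exp hf hz).differentiableAt.differentiableWithinAt

theorem ConvOnDisc.eulerNeg_iterate {f : PowerSeries ℂ} (hf : ConvOnDisc f) (k : ℕ) :
    ConvOnDisc (SubDiff.eulerNeg^[k] f) := by
  induction k with
  | zero => exact hf
  | succ k ih => rw [Function.iterate_succ_apply']; exact ih.eulerNeg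

theorem coeff_eulerNeg_iterate (f : PowerSeries ℂ) (k n : ℕ) :
    PowerSeries.coeff n (eulerNeg^[k] f) = (-(n : ℂ)) ^ k * PowerSeries.coeff n f := by
  induction k with
  | zero => simp
  | succ k ih =>
    rw [Function.iterate_succ_apply', eulerNeg, PowerSeries.coeff_mk, ih]; ring

theorem iteratedDeriv_psum_exp {f : PowerSeries ℂ} (hf : ConvOnDisc f) (k : ℕ) {z : ℂ}
    (hz : 0 < z.re) : iteratedDeriv k (fun z => psum f (Complex.exp (-z))) z =
      psum (eulerNeg^[k] f) (Complex.exp (-z)) := by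
  induction k generalizing z with
  | zero => simp
  | succ k ih =>
    rw [iteratedDeriv_succ, Function.iterate_succ_apply']
    have : iteratedDeriv k (fun z => psum f (Complex.exp (-z))) =ᶠ[𝓝 z]
        fun z => psum (eulerNeg^[k] f) (Complex.exp (-z)) := by
      filter_upwards [isOpen_re_pos.mem_nhds hz] with w hw using ih hw
    rw [this.deriv_eq, (hasDerivAt_psum_exp (hf.eulerNeg_iterate k) hz).deriv]

/-- Orthogonality of the exponentials on a period. -/
theorem integral_cexp_int_mul (m : ℤ) :
    ∫ θ in (-Real.pi)..Real.pi, Complex.exp (m * (θ * Complex.I)) =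
      if m = 0 then ((2 * Real.pi : ℝ) : ℂ) else 0 := by
  split_ifs with h
  · simp [h]; ring
  · have hc : (m : ℂ) * Complex.I ≠ 0 := mul_ne_zero (by exact_mod_cast h) Complex.I_ne_zero
    have e : ∀ θ : ℝ, Complex.exp (m * (θ * Complex.I)) = Complex.exp ((m * Complex.I) * θ) :=
      fun θ => by congr 1; ring
    simp only [e]
    rw [integral_exp_mul_complex hc, div_eq_zero_iff]
    left
    rw [sub_eq_zero, Complex.exp_eq_exp_iff_exists_int]
    exact ⟨m, by push_cast; ring⟩

/-- Cauchy's formula for the coefficients of a power series, on the circle `|ζ| = exp (-c)`. -/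
theorem coeff_eq_integral {f : PowerSeries ℂ} (hf : ConvOnDisc f) {c : ℝ} (hc : 0 < c) (n : ℕ) :
    ∫ θ in (-Real.pi)..Real.pi, Complex.exp (((n : ℝ) : ℂ) * vline c θ) *
      psum f (Complex.exp (-vline c θ)) = ((2 * Real.pi : ℝ) : ℂ) * PowerSeries.coeff n f := by
  have hpi : -Real.pi ≤ Real.pi := by linarith [Real.pi_pos]
  set F : ℕ → ℝ → ℂ := fun m θ => Complex.exp (((n : ℝ) : ℂ) * vline c θ) *
      (PowerSeries.coeff m f * Complex.exp (-vline c θ) ^ m) with hF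
  have hcont : ∀ m, Continuous (F m) := fun m => by
    have := continuous_vline c
    simp only [hF]; fun_prop
  have hr : Real.exp (-c) < 1 := Real.exp_lt_one_iff.2 (by linarith)
  have hu := (hf (Real.exp (-c) : ℝ) (by
    rwa [Complex.norm_real, Real.norm_of_nonneg (Real.exp_pos _).le])).norm
  have hnorm : ∀ m θ, ‖F m θ‖ = Real.exp (n * c) *
      ‖PowerSeries.coeff m f * ((Real.exp (-c) : ℝ) : ℂ) ^ m‖ := by
    intro m θ
    simp only [hF]
    rw [norm_mul, norm_cexp_vline, norm_mul, norm_mul, norm_pow, norm_pow, Complex.norm_exp,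
      Complex.norm_real, Real.norm_of_nonneg (Real.exp_pos _).le, Complex.neg_re, vline_re]
  have h1 := intervalIntegral.hasSum_integral_of_dominated_convergence (a := -Real.pi)
    (b := Real.pi) (F := F) (f := fun θ => Complex.exp (((n : ℝ) : ℂ) * vline c θ) *
      psum f (Complex.exp (-vline c θ))) (μ := volume)
    (fun m _ => Real.exp (n * c) * ‖PowerSeries.coeff m f * ((Real.exp (-c) : ℝ) : ℂ) ^ m‖)
    (fun m => (hcont m).aestronglyMeasurable)
    (fun m => Eventually.of_forall fun θ _ => (hnorm m θ).le)
    (Eventually.of_forall fun θ _ => hu.mul_left _)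
    (by simp)
    (Eventually.of_forall fun θ _ =>
      (hf _ (norm_cexp_neg_lt_one (by simpa using hc))).hasSum.mul_left _)
  have h2 : ∀ m, ∫ θ in (-Real.pi)..Real.pi, F m θ =
      if m = n then ((2 * Real.pi : ℝ) : ℂ) * PowerSeries.coeff n f else 0 := by
    intro m
    have e : ∀ θ : ℝ, F m θ = (PowerSeries.coeff m f * Complex.exp (((n : ℤ) - m : ℤ) * c)) *
        Complex.exp (((n : ℤ) - m : ℤ) * (θ * Complex.I)) := by
      intro θ
      simp only [hF]
      rw [← Complex.exp_nat_mul, mul_left_comm, ← Complex.exp_add, mul_assoc, ← Complex.exp_add]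
      congr 2
      unfold vline
      push_cast
      ring
    simp only [e]
    rw [intervalIntegral.integral_const_mul, integral_cexp_int_mul]
    by_cases hmn : m = n
    · subst hmn; simp; ring
    · have : ((n : ℤ) - m : ℤ) ≠ 0 := by omega
      rw [if_neg this, if_neg hmn, mul_zero]
  simp only [h2] at h1
  exact h1.unique (by
    convert! hasSum_single (f := fun m => if m = n then
      ((2 * Real.pi : ℝ) : ℂ) * PowerSeries.coeff n f else 0) n (fun m hm => if_neg hm) using 1
    simp)

/-- The discrete counterpart of integration by parts: `d/dz` multiplies the `n`-th coefficient by
`-n`. -/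
theorem coeff_eq_integral_iteratedDeriv {f : PowerSeries ℂ} (hf : ConvOnDisc f) {c : ℝ} (hc : 0 < c)
    (n k : ℕ) :
    ∫ θ in (-Real.pi)..Real.pi, Complex.exp (((n : ℝ) : ℂ) * vline c θ) *
      iteratedDeriv k (fun z => psum f (Complex.exp (-z))) (vline c θ)
      = ((2 * Real.pi : ℝ) : ℂ) * ((-(n : ℂ)) ^ k * PowerSeries.coeff n f) := by
  rw [← coeff_eulerNeg_iterate, ← coeff_eq_integral (hf.eulerNeg_iterate k) hc]
  refine intervalIntegral.integral_congr fun θ _ => ?_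
  rw [iteratedDeriv_psum_exp hf k (by simpa using hc)]

theorem ext_of_psum_eq {f g : PowerSeries ℂ} (hf : ConvOnDisc f) (hg : ConvOnDisc g)
    (h : ∀ ζ : ℂ, ‖ζ‖ < 1 → psum f ζ = psum g ζ) : f = g := by
  ext n
  have hpi : ((2 * Real.pi : ℝ) : ℂ) ≠ 0 := by
    exact_mod_cast (by positivity : (2 * Real.pi : ℝ) ≠ 0)
  apply mul_left_cancel₀ hpi
  rw [← coeff_eq_integral hf one_pos, ← coeff_eq_integral hg one_pos]
  refine intervalIntegral.integral_congr fun θ _ => ?_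
  rw [h _ (norm_cexp_neg_lt_one (by simp))]

theorem differentiableOn_psum {f : PowerSeries ℂ} (hf : ConvOnDisc f) :
    DifferentiableOn ℂ (psum f) (Metric.ball 0 1) := by
  intro ζ hζ
  have hζ' : ‖ζ‖ < 1 := by simpa using hζ
  obtain ⟨r, h1, h2⟩ := exists_between hζ'
  have hr0 : 0 < r := (norm_nonneg _).trans_lt h1
  have hu := (hf (r : ℂ) (by rwa [Complex.norm_real, Real.norm_of_nonneg hr0.le])).norm
  have hd := Complex.differentiableOn_tsum_of_summable_norm (U := Metric.ball (0 : ℂ) r)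
    (F := fun n ζ => PowerSeries.coeff n f * ζ ^ n) hu
    (fun n => (by fun_prop : Differentiable ℂ fun ζ : ℂ =>
      PowerSeries.coeff n f * ζ ^ n).differentiableOn) Metric.isOpen_ball (fun n w hw => by
      have : ‖w‖ < r := by simpa using hw
      rw [norm_mul, norm_mul, norm_pow, norm_pow, Complex.norm_real, Real.norm_of_nonneg hr0.le]
      gcongr)
  exact (hd.differentiableAt
    (Metric.isOpen_ball.mem_nhds (by simpa using h1))).differentiableWithinAt

/-- If the sum of a power series has no zero in the unit disc, then the inverse power series
converges there. -/
theorem ConvOnDisc.inv_of_ne_zero {f g : PowerSeries ℂ} (hf : ConvOnDisc f) (hfg : f * g = 1)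
    (h0 : ∀ ζ : ℂ, ‖ζ‖ < 1 → psum f ζ ≠ 0) :
    ConvOnDisc g ∧ ∀ ζ : ℂ, ‖ζ‖ < 1 → psum g ζ = (psum f ζ)⁻¹ := by
  have hd : DifferentiableOn ℂ (fun ζ => (psum f ζ)⁻¹) (Metric.ball 0 1) :=
    (differentiableOn_psum hf).inv fun ζ hζ => h0 ζ (by simpa using hζ)
  set h : PowerSeries ℂ := PowerSeries.mk fun n =>
    (n.factorial : ℂ)⁻¹ * iteratedDeriv n (fun ζ => (psum f ζ)⁻¹) 0 with hh
  have hs : ∀ ζ : ℂ, ‖ζ‖ < 1 → HasSum (fun n => PowerSeries.coeff n h * ζ ^ n) (psum f ζ)⁻¹ := by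
    intro ζ hζ
    have := Complex.hasSum_taylorSeries_on_ball hd (z := ζ) (by simpa using hζ)
    convert! this using 1
    ext n
    simp [hh]
    ring
  have hc : ConvOnDisc h := .of_hasSum hs
  have h1 : f * h = PowerSeries.C 1 := by
    refine ext_of_psum_eq (hf.mul hc) (convOnDisc_C 1) fun ζ hζ => ?_
    rw [psum_mul hf hc hζ, psum_C, psum, psum, (hs ζ hζ).tsum_eq]
    exact mul_inv_cancel₀ (h0 ζ hζ)
  rw [map_one] at h1
  have h2 : g = h := left_inv_eq_right_inv (by rwa [mul_comm] at hfg) h1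
  rw [h2]
  exact ⟨hc, fun ζ hζ => (hs ζ hζ).tsum_eq⟩

/-! ### Generating functions of the scheme -/

/-- A real power series, regarded as a complex one. -/
noncomputable abbrev toC (f : PowerSeries ℝ) : PowerSeries ℂ := PowerSeries.map Complex.ofRealHom f

theorem coeff_toC (f : PowerSeries ℝ) (n : ℕ) :
    PowerSeries.coeff n (toC f) = ((PowerSeries.coeff n f : ℝ) : ℂ) := by simp [toC]

/-- The generating function of the Grünwald-Letnikov coefficients. -/
noncomputable def glSeries (α : ℝ) : PowerSeries ℝ := PowerSeries.mk (glCoeff α)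

/-- The generating function of the shift `v ↦ (1 - α/2) v(t) + (α/2) v(t - τ)`. -/
noncomputable def shiftSeries (α : ℝ) : PowerSeries ℝ :=
  PowerSeries.C (1 - α / 2) + PowerSeries.C (α / 2) * PowerSeries.X

/-- The generating function of the left-hand side of the scheme for the scalar equation with
coefficient `μ` and unit time step. -/
noncomputable def schemeSeries (α μ : ℝ) : PowerSeries ℝ :=
  glSeries α + PowerSeries.C μ * shiftSeries α

/-- The generating function of the second-order backward difference formula. -/
noncomputable def bdfSeries : PowerSeries ℝ :=
  PowerSeries.C (3 / 2) + PowerSeries.C (-2) * PowerSeries.X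
    + PowerSeries.C (1 / 2) * (PowerSeries.X * PowerSeries.X)

/-- The generating function of the discrete response to the time-integrated data. -/
noncomputable def respSeries (α μ : ℝ) : PowerSeries ℝ :=
  bdfSeries * (shiftSeries α * (schemeSeries α μ)⁻¹)

theorem glCoeff_eq_choose (α : ℝ) (n : ℕ) :
    ((glCoeff α n : ℝ) : ℂ) = (-1) ^ n * Ring.choose (α : ℂ) n := by
  induction n with
  | zero => simp [glCoeff]
  | succ n ih =>
    have h1 := Ring.descPochhammer_eq_factorial_smul_choose (α : ℂ) n
    have h2 := Ring.descPochhammer_eq_factorial_smul_choose (α : ℂ) (n + 1)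
    rw [descPochhammer_succ_right, Polynomial.smeval_mul, h1] at h2
    simp only [Polynomial.smeval_sub, Polynomial.smeval_X, Polynomial.smeval_natCast, pow_one,
      pow_zero, nsmul_eq_mul, Nat.factorial_succ, mul_one] at h2
    push_cast at h2
    have hn : ((n : ℂ) + 1) ≠ 0 := by exact_mod_cast Nat.succ_ne_zero n
    have hf : ((n.factorial : ℕ) : ℂ) ≠ 0 := by exact_mod_cast n.factorial_ne_zero
    have h3 : Ring.choose (α : ℂ) n * (α - n) = (n + 1) * Ring.choose (α : ℂ) (n + 1) := by
      apply mul_left_cancel₀ hf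
      linear_combination h2
    have h4 : Ring.choose (α : ℂ) (n + 1) = Ring.choose (α : ℂ) n * (α - n) / (n + 1) := by
      rw [h3]; field_simp
    rw [h4, glCoeff]
    push_cast
    rw [ih]
    field_simp
    ring

theorem hasSum_glSeries (α : ℝ) {ζ : ℂ} (hζ : ‖ζ‖ < 1) :
    HasSum (fun n => PowerSeries.coeff n (toC (glSeries α)) * ζ ^ n) ((1 - ζ) ^ (α : ℂ)) := by
  have h := (Complex.one_add_cpow_hasFPowerSeriesOnBall_zero (a := (α : ℂ))).hasSum (y := -ζ) (by
    rw [← ENNReal.ofReal_one, Metric.eball_ofReal]; simpa using hζ)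
  rw [zero_add, ← sub_eq_add_neg] at h
  convert! h using 1
  ext n
  rw [coeff_toC, glSeries, PowerSeries.coeff_mk, glCoeff_eq_choose, binomialSeries_apply]
  simp only [smul_eq_mul, List.ofFn_const, List.prod_replicate]
  rw [neg_pow]
  ring

theorem convOnDisc_glSeries (α : ℝ) : ConvOnDisc (toC (glSeries α)) :=
  .of_hasSum fun _ => hasSum_glSeries α

theorem toC_shiftSeries (α : ℝ) : toC (shiftSeries α) =
    PowerSeries.C ((1 - α / 2 : ℝ) : ℂ) + PowerSeries.C ((α / 2 : ℝ) : ℂ) * PowerSeries.X := by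
  simp [toC, shiftSeries]

theorem toC_bdfSeries : toC bdfSeries = PowerSeries.C (((3 / 2 : ℝ)) : ℂ)
    + PowerSeries.C ((-2 : ℝ) : ℂ) * PowerSeries.X
    + PowerSeries.C ((1 / 2 : ℝ) : ℂ) * (PowerSeries.X * PowerSeries.X) := by
  simp [toC, bdfSeries]

theorem toC_schemeSeries (α μ : ℝ) : toC (schemeSeries α μ) =
    toC (glSeries α) + PowerSeries.C (μ : ℂ) * toC (shiftSeries α) := by
  simp [toC, schemeSeries]

theorem convOnDisc_shiftSeries (α : ℝ) : ConvOnDisc (toC (shiftSeries α)) := by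
  rw [toC_shiftSeries]
  exact (convOnDisc_C _).add ((convOnDisc_C _).mul convOnDisc_X)

theorem convOnDisc_bdfSeries : ConvOnDisc (toC bdfSeries) := by
  rw [toC_bdfSeries]
  exact ((convOnDisc_C _).add ((convOnDisc_C _).mul convOnDisc_X)).add
    ((convOnDisc_C _).mul (convOnDisc_X.mul convOnDisc_X))

theorem convOnDisc_schemeSeries (α μ : ℝ) : ConvOnDisc (toC (schemeSeries α μ)) := by
  rw [toC_schemeSeries]
  exact (convOnDisc_glSeries α).add ((convOnDisc_C _).mul (convOnDisc_shiftSeries α))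

theorem psum_shiftSeries (α : ℝ) {ζ : ℂ} (hζ : ‖ζ‖ < 1) :
    psum (toC (shiftSeries α)) ζ = 1 - (α / 2 : ℝ) * (1 - ζ) := by
  rw [toC_shiftSeries, psum_add (convOnDisc_C _) ((convOnDisc_C _).mul convOnDisc_X) hζ,
    psum_mul (convOnDisc_C _) convOnDisc_X hζ]
  simp only [psum_C, psum_X]
  push_cast
  ring

theorem psum_bdfSeries {ζ : ℂ} (hζ : ‖ζ‖ < 1) :
    psum (toC bdfSeries) ζ = (1 - ζ) + (1 - ζ) ^ 2 / 2 := by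
  rw [toC_bdfSeries, psum_add ((convOnDisc_C _).add ((convOnDisc_C _).mul convOnDisc_X))
    ((convOnDisc_C _).mul (convOnDisc_X.mul convOnDisc_X)) hζ,
    psum_add (convOnDisc_C _) ((convOnDisc_C _).mul convOnDisc_X) hζ,
    psum_mul (convOnDisc_C _) convOnDisc_X hζ,
    psum_mul (convOnDisc_C _) (convOnDisc_X.mul convOnDisc_X) hζ,
    psum_mul convOnDisc_X convOnDisc_X hζ]
  simp only [psum_C, psum_X]
  push_cast
  ring

theorem psum_schemeSeries (α μ : ℝ) {ζ : ℂ} (hζ : ‖ζ‖ < 1) : psum (toC (schemeSeries α μ)) ζ =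
    (1 - ζ) ^ (α : ℂ) + μ * (1 - (α / 2 : ℝ) * (1 - ζ)) := by
  rw [toC_schemeSeries, psum_add (convOnDisc_glSeries α)
    ((convOnDisc_C _).mul (convOnDisc_shiftSeries α)) hζ,
    psum_mul (convOnDisc_C _) (convOnDisc_shiftSeries α) hζ, psum_C, psum_shiftSeries α hζ, psum,
    (hasSum_glSeries α hζ).tsum_eq]

/-- Both `(1 - ζ) ^ α` and the shift symbol have positive real part in the unit disc, and
`μ ≥ 0`. -/
theorem psum_schemeSeries_ne_zero {α μ : ℝ} (hα0 : 0 < α) (hα1 : α < 1) (hμ : 0 ≤ μ) {ζ : ℂ}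
    (hζ : ‖ζ‖ < 1) : psum (toC (schemeSeries α μ)) ζ ≠ 0 := by
  obtain ⟨ε, κ, hε0, -, hκ, h⟩ := exists_sector_cpow hα0 hα1
  rw [psum_schemeSeries α μ hζ]
  have h1 := Complex.abs_re_le_norm ζ
  have h2 := le_abs_self ζ.re
  have h3 := neg_abs_le ζ.re
  have hre : 0 < (1 - ζ).re := by simp only [Complex.sub_re, Complex.one_re]; linarith
  have hne : 1 - ζ ≠ 0 := fun h0 => by rw [h0] at hre; simp at hre
  have h4 := (h _ hne (by nlinarith [norm_nonneg (1 - ζ)])).2.2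
  have hn : 0 < κ * ‖1 - ζ‖ ^ α := mul_pos hκ (Real.rpow_pos_of_pos (norm_pos_iff.2 hne) _)
  intro h0
  have h5 := congrArg Complex.re h0
  rw [Complex.add_re, Complex.re_ofReal_mul, Complex.sub_re, Complex.re_ofReal_mul, Complex.one_re,
    Complex.zero_re, Complex.sub_re, Complex.one_re] at h5
  have h6 : 0 ≤ μ * (1 - α / 2 * (1 - ζ.re)) := mul_nonneg hμ (by nlinarith)
  linarith

theorem constantCoeff_schemeSeries (α μ : ℝ) :
    PowerSeries.constantCoeff (schemeSeries α μ) = 1 + μ * (1 - α / 2) := by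
  have h : PowerSeries.constantCoeff (glSeries α) = 1 := by
    rw [← PowerSeries.coeff_zero_eq_constantCoeff_apply, glSeries, PowerSeries.coeff_mk, glCoeff]
  simp [schemeSeries, shiftSeries, h]

theorem schemeSeries_mul_inv {α μ : ℝ} (hα1 : α < 1) (hμ : 0 ≤ μ) :
    schemeSeries α μ * (schemeSeries α μ)⁻¹ = 1 := by
  refine PowerSeries.mul_inv_cancel _ ?_
  rw [constantCoeff_schemeSeries]
  nlinarith

theorem convOnDisc_respSeries {α μ : ℝ} (hα0 : 0 < α) (hα1 : α < 1) (hμ : 0 ≤ μ) :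
    ConvOnDisc (toC (respSeries α μ)) ∧ ∀ z : ℂ, 0 < z.re →
      psum (toC (respSeries α μ)) (Complex.exp (-z)) = schemeResolvent α μ z * bdfSymbol z := by
  have h1 : toC (schemeSeries α μ) * toC (schemeSeries α μ)⁻¹ = 1 := by
    rw [← map_mul, schemeSeries_mul_inv hα1 hμ, map_one]
  obtain ⟨h2, h3⟩ := (convOnDisc_schemeSeries α μ).inv_of_ne_zero h1
    fun ζ hζ => psum_schemeSeries_ne_zero hα0 hα1 hμ hζ
  have h4 : toC (respSeries α μ) =
      toC bdfSeries * (toC (shiftSeries α) * toC (schemeSeries α μ)⁻¹) := by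
    simp [toC, respSeries]
  have h5 := (convOnDisc_shiftSeries α).mul h2
  rw [h4]
  refine ⟨convOnDisc_bdfSeries.mul h5, fun z hz => ?_⟩
  have hζ := norm_cexp_neg_lt_one hz
  rw [psum_mul convOnDisc_bdfSeries h5 hζ, psum_mul (convOnDisc_shiftSeries α) h2 hζ, h3 _ hζ,
    psum_bdfSeries hζ, psum_shiftSeries α hζ, psum_schemeSeries α μ hζ]
  unfold schemeResolvent bdfSymbol shiftSymbol schemeSymbol shiftSymbol bdiff
  ring

/-- The sequence `n`. -/
noncomputable def linSeries : PowerSeries ℝ := PowerSeries.mk fun n => (n : ℝ)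

/-- The sequence `(n - s)² / 2` for `n ≥ 1`, and `0` for `n = 0`. -/
noncomputable def quadSeries (s : ℝ) : PowerSeries ℝ :=
  PowerSeries.mk fun n => if n = 0 then 0 else ((n : ℝ) - s) ^ 2 / 2

theorem hasSum_linSeries {ζ : ℂ} (hζ : ‖ζ‖ < 1) :
    HasSum (fun n => PowerSeries.coeff n (toC linSeries) * ζ ^ n) (ζ / (1 - ζ) ^ 2) := by
  convert! hasSum_coe_mul_geometric_of_norm_lt_one hζ using 1
  ext n
  simp [linSeries]

theorem hasSum_quadSeries (s : ℝ) {ζ : ℂ} (hζ : ‖ζ‖ < 1) :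
    HasSum (fun n => PowerSeries.coeff n (toC (quadSeries s)) * ζ ^ n)
      (ζ * (1 + ζ) / (1 - ζ) ^ 3 / 2 - s * (ζ / (1 - ζ) ^ 2) + s ^ 2 / 2 * (ζ / (1 - ζ))) := by
  have hne : (1 - ζ) ≠ 0 := fun h => by
    rw [sub_eq_zero] at h; rw [← h] at hζ; simp at hζ
  have h0 := hasSum_geometric_of_norm_lt_one hζ
  have h1 := hasSum_coe_mul_geometric_of_norm_lt_one hζ
  have h2 := hasSum_choose_mul_geometric_of_norm_lt_one 2 hζ
  have h3 := hasSum_single (f := fun n : ℕ => if n = 0 then (s : ℂ) ^ 2 / 2 else 0) 0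
    (fun n hn => if_neg hn)
  have h4 := ((h2.sub (h1.mul_left (3 / 2 + (s : ℂ)))).add
    (h0.mul_left ((s : ℂ) ^ 2 / 2 - 1))).sub h3
  convert! h4 using 1
  · ext n
    rw [coeff_toC, quadSeries, PowerSeries.coeff_mk]
    have hch : (((n + 2).choose 2 : ℕ) : ℂ) = ((n : ℂ) + 2) * (n + 1) / 2 := by
      rw [Nat.cast_choose_two]; push_cast; ring
    rw [hch]
    rcases Nat.eq_zero_or_pos n with h | h
    · subst h; simp
    · rw [if_neg h.ne', if_neg h.ne']
      push_cast
      ring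
  · rw [if_pos rfl]
    field_simp
    ring

theorem psum_linSeries {z : ℂ} (hz : 0 < z.re) :
    bdfSymbol z * psum (toC linSeries) (Complex.exp (-z)) = linSymbol z := by
  rw [psum, (hasSum_linSeries (norm_cexp_neg_lt_one hz)).tsum_eq, linSymbol, bdiff, sub_sub_cancel]

theorem psum_quadSeries (s : ℝ) {z : ℂ} (hz : 0 < z.re) :
    bdfSymbol z * psum (toC (quadSeries s)) (Complex.exp (-z)) = quadSymbol s z := by
  rw [psum, (hasSum_quadSeries s (norm_cexp_neg_lt_one hz)).tsum_eq, quadSymbol, bdiff]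
  congr 1
  ring

/-! ### The generating function of a power -/

/-- The sequence `n ^ (2 - α) / Γ(3 - α)`. -/
noncomputable def powSeries (α : ℝ) : PowerSeries ℝ :=
  PowerSeries.mk fun n => (n : ℝ) ^ (2 - α) / Real.Gamma (3 - α)

/-- The difference between the generating function of `n ^ (2 - α) / Γ(3 - α)` and the Laplace
transform `z ^ (α - 3)` of `t ^ (2 - α) / Γ(3 - α)`. -/
noncomputable def powRemainder (α : ℝ) (z : ℂ) : ℂ :=
  ∑' k : ℤ, if k = 0 then 0 else
    (z + ((2 * Real.pi * k : ℝ) : ℂ) * Complex.I) ^ ((-(2 - α + 1) : ℝ) : ℂ)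

theorem convOnDisc_powSeries {α : ℝ} (hα0 : 0 < α) (hα1 : α < 1) :
    ConvOnDisc (toC (powSeries α)) := by
  intro ζ hζ
  have hG : 0 < Real.Gamma (3 - α) := Real.Gamma_pos_of_pos (by linarith)
  refine Summable.of_norm_bounded ((summable_pow_mul_geometric_of_norm_lt_one 2
    (r := ‖ζ‖) (by rwa [norm_norm])).mul_left (Real.Gamma (3 - α))⁻¹) fun n => ?_
  rw [coeff_toC, powSeries, PowerSeries.coeff_mk, norm_mul, norm_pow, Complex.norm_real,
    Real.norm_of_nonneg (by positivity), div_eq_inv_mul, mul_assoc]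
  gcongr
  rcases Nat.eq_zero_or_pos n with h | h
  · subst h; simp [Real.zero_rpow (by linarith : 2 - α ≠ 0)]
  · rw [← Real.rpow_natCast]
    exact Real.rpow_le_rpow_of_exponent_le (by exact_mod_cast h) (by push_cast; linarith)

/-- The singularities of `powRemainder` are the points `-2πik`, `k ≠ 0`; the disc of radius
`4.2 < 2π`, a neighbourhood of the disc of radius `4`, keeps away from them. -/
theorem norm_add_two_pi_mul_ge {z : ℂ} (hz : ‖z‖ < 4.2) {k : ℤ} (hk : k ≠ 0) :
    2 * |(k : ℝ)| ≤ |(z + ((2 * Real.pi * k : ℝ) : ℂ) * Complex.I).im| := by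
  have h1 : (1 : ℝ) ≤ |(k : ℝ)| := by exact_mod_cast Int.one_le_abs hk
  have h2 := Complex.abs_im_le_norm z
  have h3 := Real.pi_gt_d2
  have h4 : |2 * Real.pi * (k : ℝ)| = 2 * Real.pi * |(k : ℝ)| := by
    rw [abs_mul, abs_of_pos (by positivity)]
  have e : (z + ((2 * Real.pi * k : ℝ) : ℂ) * Complex.I).im = 2 * Real.pi * k - (-z.im) := by
    rw [Complex.add_im, Complex.im_ofReal_mul, Complex.I_im]; ring
  rw [e]
  have h5 := abs_sub_abs_le_abs_sub (2 * Real.pi * (k : ℝ)) (-z.im)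
  rw [abs_neg, h4] at h5
  nlinarith

theorem norm_powRemainder_term_le {α : ℝ} (hα1 : α < 1) {z : ℂ} (hz : ‖z‖ < 4.2) (k : ℤ) :
    ‖(if k = 0 then 0 else
      (z + ((2 * Real.pi * k : ℝ) : ℂ) * Complex.I) ^ ((-(2 - α + 1) : ℝ) : ℂ))‖
      ≤ |(k : ℝ)| ^ (-(2 - α + 1)) := by
  split_ifs with hk
  · rw [norm_zero]; positivity
  · have h := norm_add_two_pi_mul_ge hz hk
    have h1 : (1 : ℝ) ≤ |(k : ℝ)| := by exact_mod_cast Int.one_le_abs hk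
    rw [Complex.norm_cpow_real]
    refine Real.rpow_le_rpow_of_nonpos (by linarith) ?_ (by linarith)
    have := Complex.abs_im_le_norm (z + ((2 * Real.pi * k : ℝ) : ℂ) * Complex.I)
    linarith

theorem norm_powRemainder_le {α : ℝ} (hα1 : α < 1) :
    ∃ C : ℝ, 0 < C ∧ ∀ z : ℂ, ‖z‖ ≤ 4 → ‖powRemainder α z‖ ≤ C := by
  have hs := Real.summable_abs_int_rpow (by linarith : 1 < 2 - α + 1)
  refine ⟨(∑' k : ℤ, |(k : ℝ)| ^ (-(2 - α + 1))) + 1, ?_, fun z hz => ?_⟩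
  · have : 0 ≤ ∑' k : ℤ, |(k : ℝ)| ^ (-(2 - α + 1)) := tsum_nonneg fun k => by positivity
    linarith
  · have := tsum_of_norm_bounded hs.hasSum
      (norm_powRemainder_term_le hα1 (z := z) (lt_of_le_of_lt hz (by norm_num)))
    unfold powRemainder
    linarith

theorem differentiableAt_powRemainder {α : ℝ} (hα1 : α < 1) {z : ℂ} (hz : ‖z‖ ≤ 4) :
    DifferentiableAt ℂ (powRemainder α) z := by
  have hs := Real.summable_abs_int_rpow (by linarith : 1 < 2 - α + 1)
  have := Complex.differentiableOn_tsum_of_summable_norm (U := Metric.ball (0 : ℂ) 4.2) hs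
    (F := fun (k : ℤ) (z : ℂ) => if k = 0 then 0 else
    (z + ((2 * Real.pi * k : ℝ) : ℂ) * Complex.I) ^ ((-(2 - α + 1) : ℝ) : ℂ)) (fun k => ?_)
    Metric.isOpen_ball (fun k w hw => norm_powRemainder_term_le hα1 (by simpa using hw) k)
  · exact this.differentiableAt (Metric.isOpen_ball.mem_nhds (by
      simpa using lt_of_le_of_lt hz (by norm_num)))
  · intro w hw
    by_cases hk : k = 0
    · simp only [hk, if_true]; exact differentiableWithinAt_const _
    · simp only [if_neg hk]
      have h := norm_add_two_pi_mul_ge (z := w) (by simpa using hw) hk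
      have h1 : (1 : ℝ) ≤ |(k : ℝ)| := by exact_mod_cast Int.one_le_abs hk
      refine (DifferentiableAt.cpow_const (by fun_prop) (Or.inr ?_)).differentiableWithinAt
      exact abs_pos.1 (by linarith)

/-- The decay that Poisson summation requires. -/
theorem norm_rpow_mul_exp_le {s t c : ℝ} (hs : 0 ≤ s) (ht : 0 < t) (hc : 0 < c) :
    t ^ s * Real.exp (-c * t) ≤ Real.Gamma (s + 2 + 1) * c ^ (-(s + 2)) * t ^ (-2 : ℝ) := by
  have h := rpow_div_Gamma_le_scaled (s := s + 2) (by linarith) ht.le hc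
  have hG : 0 < Real.Gamma (s + 2 + 1) := Real.Gamma_pos_of_pos (by linarith)
  rw [div_le_iff₀ hG] at h
  have e1 : t ^ s = t ^ (s + 2) * t ^ (-2 : ℝ) := by rw [← Real.rpow_add ht]; congr 1; ring
  have e2 : Real.exp (c * t) * Real.exp (-c * t) = 1 := by rw [← Real.exp_add]; simp
  calc t ^ s * Real.exp (-c * t) = t ^ (s + 2) * (t ^ (-2 : ℝ) * Real.exp (-c * t)) := by
        rw [e1]; ring
    _ ≤ (c ^ (-(s + 2)) * Real.exp (c * t) * Real.Gamma (s + 2 + 1)) *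
        (t ^ (-2 : ℝ) * Real.exp (-c * t)) := by gcongr
    _ = Real.Gamma (s + 2 + 1) * c ^ (-(s + 2)) * t ^ (-2 : ℝ) *
        (Real.exp (c * t) * Real.exp (-c * t)) := by ring
    _ = _ := by rw [e2, mul_one]

/-- Poisson summation for `t_+ ^ (2 - α) * exp (-z t)`. -/
theorem psum_powSeries {α : ℝ} (hα0 : 0 < α) (hα1 : α < 1) {z : ℂ} (hz : 0 < z.re)
    (hz4 : ‖z‖ ≤ 4) :
    psum (toC (powSeries α)) (Complex.exp (-z)) =
      z ^ ((-(2 - α + 1) : ℝ) : ℂ) + powRemainder α z := by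
  set s : ℝ := 2 - α with hs
  set f : ℝ → ℂ := fun x => (Ioi (0 : ℝ)).indicator
    (fun x : ℝ => ((x ^ s : ℝ) : ℂ) * Complex.exp (-(z * x))) x with hf
  have hs1 : 1 < s := by linarith
  have hG : 0 < Real.Gamma (s + 1) := Real.Gamma_pos_of_pos (by linarith)
  have hsum := Real.summable_abs_int_rpow (by linarith : 1 < s + 1)
  have hfour : ∀ k : ℤ, FourierTransform.fourier f k = (Real.Gamma (s + 1) : ℂ) *
      (z + ((2 * Real.pi * k : ℝ) : ℂ) * Complex.I) ^ ((-(s + 1) : ℝ) : ℂ) :=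
    fun k => fourier_rpow_mul_cexp (by linarith) hz k
  -- the hypotheses of Poisson summation: summable Fourier transform, continuity and decay
  have hterm : Summable fun k : ℤ =>
      (z + ((2 * Real.pi * k : ℝ) : ℂ) * Complex.I) ^ ((-(s + 1) : ℝ) : ℂ) := by
    refine Summable.of_norm_bounded_eventually hsum ?_
    filter_upwards [(Set.finite_singleton (0 : ℤ)).compl_mem_cofinite] with k hk
    have := norm_powRemainder_term_le hα1 (z := z) (lt_of_le_of_lt hz4 (by norm_num)) k
    rwa [if_neg (show k ≠ 0 from hk)] at this
  have hcont : Continuous f := by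
    have : f = fun x : ℝ => ((max x 0 ^ s : ℝ) : ℂ) * Complex.exp (-(z * x)) := by
      ext x
      simp only [hf, indicator_apply]
      split_ifs with hx
      · rw [max_eq_left (le_of_lt hx)]
      · rw [max_eq_right (not_lt.1 hx), Real.zero_rpow (by linarith)]; simp
    rw [this]
    have h1 : Continuous fun x : ℝ => max x 0 ^ s :=
      (continuous_id.max continuous_const).rpow_const fun _ => Or.inr (by linarith)
    exact (Complex.continuous_ofReal.comp h1).mul (by fun_prop)
  have hdecay : f =O[cocompact ℝ] fun x : ℝ => |x| ^ (-2 : ℝ) := by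
    refine Asymptotics.IsBigO.of_bound (Real.Gamma (s + 2 + 1) * z.re ^ (-(s + 2)))
      (Eventually.of_forall fun x => ?_)
    have hG2 : 0 < Real.Gamma (s + 2 + 1) := Real.Gamma_pos_of_pos (by linarith)
    rw [Real.norm_of_nonneg (by positivity)]
    simp only [hf, indicator_apply]
    split_ifs with hx
    · rw [norm_rpow_mul_cexp s z hx, abs_of_pos hx]
      exact norm_rpow_mul_exp_le (by linarith) hx hz
    · rw [norm_zero]; positivity
  have hP := Real.tsum_eq_tsum_fourier_of_rpow_decay_of_summable hcont one_lt_two hdecay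
    (by simpa only [hfour] using hterm.mul_left _) 0
  simp only [zero_add, hfour] at hP
  -- the left-hand side has no terms with `n ≤ 0`, and the term `k = 0` on the right-hand side is
  -- the Laplace transform
  have hL : ∑' n : ℤ, f n =
      (Real.Gamma (s + 1) : ℂ) * psum (toC (powSeries α)) (Complex.exp (-z)) := by
    have h1 : ∑' n : ℕ, f ((n : ℤ) : ℝ) = ∑' n : ℤ, f n :=
      (Nat.cast_injective (R := ℤ)).tsum_eq (f := fun n : ℤ => f n) (by
        intro n hn
        rcases Int.eq_ofNat_of_zero_le (a := n) (by
          by_contra! h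
          apply hn
          have : ¬ (0 : ℝ) < n := by
            rw [not_lt]; exact_mod_cast h.le
          simp [hf, this]) with ⟨m, rfl⟩
        exact ⟨m, rfl⟩)
    rw [← h1, psum, ← tsum_mul_left]
    congr 1
    ext n
    rw [coeff_toC, powSeries, PowerSeries.coeff_mk, ← Complex.exp_nat_mul]
    have hG3 : Real.Gamma (3 - α) = Real.Gamma (s + 1) := by congr 1; rw [hs]; ring
    rw [hG3]
    have hGc : (Real.Gamma (s + 1) : ℂ) ≠ 0 := by exact_mod_cast hG.ne'
    rcases Nat.eq_zero_or_pos n with h | h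
    · subst h; simp [hf, Real.zero_rpow (by linarith : 2 - α ≠ 0)]
    · have hn : (0 : ℝ) < ((n : ℤ) : ℝ) := by exact_mod_cast h
      simp only [hf, indicator_of_mem (show ((n : ℤ) : ℝ) ∈ Ioi (0 : ℝ) from hn)]
      push_cast
      rw [← hs]
      field_simp
  have hfou : ∀ k : ℤ, (fourier k : C(AddCircle (1 : ℝ), ℂ)) ((0 : ℝ) : AddCircle (1 : ℝ)) = 1 := by
    intro k; simp
  rw [hL] at hP
  have hR : ∑' n : ℤ, (Real.Gamma (s + 1) : ℂ) *
      (z + ((2 * Real.pi * n : ℝ) : ℂ) * Complex.I) ^ ((-(s + 1) : ℝ) : ℂ) *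
      (fourier n : C(AddCircle (1 : ℝ), ℂ)) ((0 : ℝ) : AddCircle (1 : ℝ)) =
      (Real.Gamma (s + 1) : ℂ) * (z ^ ((-(s + 1) : ℝ) : ℂ) + powRemainder α z) := by
    simp only [hfou, mul_one]
    rw [tsum_mul_left, hterm.tsum_eq_add_tsum_ite 0]
    simp [powRemainder, hs]
  rw [hR] at hP
  exact mul_left_cancel₀ (by exact_mod_cast hG.ne') hP

/-- The transform of the discrete initial data, multiplied by the BDF symbol. -/
noncomputable def powSymbol (α : ℝ) (z : ℂ) : ℂ :=
  bdfSymbol z * (bdfSymbol z * (z ^ ((-(2 - α + 1) : ℝ) : ℂ) + powRemainder α z))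

/-- Second-order consistency of the initial data: two backward differences of
`t ^ (2 - α) / Γ(3 - α)` approximate its second derivative `t ^ (-α) / Γ(1 - α)`, which is the
Riemann-Liouville derivative of the constant `1` and has the Laplace transform `z ^ (α - 1)`. -/
theorem powSymbol_expansion {α : ℝ} (hα0 : 0 < α) (hα1 : α < 1) :
    ∃ C : ℝ, 0 < C ∧ ∀ z : ℂ, z ≠ 0 → ‖z‖ ≤ 4 →
    ‖powSymbol α z - z ^ ((α - 1 : ℝ) : ℂ)‖ ≤ C * ‖z‖ ^ (α - 1 + 2) := by
  obtain ⟨C₁, hC₁, h1⟩ := norm_bdfSymbol_sub_self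
  obtain ⟨C₂, hC₂, h2⟩ := norm_powRemainder_le hα1
  refine ⟨C₁ * (C₁ + 1) + C₁ ^ 2 * C₂ * 4, by positivity, fun z hz hz4 => ?_⟩
  have hn : 0 < ‖z‖ := norm_pos_iff.2 hz
  obtain ⟨h3, h4⟩ := h1 z hz4
  have h5 := h2 z hz4
  have e0 : z ^ ((α - 1 : ℝ) : ℂ) = z ^ 2 * z ^ ((-(2 - α + 1) : ℝ) : ℂ) := by
    rw [← Complex.cpow_natCast z 2, ← Complex.cpow_add _ _ hz]
    congr 1
    push_cast
    ring
  have e : powSymbol α z - z ^ ((α - 1 : ℝ) : ℂ) =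
      (bdfSymbol z - z) * (bdfSymbol z + z) * z ^ ((-(2 - α + 1) : ℝ) : ℂ)
        + bdfSymbol z ^ 2 * powRemainder α z := by
    rw [e0]; unfold powSymbol; ring
  rw [e]
  refine (norm_add_le _ _).trans ?_
  rw [norm_mul, norm_mul, norm_mul, norm_pow, Complex.norm_cpow_real]
  have h6 : ‖bdfSymbol z + z‖ ≤ (C₁ + 1) * ‖z‖ := (norm_add_le _ _).trans (by linarith)
  have e1 : ‖z‖ ^ 3 * ‖z‖ * ‖z‖ ^ (-(2 - α + 1)) = ‖z‖ ^ (α - 1 + 2) := by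
    rw [← pow_succ, ← Real.rpow_natCast, ← Real.rpow_add hn]
    congr 1
    push_cast
    ring
  have e2 : ‖z‖ ^ 2 ≤ 4 * ‖z‖ ^ (α - 1 + 2) := by
    have : ‖z‖ ^ 2 = ‖z‖ ^ (1 - α) * ‖z‖ ^ (α - 1 + 2) := by
      rw [← Real.rpow_add hn, ← Real.rpow_natCast]
      congr 1
      push_cast
      ring
    rw [this]
    gcongr
    calc ‖z‖ ^ (1 - α) ≤ 4 ^ (1 - α) := Real.rpow_le_rpow hn.le hz4 (by linarith)
      _ ≤ 4 ^ (1 : ℝ) := Real.rpow_le_rpow_of_exponent_le (by norm_num) (by linarith)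
      _ = 4 := Real.rpow_one 4
  calc _ ≤ C₁ * ‖z‖ ^ 3 * ((C₁ + 1) * ‖z‖) * ‖z‖ ^ (-(2 - α + 1)) + (C₁ * ‖z‖) ^ 2 * C₂ := by gcongr
    _ = C₁ * (C₁ + 1) * (‖z‖ ^ 3 * ‖z‖ * ‖z‖ ^ (-(2 - α + 1))) + C₁ ^ 2 * C₂ * ‖z‖ ^ 2 := by ring
    _ ≤ C₁ * (C₁ + 1) * ‖z‖ ^ (α - 1 + 2) + C₁ ^ 2 * C₂ * (4 * ‖z‖ ^ (α - 1 + 2)) := by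
        rw [e1]; gcongr
    _ = _ := by ring

/-! ### Inverse Laplace representation of the exact responses -/

/-- The transforms of the exact responses are analytic in a sector larger than the right
half-plane, so that their derivatives obey Cauchy estimates that are uniform in `μ ≥ 0`. -/
theorem mlfLaplace_bounds {α : ℝ} (hα0 : 0 < α) (hα1 : α < 1) :
    ∃ D : ℝ → ℕ → ℝ, (∀ β k, 0 < D β k) ∧ ∀ (β μ : ℝ), 0 ≤ μ →
      DifferentiableOn ℂ (mlfLaplace α β μ) {z | 0 < z.re} ∧ ∀ (k : ℕ) (z : ℂ), 0 < z.re →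
        ‖iteratedDeriv k (mlfLaplace α β μ) z‖ ≤ D β k * ‖z‖ ^ (-(β + 1) - k) := by
  obtain ⟨δ, C, hδ0, hδ5, hC, h, -⟩ := exists_sector hα0 hα1
  refine ⟨fun β k => k.factorial * (C * 2 ^ |-(β + 1)|) / (δ / 2) ^ k,
    fun β k => by positivity, fun β μ hμ => ⟨fun z (hz : 0 < z.re) => ?_, fun k z hz => ?_⟩⟩
  · have hz0 : z ≠ 0 := fun h0 => by rw [h0] at hz; simp at hz
    obtain ⟨h1, h2⟩ := h z hz0 (by nlinarith [norm_nonneg z])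
    exact (mlfLaplace_differentiableAt h1 (h2 μ hμ).1).differentiableWithinAt
  · have hz0 : z ≠ 0 := fun h0 => by rw [h0] at hz; simp at hz
    refine norm_iteratedDeriv_le_rpow k hz0 (by positivity) (by linarith)
      (closedBall_subset_sector hδ0 hδ5 hz) (fun w hw => ?_) hC.le (fun w hw => ?_)
    · obtain ⟨h1, h2⟩ := h w hw.1 hw.2
      exact mlfLaplace_differentiableAt h1 (h2 μ hμ).1
    · exact norm_mlfLaplace_le ((h w hw.1 hw.2).2 μ hμ).2

/-- The contour is shifted from far to the right, where the series converges, to any line in the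
right half-plane; this uses `μ ≥ 0`. -/
theorem mlf_inversion {α β μ t c : ℝ} (hα0 : 0 < α) (hα1 : α < 1) (hβ : 0 < β) (hμ : 0 ≤ μ)
    (ht : 0 < t) (hc : 0 < c) :
    ∫ θ : ℝ, Complex.exp (t * vline c θ) * mlfLaplace α β μ (vline c θ)
      = ((2 * Real.pi * mlf α β μ t : ℝ) : ℂ) := by
  obtain ⟨D, -, h⟩ := mlfLaplace_bounds hα0 hα1
  obtain ⟨h1, h2⟩ := h β μ hμ
  obtain ⟨c₀, hc₀, hr⟩ := exists_geometric_rate hα0 μ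
  rw [← mlf_inversion_far hα0 hβ ht (lt_max_of_lt_left hc₀ : 0 < max c₀ c) (hr _ (le_max_left _ _))]
  exact contour_shift h1 (by linarith : 1 < β + 1) (fun z hz => by simpa using h2 0 z hz) t hc
    (le_max_right _ _)

theorem integrable_iteratedDeriv_mlfLaplace {α β μ c : ℝ} (hα0 : 0 < α) (hα1 : α < 1) (hμ : 0 ≤ μ)
    (hc : 0 < c) (j : ℕ) (hj : 0 < β + j) :
    Integrable fun θ => iteratedDeriv j (mlfLaplace α β μ) (vline c θ) := by
  obtain ⟨D, -, h⟩ := mlfLaplace_bounds hα0 hα1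
  obtain ⟨h1, h2⟩ := h β μ hμ
  refine integrable_comp_vline (C := D β j) (p := β + 1 + j)
    (differentiableOn_iteratedDeriv isOpen_re_pos h1 j) (by linarith) hc fun θ => ?_
  convert! h2 j (vline c θ) (by simpa using hc) using 3
  ring

theorem mlf_inversion_iteratedDeriv {α β μ t c : ℝ} (hα0 : 0 < α) (hα1 : α < 1) (hβ : 0 < β)
    (hμ : 0 ≤ μ) (ht : 0 < t) (hc : 0 < c) (k : ℕ) :
    (t : ℂ) ^ k * ((2 * Real.pi * mlf α β μ t : ℝ) : ℂ) =
      (-1) ^ k * ∫ θ : ℝ, Complex.exp (t * vline c θ) *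
        iteratedDeriv k (mlfLaplace α β μ) (vline c θ) := by
  obtain ⟨D, -, h⟩ := mlfLaplace_bounds hα0 hα1
  rw [← mlf_inversion hα0 hα1 hβ hμ ht hc]
  exact vline_integral_by_parts_iterate (h β μ hμ).1 hc k fun j _ =>
    integrable_iteratedDeriv_mlfLaplace hα0 hα1 hμ hc j (by positivity)

/-- The representation of `E_α(-μ t ^ α) = 1 - μ t ^ α E_{α, α + 1}(-μ t ^ α)`. Its transform
`z ^ (α - 1) / (z ^ α + μ)` is not integrable on vertical lines, but its derivatives are. -/
theorem one_sub_mlf_inversion {α μ t c : ℝ} (hα0 : 0 < α) (hα1 : α < 1)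
    (hμ : 0 ≤ μ) (ht : 0 < t) (hc : 0 < c) (k : ℕ) :
    (t : ℂ) ^ (k + 1) * ((2 * Real.pi * (1 - μ * mlf α α μ t) : ℝ) : ℂ) =
      (-1) ^ (k + 1) * ∫ θ : ℝ, Complex.exp (t * vline c θ) *
        iteratedDeriv (k + 1) (mlfLaplace α 0 μ) (vline c θ) := by
  obtain ⟨D, -, h⟩ := mlfLaplace_bounds hα0 hα1
  obtain ⟨h1, -⟩ := h α μ hμ
  obtain ⟨h0, -⟩ := h 0 μ hμ
  have hsec := exists_sector hα0 hα1
  obtain ⟨δ, C, hδ0, -, -, hs, -⟩ := hsec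
  have hne : ∀ z : ℂ, 0 < z.re → z ≠ 0 := fun z hz h0 => by rw [h0] at hz; simp at hz
  have hL : ∀ z : ℂ, 0 < z.re → mlfLaplace α 0 μ z = z⁻¹ - μ * mlfLaplace α α μ z := by
    intro z hz
    have h2 := ((hs z (hne z hz) (by nlinarith [norm_nonneg z])).2 μ hμ).1
    have h3 : z ^ (α : ℂ) ≠ 0 := by simp [Complex.cpow_eq_zero_iff, hne z hz]
    unfold mlfLaplace
    have e1 : z ^ ((-(0 + 1) : ℝ) : ℂ) = z⁻¹ := by
      rw [← Complex.cpow_neg_one]; congr 1; push_cast; ring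
    have e2 : z ^ ((-(α + 1) : ℝ) : ℂ) = z⁻¹ * (z ^ (α : ℂ))⁻¹ := by
      rw [← Complex.cpow_neg_one, ← Complex.cpow_neg, ← Complex.cpow_add _ _ (hne z hz)]
      congr 1; push_cast; ring
    have hz0 := hne z hz
    rw [e1, e2]
    field_simp
    ring
  have hderiv : ∀ z : ℂ, 0 < z.re →
      deriv (mlfLaplace α 0 μ) z =
        -(z ^ ((-(1 + 1) : ℝ) : ℂ)) - μ * deriv (mlfLaplace α α μ) z := by
    intro z hz
    have : mlfLaplace α 0 μ =ᶠ[𝓝 z] fun z => z⁻¹ - μ * mlfLaplace α α μ z := by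
      filter_upwards [isOpen_re_pos.mem_nhds hz] with w hw using hL w hw
    rw [this.deriv_eq]
    have hd := (h1.differentiableAt (isOpen_re_pos.mem_nhds hz)).hasDerivAt
    have := ((hasDerivAt_inv (hne z hz)).sub (hd.const_mul (μ : ℂ))).deriv
    refine this.trans ?_
    congr 2
    rw [← Complex.cpow_natCast z 2, ← Complex.cpow_neg]
    congr 1; push_cast; ring
  have hint1 : Integrable fun θ => deriv (mlfLaplace α α μ) (vline c θ) := by
    simpa using integrable_iteratedDeriv_mlfLaplace (β := α) hα0 hα1 hμ hc 1 (by positivity)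
  have hintp : Integrable fun θ => vline c θ ^ ((-(1 + 1) : ℝ) : ℂ) := by
    refine (integrable_norm_vline hc (by norm_num : (1 : ℝ) < 1 + 1)).mono'
        (continuous_vline_cpow hc _).aestronglyMeasurable (Eventually.of_forall fun θ => ?_)
    rw [Complex.norm_cpow_real]
  have hbase : (t : ℂ) * ((2 * Real.pi * (1 - μ * mlf α α μ t) : ℝ) : ℂ) =
      -∫ θ : ℝ, Complex.exp (t * vline c θ) * deriv (mlfLaplace α 0 μ) (vline c θ) := by
    have e1 := rpow_inversion (s := 1) one_pos ht hc
    have e2 := mlf_inversion_iteratedDeriv (β := α) hα0 hα1 hα0 hμ ht hc 1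
    simp only [pow_one, iteratedDeriv_one, neg_one_mul] at e2
    have e3 : ∫ θ : ℝ, Complex.exp (t * vline c θ) * deriv (mlfLaplace α 0 μ) (vline c θ) =
        -(∫ θ : ℝ, Complex.exp (t * vline c θ) * vline c θ ^ ((-(1 + 1) : ℝ) : ℂ))
        - μ * ∫ θ : ℝ, Complex.exp (t * vline c θ) * deriv (mlfLaplace α α μ) (vline c θ) := by
      rw [← integral_neg, ← integral_const_mul, ← integral_sub
        (integrable_cexp_mul hintp).fun_neg ((integrable_cexp_mul hint1).const_mul _)]
      congr 1
      ext θ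
      rw [hderiv _ (by simpa using hc)]
      ring
    rw [e3, e1]
    have e4 : ∫ θ : ℝ, Complex.exp (t * vline c θ) * deriv (mlfLaplace α α μ) (vline c θ) =
        -((t : ℂ) * ((2 * Real.pi * mlf α α μ t : ℝ) : ℂ)) := by rw [e2, neg_neg]
    rw [e4]
    have hG : Real.Gamma (1 + 1) = 1 := by norm_num
    rw [hG, Real.rpow_one]
    push_cast
    ring
  have hparts := vline_integral_by_parts_iterate (F := deriv (mlfLaplace α 0 μ))
    (h0.deriv isOpen_re_pos) (t := t) hc k fun j _ => by
      rw [← iteratedDeriv_succ']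
      exact integrable_iteratedDeriv_mlfLaplace hα0 hα1 hμ hc (j + 1) (by push_cast; positivity)
  rw [pow_succ, mul_assoc, hbase, mul_neg, hparts, iteratedDeriv_succ', pow_succ]
  ring

/-! ### Comparison of a function with a sequence through their transforms -/

theorem iteratedDeriv_sub_of_differentiableOn {F G : ℂ → ℂ}
    (hF : DifferentiableOn ℂ F {z | 0 < z.re}) (hG : DifferentiableOn ℂ G {z | 0 < z.re}) (k : ℕ)
    {z : ℂ} (hz : 0 < z.re) :
    iteratedDeriv k (fun z => F z - G z) z = iteratedDeriv k F z - iteratedDeriv k G z :=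
  iteratedDeriv_fun_sub (hF.analyticAt (isOpen_re_pos.mem_nhds hz)).contDiffAt
    (hG.analyticAt (isOpen_re_pos.mem_nhds hz)).contDiffAt

/-- If the `k`-th derivative of the generating function of a sequence `a` agrees with that of the
Laplace transform of a function `y` up to `O(|z| ^ (m - k))`, with `k > m + 1`, then
`y(n) - a n = O(n ^ (-m - 1))`. Both are represented as integrals over the line `Re z = 1 / n`, on
which the factor `exp (n z)` is bounded; differentiating `k` times produces the factor `n ^ (-k)`
and makes the part of the line with `|Im z| > π` harmless. -/
theorem norm_sub_coeff_le {m p C₁ C₂ : ℝ} {k n : ℕ} (hk : m + 1 < k) (hp : 1 < p) (hC₁ : 0 ≤ C₁)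
    (hC₂ : 0 ≤ C₂) (hn : 1 ≤ n) {f : PowerSeries ℂ} (hf : ConvOnDisc f) {L : ℂ → ℂ} {y : ℂ}
    (hLi : Integrable fun θ => iteratedDeriv k L (vline (1 / n) θ))
    (hy : (n : ℂ) ^ k * ((2 * Real.pi : ℝ) * y) =
      (-1) ^ k * ∫ θ : ℝ, Complex.exp (((n : ℝ) : ℂ) * vline (1 / n) θ) *
        iteratedDeriv k L (vline (1 / n) θ))
    (hnear : ∀ θ : ℝ, |θ| ≤ Real.pi →
      ‖iteratedDeriv k (fun z => psum f (Complex.exp (-z))) (vline (1 / n) θ) -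
        iteratedDeriv k L (vline (1 / n) θ)‖ ≤ C₁ * ‖vline (1 / n) θ‖ ^ (m - k))
    (htail : ∀ θ : ℝ, Real.pi ≤ |θ| →
      ‖iteratedDeriv k L (vline (1 / n) θ)‖ ≤ C₂ * ‖vline (1 / n) θ‖ ^ (-p)) :
    ‖y - PowerSeries.coeff n f‖ ≤ Real.exp 1 / (2 * Real.pi) *
      (C₁ * (∫ θ, ‖vline 1 θ‖ ^ (-(k - m))) + C₂ * 2 ^ p * ∫ θ, ‖vline 1 θ‖ ^ (-p)) *
        (n : ℝ) ^ (-m - 1) := by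
  have hn0 : (0 : ℝ) < n := by exact_mod_cast hn
  have hn1 : (1 : ℝ) ≤ n := by exact_mod_cast hn
  set c : ℝ := 1 / n with hc
  have hc0 : 0 < c := by positivity
  have hpi := Real.pi_pos
  set G : ℂ → ℂ := fun z => psum f (Complex.exp (-z)) with hG
  have hcoef := coeff_eq_integral_iteratedDeriv hf hc0 n k
  rw [intervalIntegral.integral_of_le (by linarith),
    ← integral_indicator measurableSet_Ioc] at hcoef
  have hGc : Continuous fun θ => iteratedDeriv k G (vline c θ) :=
    continuous_comp_vline (differentiableOn_iteratedDeriv isOpen_re_pos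
      (differentiableOn_psum_exp hf) k) hc0
  have hcv := continuous_vline c
  have hGi : Integrable ((Ioc (-Real.pi) Real.pi).indicator fun θ : ℝ =>
      Complex.exp (((n : ℝ) : ℂ) * vline c θ) * iteratedDeriv k G (vline c θ)) := by
    rw [integrable_indicator_iff measurableSet_Ioc]
    exact ((by fun_prop : Continuous fun θ : ℝ => Complex.exp (((n : ℝ) : ℂ) * vline c θ) *
      iteratedDeriv k G (vline c θ)).integrableOn_Icc).mono_set Ioc_subset_Icc_self
  have hdiff : ((2 * Real.pi : ℝ) : ℂ) * ((-(n : ℂ)) ^ k * (y - PowerSeries.coeff n f)) =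
      ∫ θ : ℝ, (Complex.exp (((n : ℝ) : ℂ) * vline c θ) * iteratedDeriv k L (vline c θ) -
        (Ioc (-Real.pi) Real.pi).indicator (fun θ : ℝ =>
          Complex.exp (((n : ℝ) : ℂ) * vline c θ) * iteratedDeriv k G (vline c θ)) θ) := by
    rw [integral_sub (integrable_cexp_mul hLi) hGi, hcoef]
    have h1 : ((-1 : ℂ) ^ k) * (-1) ^ k = 1 := by rw [← mul_pow]; simp
    have h2 : ∫ θ : ℝ, Complex.exp (((n : ℝ) : ℂ) * vline c θ) * iteratedDeriv k L (vline c θ) =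
        (-1) ^ k * ((n : ℂ) ^ k * ((2 * Real.pi : ℝ) * y)) := by
      rw [hy, ← mul_assoc, h1, one_mul]
    rw [h2, neg_pow (n : ℂ)]
    ring
  -- the transforms are close to each other for `|θ| ≤ π`; for `|θ| > π` the exact one is small, as
  -- `|vline 1 θ| ≤ 2 |vline c θ|` there
  have hpt : ∀ θ : ℝ, ‖Complex.exp (((n : ℝ) : ℂ) * vline c θ) * iteratedDeriv k L (vline c θ) -
        (Ioc (-Real.pi) Real.pi).indicator (fun θ : ℝ =>
          Complex.exp (((n : ℝ) : ℂ) * vline c θ) * iteratedDeriv k G (vline c θ)) θ‖ ≤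
      Real.exp 1 * (C₁ * ‖vline c θ‖ ^ (-(k - m)) + C₂ * 2 ^ p * ‖vline 1 θ‖ ^ (-p)) := by
    intro θ
    have hexp : ‖Complex.exp (((n : ℝ) : ℂ) * vline c θ)‖ = Real.exp 1 := by
      rw [norm_cexp_vline, hc]; congr 1; field_simp
    by_cases hθ : θ ∈ Ioc (-Real.pi) Real.pi
    · rw [indicator_of_mem hθ, ← mul_sub, norm_mul, hexp, norm_sub_rev]
      have h1 := hnear θ (abs_le.2 ⟨hθ.1.le, hθ.2⟩)
      rw [neg_sub]
      have h2 : 0 ≤ C₂ * 2 ^ p * ‖vline 1 θ‖ ^ (-p) := by positivity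
      gcongr
      linarith
    · rw [indicator_of_notMem hθ, sub_zero, norm_mul, hexp]
      have hθ' : Real.pi ≤ |θ| := by
        rw [mem_Ioc, not_and_or, not_lt, not_le] at hθ
        rcases hθ with h | h
        · rw [abs_of_nonpos (by linarith)]; linarith
        · exact h.le.trans (le_abs_self _)
      have h1 := htail θ hθ'
      have h2 : 0 ≤ C₁ * ‖vline c θ‖ ^ (-(k - m)) := by positivity
      have h3 : ‖vline c θ‖ ^ (-p) ≤ 2 ^ p * ‖vline 1 θ‖ ^ (-p) := by
        have h4 : ‖vline 1 θ‖ ≤ 2 * ‖vline c θ‖ := by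
          have h5 : ‖vline 1 θ‖ ≤ 1 + |θ| := by
            simpa [vline] using norm_add_le (1 : ℂ) (θ * Complex.I)
          have h6 := Complex.abs_im_le_norm (vline c θ)
          rw [vline_im] at h6
          have := Real.pi_gt_three
          linarith
        have h7 : ‖vline c θ‖ ^ (-p) = 2 ^ p * (2 * ‖vline c θ‖) ^ (-p) := by
          rw [Real.mul_rpow (by norm_num) (norm_nonneg _), ← mul_assoc,
            ← Real.rpow_add (by norm_num)]
          simp
        rw [h7]
        exact mul_le_mul_of_nonneg_left (Real.rpow_le_rpow_of_nonpos (norm_vline_pos one_pos θ) h4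
          (by linarith)) (by positivity)
      have h8 : C₂ * ‖vline c θ‖ ^ (-p) ≤ C₂ * 2 ^ p * ‖vline 1 θ‖ ^ (-p) := by
        rw [mul_assoc]; gcongr
      gcongr
      linarith
  have hI1 := integrable_norm_vline hc0 (by linarith : 1 < (k : ℝ) - m)
  have hI2 := integrable_norm_vline one_pos hp
  have hle := norm_integral_le_of_norm_le (((hI1.const_mul C₁).add
    (hI2.const_mul (C₂ * 2 ^ p))).const_mul (Real.exp 1)) (Eventually.of_forall hpt)
  rw [← hdiff, integral_const_mul, integral_add' (hI1.const_mul C₁) (hI2.const_mul (C₂ * 2 ^ p)),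
    integral_const_mul, integral_const_mul, integral_norm_vline hc0, norm_mul, norm_mul, norm_pow,
    norm_neg, Complex.norm_real, Real.norm_of_nonneg (by positivity), Complex.norm_natCast] at hle
  set K₁ := ∫ θ, ‖vline 1 θ‖ ^ (-((k : ℝ) - m))
  set K₂ := ∫ θ, ‖vline 1 θ‖ ^ (-p)
  have hK₁ : 0 ≤ K₁ := integral_nonneg fun θ => by positivity
  have hK₂ : 0 ≤ K₂ := integral_nonneg fun θ => by positivity
  have hcp : c ^ (1 - ((k : ℝ) - m)) = (n : ℝ) ^ (k : ℕ) * (n : ℝ) ^ (-m - 1) := by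
    rw [hc, one_div, Real.inv_rpow hn0.le, ← Real.rpow_neg hn0.le, ← Real.rpow_natCast,
      ← Real.rpow_add hn0]
    congr 1; ring
  -- the part with `|θ| > π` carries no power of `n` and is absorbed, as `k - m - 1 > 0`
  have h1n : 1 ≤ (n : ℝ) ^ (k : ℕ) * (n : ℝ) ^ (-m - 1) := by
    rw [← Real.rpow_natCast, ← Real.rpow_add hn0]
    exact Real.one_le_rpow hn1 (by linarith)
  rw [hcp] at hle
  have hnk : 0 < (n : ℝ) ^ k := by positivity
  have h9 : (n : ℝ) ^ k * (2 * Real.pi * ‖y - PowerSeries.coeff n f‖) ≤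
      (n : ℝ) ^ k * (Real.exp 1 * (C₁ * K₁ + C₂ * 2 ^ p * K₂) * (n : ℝ) ^ (-m - 1)) := by
    calc _ = 2 * Real.pi * ((n : ℝ) ^ k * ‖y - PowerSeries.coeff n f‖) := by ring
      _ ≤ _ := hle
      _ ≤ Real.exp 1 * (C₁ * ((n : ℝ) ^ k * (n : ℝ) ^ (-m - 1) * K₁) +
          C₂ * 2 ^ p * (((n : ℝ) ^ k * (n : ℝ) ^ (-m - 1)) * K₂)) := by
        gcongr
        exact le_mul_of_one_le_left hK₂ h1n
      _ = _ := by ring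
  have h10 := le_of_mul_le_mul_left h9 hnk
  rw [div_mul_eq_mul_div, div_mul_eq_mul_div, le_div_iff₀ (by positivity)]
  linarith

/-! ### Error of the discrete responses, uniformly in the eigenvalue -/

theorem bdiff_ne_zero_of_mem_slitPlane {z : ℂ} (h : bdiff z ∈ Complex.slitPlane) : bdiff z ≠ 0 :=
  Complex.slitPlane_ne_zero h

/-- If the discrete data `E` approximate the exact data `e = O(z ^ r)` with an error
`O(z ^ (r + 2))`, then the transforms of the discrete and of the exact response to these data, and
by Cauchy's estimates all their derivatives, are close to each other near the origin. -/
theorem norm_iteratedDeriv_response_sub_le {α : ℝ} (hα0 : 0 < α) (hα1 : α < 1) (r : ℝ) (k : ℕ)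
    {C' : ℝ} (hC' : 0 ≤ C') :
    ∃ C₁ : ℝ, 0 ≤ C₁ ∧ ∀ (μ : ℝ), 0 ≤ μ → ∀ (E e L : ℂ → ℂ) (f : PowerSeries ℂ),
      (∀ z ∈ Complex.slitPlane, ‖z‖ ≤ 4 → bdiff z ≠ 0 →
        DifferentiableAt ℂ E z ∧ DifferentiableAt ℂ e z ∧
        ‖E z - e z‖ ≤ C' * ‖z‖ ^ (r + 2) ∧ ‖e z‖ ≤ C' * ‖z‖ ^ r) →
      DifferentiableOn ℂ L {z | 0 < z.re} →
      (∀ z : ℂ, 0 < z.re →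
        L z = z ^ ((-α : ℝ) : ℂ) * (z ^ (α : ℂ) / (z ^ (α : ℂ) + μ)) * e z) →
      ConvOnDisc f →
      (∀ z : ℂ, 0 < z.re → ‖z‖ ≤ 4 →
        psum f (Complex.exp (-z)) = schemeResolvent α μ z * E z) →
      ∀ c θ : ℝ, 0 < c → c ≤ 1 → |θ| ≤ Real.pi →
        ‖iteratedDeriv k (fun z => psum f (Complex.exp (-z))) (vline c θ) -
          iteratedDeriv k L (vline c θ)‖ ≤ C₁ * ‖vline c θ‖ ^ (r + 2 - α - k) := by
  obtain ⟨δ, C, hδ0, hδ5, hC, hsec, hnear⟩ := exists_sector hα0 hα1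
  refine ⟨k.factorial * (2 * C * C' * 2 ^ |r + 2 - α|) / (δ / 2) ^ k, by positivity,
    fun μ hμ E e L f hEe hLd hL hf hfE c θ hc hc1 hθ => ?_⟩
  have hz0 : 0 < (vline c θ).re := by simpa using hc
  have hsub := closedBall_subset_nearSector hδ0 hδ5 hc hc1 hθ
  have hnhds : Metric.closedBall (vline c θ) (δ / 2 * ‖vline c θ‖) ∈ 𝓝 (vline c θ) :=
    Metric.closedBall_mem_nhds _ (mul_pos (by positivity) (norm_vline_pos hc θ))
  rw [← iteratedDeriv_sub_of_differentiableOn (differentiableOn_psum_exp hf) hLd k hz0]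
  have heq : (fun z => psum f (Complex.exp (-z)) - L z) =ᶠ[𝓝 (vline c θ)] fun z =>
      schemeResolvent α μ z * E z -
        z ^ ((-α : ℝ) : ℂ) * (z ^ (α : ℂ) / (z ^ (α : ℂ) + μ)) * e z := by
    filter_upwards [hnhds, isOpen_re_pos.mem_nhds hz0] with z hz hz'
    rw [hfE z hz' (hsub hz).2.1, hL z hz']
  rw [heq.iteratedDeriv_eq k]
  refine norm_iteratedDeriv_le_rpow k (vline_ne_zero hc θ) (by positivity) (by linarith) hsub
    (fun z hz => ?_) (by positivity) fun z hz => ?_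
  · obtain ⟨h1, h2⟩ := hsec z hz.1 hz.2.2
    obtain ⟨h3, h4⟩ := hnear z hz
    obtain ⟨h5, h6, -⟩ := hEe z h1 hz.2.1 (bdiff_ne_zero_of_mem_slitPlane h3)
    have h7 : ∀ s : ℂ, DifferentiableAt ℂ (fun z : ℂ => z ^ s) z := fun s =>
      differentiableAt_id.cpow_const h1
    exact ((schemeResolvent_differentiableAt h3 (h4 μ hμ).1).mul h5).sub
      (((h7 _).mul ((h7 _).div ((h7 _).add_const _) (h2 μ hμ).1)).mul h6)
  · obtain ⟨h1, -⟩ := hsec z hz.1 hz.2.2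
    obtain ⟨h3, h4⟩ := hnear z hz
    obtain ⟨-, -, h5, h6⟩ := hEe z h1 hz.2.1 (bdiff_ne_zero_of_mem_slitPlane h3)
    exact norm_response_sub_le hz.1 hC.le (h4 μ hμ).2.1 (h4 μ hμ).2.2 h5 h6

theorem norm_ofReal_sub_coeff (y : ℝ) (f : PowerSeries ℝ) (n : ℕ) :
    ‖(y : ℂ) - PowerSeries.coeff n (toC f)‖ = |y - PowerSeries.coeff n f| := by
  rw [coeff_toC, ← Complex.ofReal_sub, Complex.norm_real, Real.norm_eq_abs]

theorem cpow_ofReal_mul_eq {α β γ : ℝ} {z : ℂ} (hz : z ≠ 0) (h : -α + γ = β) :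
    z ^ ((-α : ℝ) : ℂ) * z ^ ((γ : ℝ) : ℂ) = z ^ (β : ℂ) := by
  rw [← Complex.cpow_add _ _ hz, ← Complex.ofReal_add, h]

/-- The error of the discrete response to initial data. -/
theorem abs_sub_coeff_powSeries_le {α : ℝ} (hα0 : 0 < α) (hα1 : α < 1) :
    ∃ C : ℝ, 0 < C ∧ ∀ μ : ℝ, 0 ≤ μ → ∀ n : ℕ, 1 ≤ n →
      |(1 - μ * mlf α α μ n) -
        PowerSeries.coeff n (respSeries α μ * (bdfSeries * powSeries α))| ≤
        C * (n : ℝ) ^ (-2 : ℝ) := by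
  obtain ⟨C₀, hC₀, hpow⟩ := powSymbol_expansion hα0 hα1
  obtain ⟨C₁, hC₁, hresp⟩ := norm_iteratedDeriv_response_sub_le hα0 hα1 (α - 1) 3
    (by positivity : 0 ≤ C₀ + 1)
  obtain ⟨D, hD, hlap⟩ := mlfLaplace_bounds hα0 hα1
  set K := Real.exp 1 / (2 * Real.pi) *
      (C₁ * (∫ θ, ‖vline 1 θ‖ ^ (-(((3 : ℕ) : ℝ) - 1))) +
        D 0 3 * 2 ^ (4 : ℝ) * ∫ θ, ‖vline 1 θ‖ ^ (-4 : ℝ)) with hK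
  refine ⟨|K| + 1, by positivity, fun μ hμ n hn => ?_⟩
  have hn0 : (0 : ℝ) < n := by exact_mod_cast hn
  have hn1 : (1 : ℝ) ≤ n := by exact_mod_cast hn
  have hc1 : (1 : ℝ) / n ≤ 1 := by rw [div_le_one hn0]; exact hn1
  obtain ⟨hLd, hLb⟩ := hlap 0 μ hμ
  obtain ⟨hrc, hrs⟩ := convOnDisc_respSeries hα0 hα1 hμ
  have hpc := convOnDisc_powSeries hα0 hα1
  have hbp := convOnDisc_bdfSeries.mul hpc
  have hf : ConvOnDisc (toC (respSeries α μ * (bdfSeries * powSeries α))) := by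
    rw [toC, map_mul, map_mul]; exact hrc.mul hbp
  rw [← norm_ofReal_sub_coeff]
  have key := norm_sub_coeff_le (m := 1) (p := 4) (C₁ := C₁) (C₂ := D 0 3) (k := 3) (n := n)
    (L := mlfLaplace α 0 μ) (y := ((1 - μ * mlf α α μ n : ℝ) : ℂ))
    (by norm_num) (by norm_num) hC₁ (hD 0 3).le hn hf
    (integrable_iteratedDeriv_mlfLaplace hα0 hα1 hμ (by positivity) 3 (by norm_num)) ?_ ?_ ?_
  · refine key.trans ?_
    rw [← hK, show (-1 - 1 : ℝ) = -2 by norm_num]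
    gcongr
    linarith [le_abs_self K]
  · have := one_sub_mlf_inversion hα0 hα1 hμ hn0 (by positivity : (0 : ℝ) < 1 / n) 2
    rw [← this]
    push_cast
    ring
  · intro θ hθ
    have := hresp μ hμ (powSymbol α) (fun z => z ^ ((α - 1 : ℝ) : ℂ)) (mlfLaplace α 0 μ) _
      (fun z hz hz4 _ => ⟨?_, ?_, ?_, ?_⟩) hLd (fun z hz => ?_) hf (fun z hz hz4 => ?_) (1 / n) θ
      (by positivity) hc1 hθ
    · refine this.trans_eq ?_
      congr 2
      push_cast
      ring
    · have h1 := (differentiable_bdiff z)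
      have h2 : DifferentiableAt ℂ bdfSymbol z := by
        unfold bdfSymbol; exact h1.add ((h1.pow 2).div_const _)
      unfold powSymbol
      exact h2.mul (h2.mul ((differentiableAt_id.cpow_const hz).add
        (differentiableAt_powRemainder hα1 hz4)))
    · exact differentiableAt_id.cpow_const hz
    · refine (hpow z (Complex.slitPlane_ne_zero hz) hz4).trans ?_
      gcongr
      linarith
    · rw [Complex.norm_cpow_real]
      exact le_mul_of_one_le_left (by positivity) (by linarith)
    · have hz0 : z ≠ 0 := fun h => by rw [h] at hz; simp at hz
      rw [mul_right_comm, cpow_ofReal_mul_eq hz0 (β := -(0 + 1)) (by ring)]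
      rfl
    · have hζ := norm_cexp_neg_lt_one hz
      rw [toC, map_mul, map_mul]
      rw [psum_mul hrc hbp hζ, psum_mul convOnDisc_bdfSeries hpc hζ, hrs z hz, psum_bdfSeries hζ,
        psum_powSeries hα0 hα1 hz hz4]
      unfold powSymbol bdfSymbol bdiff
      ring
  · intro θ _
    refine (hLb 3 (vline (1 / n) θ) (by rw [vline_re]; positivity)).trans_eq ?_
    norm_num

/-- The error of the discrete response to a constant source. -/
theorem abs_sub_coeff_linSeries_le {α : ℝ} (hα0 : 0 < α) (hα1 : α < 1) :
    ∃ C : ℝ, 0 < C ∧ ∀ μ : ℝ, 0 ≤ μ → ∀ n : ℕ, 1 ≤ n →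
      |mlf α α μ n - PowerSeries.coeff n (respSeries α μ * linSeries)| ≤
        C * (n : ℝ) ^ (α - 2) := by
  obtain ⟨C₀, hC₀, hlin⟩ := linSymbol_expansion
  obtain ⟨C₁, hC₁, hresp⟩ := norm_iteratedDeriv_response_sub_le hα0 hα1 (-1) 2
    (by positivity : 0 ≤ C₀ + 1)
  obtain ⟨D, hD, hlap⟩ := mlfLaplace_bounds hα0 hα1
  set K := Real.exp 1 / (2 * Real.pi) *
      (C₁ * (∫ θ, ‖vline 1 θ‖ ^ (-(((2 : ℕ) : ℝ) - (1 - α)))) +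
        D α 2 * 2 ^ (α + 1 + 2) * ∫ θ, ‖vline 1 θ‖ ^ (-(α + 1 + 2))) with hK
  refine ⟨|K| + 1, by positivity, fun μ hμ n hn => ?_⟩
  have hn0 : (0 : ℝ) < n := by exact_mod_cast hn
  have hn1 : (1 : ℝ) ≤ n := by exact_mod_cast hn
  have hc1 : (1 : ℝ) / n ≤ 1 := by rw [div_le_one hn0]; exact hn1
  obtain ⟨hLd, hLb⟩ := hlap α μ hμ
  obtain ⟨hrc, hrs⟩ := convOnDisc_respSeries hα0 hα1 hμ
  have hlc : ConvOnDisc (toC linSeries) := ConvOnDisc.of_hasSum fun ζ hζ => hasSum_linSeries hζ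
  have hf : ConvOnDisc (toC (respSeries α μ * linSeries)) := by
    rw [toC, map_mul]; exact hrc.mul hlc
  rw [← norm_ofReal_sub_coeff]
  have key := norm_sub_coeff_le (m := 1 - α) (p := α + 1 + 2) (C₁ := C₁) (C₂ := D α 2) (k := 2)
    (n := n) (L := mlfLaplace α α μ) (y := ((mlf α α μ n : ℝ) : ℂ))
    (by push_cast; linarith) (by linarith) hC₁ (hD α 2).le hn hf
    (integrable_iteratedDeriv_mlfLaplace hα0 hα1 hμ (by positivity) 2 (by positivity)) ?_ ?_ ?_
  · refine key.trans ?_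
    rw [← hK, show (-(1 - α) - 1 : ℝ) = α - 2 by ring]
    gcongr
    linarith [le_abs_self K]
  · rw [← Complex.ofReal_mul]
    exact mlf_inversion_iteratedDeriv hα0 hα1 hα0 hμ hn0 (by positivity : (0 : ℝ) < 1 / n) 2
  · intro θ hθ
    have := hresp μ hμ linSymbol (fun z => z⁻¹) (mlfLaplace α α μ) _
      (fun z hz hz4 hb => ⟨?_, ?_, ?_, ?_⟩) hLd (fun z hz => ?_) hf (fun z hz hz4 => ?_) (1 / n) θ
      (by positivity) hc1 hθ
    · refine this.trans_eq ?_
      congr 2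
      push_cast
      ring
    · have h1 := (differentiable_bdiff z)
      unfold linSymbol bdfSymbol
      exact (h1.add ((h1.pow 2).div_const _)).mul
        ((h1.const_sub 1).div (h1.pow 2) (pow_ne_zero 2 hb))
    · exact differentiableAt_inv (Complex.slitPlane_ne_zero hz)
    · refine (hlin z (Complex.slitPlane_ne_zero hz) hz4).trans ?_
      rw [show (-1 + 2 : ℝ) = 1 by norm_num, Real.rpow_one]
      gcongr
      linarith
    · rw [norm_inv, Real.rpow_neg_one]
      exact le_mul_of_one_le_left (by positivity) (by linarith)
    · have hz0 : z ≠ 0 := fun h => by rw [h] at hz; simp at hz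
      have h2 : z⁻¹ = z ^ (((-1 : ℝ)) : ℂ) := by
        rw [← Complex.cpow_neg_one]; norm_num
      rw [h2, mul_right_comm, cpow_ofReal_mul_eq hz0 (β := -(α + 1)) (by ring)]
      rfl
    · have hζ := norm_cexp_neg_lt_one hz
      rw [toC, map_mul, psum_mul hrc hlc hζ, hrs z hz, ← psum_linSeries hz, mul_assoc]
  · intro θ _
    refine (hLb 2 (vline (1 / n) θ) (by rw [vline_re]; positivity)).trans_eq ?_
    congr 2
    push_cast
    ring

/-- The error of the discrete response to the source `(t - s)₊` that sets in within the first step,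
including `s = 0`. -/
theorem abs_sub_coeff_quadSeries_le {α : ℝ} (hα0 : 0 < α) (hα1 : α < 1) :
    ∃ C : ℝ, 0 < C ∧ ∀ μ : ℝ, 0 ≤ μ → ∀ s : ℝ, 0 ≤ s → s < 1 → ∀ n : ℕ, 1 ≤ n →
      |mlf α (1 + α) μ (n - s) - PowerSeries.coeff n (respSeries α μ * quadSeries s)| ≤
        C * (n : ℝ) ^ (α - 1) := by
  obtain ⟨C₀, hC₀, hquad⟩ := quadSymbol_expansion
  obtain ⟨C₁, hC₁, hresp⟩ := norm_iteratedDeriv_response_sub_le hα0 hα1 (-2) 1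
    (by positivity : 0 ≤ C₀ + Real.exp 4)
  obtain ⟨D, hD, hlap⟩ := mlfLaplace_bounds hα0 hα1
  have hD0 := hD (1 + α) 0
  have hD1 := hD (1 + α) 1
  set K := Real.exp 1 / (2 * Real.pi) *
      (C₁ * (∫ θ, ‖vline 1 θ‖ ^ (-(((1 : ℕ) : ℝ) - (-α)))) +
        (D (1 + α) 0 + D (1 + α) 1) * 2 ^ (1 + α + 1) * ∫ θ, ‖vline 1 θ‖ ^ (-(1 + α + 1))) with hK
  refine ⟨|K| + 1, by positivity, fun μ hμ s hs0 hs1 n hn => ?_⟩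
  have hn0 : (0 : ℝ) < n := by exact_mod_cast hn
  have hn1 : (1 : ℝ) ≤ n := by exact_mod_cast hn
  have hc0 : (0 : ℝ) < 1 / n := by positivity
  have hc1 : (1 : ℝ) / n ≤ 1 := by rw [div_le_one hn0]; exact hn1
  have ht : 0 < (n : ℝ) - s := by linarith
  obtain ⟨hLd, hLb⟩ := hlap (1 + α) μ hμ
  obtain ⟨hrc, hrs⟩ := convOnDisc_respSeries hα0 hα1 hμ
  have hlc : ConvOnDisc (toC (quadSeries s)) :=
    ConvOnDisc.of_hasSum fun ζ hζ => hasSum_quadSeries s hζ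
  have hf : ConvOnDisc (toC (respSeries α μ * quadSeries s)) := by
    rw [toC, map_mul]; exact hrc.mul hlc
  set L₂ := mlfLaplace α (1 + α) μ with hL₂
  set L : ℂ → ℂ := fun z => Complex.exp (-(s * z)) * L₂ z with hLdef
  have hexpd : ∀ z, HasDerivAt (fun z : ℂ => Complex.exp (-(s * z)))
      (Complex.exp (-(s * z)) * -s) z := fun z => by
    simpa using (((hasDerivAt_id z).const_mul (s : ℂ)).neg).cexp
  have hLd' : DifferentiableOn ℂ L {z | 0 < z.re} := fun z hz =>
    (hexpd z).differentiableAt.differentiableWithinAt.mul (hLd z hz)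
  have hLderiv : ∀ θ, iteratedDeriv 1 L (vline (1 / n) θ) =
      Complex.exp (-(s * vline (1 / n) θ)) *
        (iteratedDeriv 1 L₂ (vline (1 / n) θ) - s * L₂ (vline (1 / n) θ)) := by
    intro θ
    have h1 : 0 < (vline (1 / n) θ).re := by rw [vline_re]; exact hc0
    have h2 := (hLd.differentiableAt (isOpen_re_pos.mem_nhds h1)).hasDerivAt
    rw [iteratedDeriv_one, iteratedDeriv_one]
    refine ((hexpd _).mul h2).deriv.trans ?_
    ring
  have hi1 := integrable_iteratedDeriv_mlfLaplace (β := 1 + α) hα0 hα1 hμ hc0 1 (by positivity)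
  have hi0 : Integrable fun θ => L₂ (vline (1 / n) θ) := by
    simpa using integrable_iteratedDeriv_mlfLaplace (β := 1 + α) hα0 hα1 hμ hc0 0
      (by simp; positivity)
  have hexps : ∀ θ, Complex.exp (-(s * vline (1 / n) θ)) =
      Complex.exp (((-s : ℝ) : ℂ) * vline (1 / n) θ) := fun θ => by
    congr 1; push_cast; ring
  rw [← norm_ofReal_sub_coeff]
  have key := norm_sub_coeff_le (m := -α) (p := 1 + α + 1) (C₁ := C₁)
    (C₂ := D (1 + α) 0 + D (1 + α) 1) (k := 1)
    (n := n) (L := L) (y := ((mlf α (1 + α) μ (n - s) : ℝ) : ℂ))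
    (by push_cast; linarith) (by linarith) hC₁ (by linarith) hn hf ?_ ?_ ?_ ?_
  · refine key.trans ?_
    rw [← hK, show (- -α - 1 : ℝ) = α - 1 by ring]
    gcongr
    linarith [le_abs_self K]
  · simp only [hLderiv, hexps]
    exact integrable_cexp_mul (hi1.sub (hi0.const_mul _))
  · have e1 := mlf_inversion_iteratedDeriv (β := 1 + α) hα0 hα1 (by linarith) hμ ht hc0 1
    have e0 := mlf_inversion (β := 1 + α) hα0 hα1 (by linarith) hμ ht hc0
    have e2 : ∫ θ : ℝ, Complex.exp (((n : ℝ) : ℂ) * vline (1 / n) θ) *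
        iteratedDeriv 1 L (vline (1 / n) θ) =
        (∫ θ : ℝ, Complex.exp (((n - s : ℝ) : ℂ) * vline (1 / n) θ) *
          iteratedDeriv 1 L₂ (vline (1 / n) θ)) -
        s * ∫ θ : ℝ, Complex.exp (((n - s : ℝ) : ℂ) * vline (1 / n) θ) * L₂ (vline (1 / n) θ) := by
      rw [← integral_const_mul, ← integral_sub (integrable_cexp_mul hi1)
        ((integrable_cexp_mul hi0).const_mul _)]
      congr 1
      ext θ
      have : Complex.exp (((n - s : ℝ) : ℂ) * vline (1 / n) θ) =
          Complex.exp (((n : ℝ) : ℂ) * vline (1 / n) θ) * Complex.exp (-(s * vline (1 / n) θ)) := by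
        rw [← Complex.exp_add]; congr 1; push_cast; ring
      rw [hLderiv, this]
      ring
    rw [e2, e0]
    have e3 : (∫ θ : ℝ, Complex.exp (((n - s : ℝ) : ℂ) * vline (1 / n) θ) *
          iteratedDeriv 1 L₂ (vline (1 / n) θ)) = -(((n - s : ℝ) : ℂ) *
          ((2 * Real.pi * mlf α (1 + α) μ (n - s) : ℝ) : ℂ)) := by
      rw [pow_one, pow_one, neg_one_mul] at e1
      rw [e1, neg_neg]
    rw [e3]
    push_cast
    ring
  · intro θ hθ
    have := hresp μ hμ (quadSymbol s) (fun z => Complex.exp (-(s * z)) * (z ^ 2)⁻¹) L _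
      (fun z hz hz4 hb => ⟨?_, ?_, ?_, ?_⟩) hLd' (fun z hz => ?_) hf (fun z hz hz4 => ?_) (1 / n) θ
      hc0 hc1 hθ
    · refine this.trans_eq ?_
      congr 2
      push_cast
      ring
    · have h1 := (differentiable_bdiff z)
      have h2 := pow_ne_zero 2 hb
      have h3 := pow_ne_zero 3 hb
      unfold quadSymbol bdfSymbol
      have h4 := h1.const_sub 1
      exact (h1.add ((h1.pow 2).div_const _)).mul
        (((((h4.mul (h1.const_sub 2)).div (h1.pow 3) h3).div_const _).sub
          ((h4.div (h1.pow 2) h2).const_mul _)).add ((h4.div h1 hb).const_mul _))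
    · exact (hexpd z).differentiableAt.mul
        ((differentiableAt_id.pow 2).inv (pow_ne_zero 2 (Complex.slitPlane_ne_zero hz)))
    · refine (hquad s hs0 hs1.le z (Complex.slitPlane_ne_zero hz) hz4).trans ?_
      rw [show (-2 + 2 : ℝ) = 0 by norm_num, Real.rpow_zero, mul_one]
      linarith [Real.exp_pos 4]
    · have h1 : ‖Complex.exp (-(s * z))‖ ≤ Real.exp 4 := by
        rw [Complex.norm_exp]
        refine Real.exp_le_exp.2 ?_
        rw [Complex.neg_re, Complex.re_ofReal_mul]
        have := (abs_le.1 (Complex.abs_re_le_norm z)).1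
        nlinarith
      rw [norm_mul, norm_inv, norm_pow, show (-2 : ℝ) = -((2 : ℕ) : ℝ) by norm_num,
        Real.rpow_neg (norm_nonneg _), Real.rpow_natCast]
      gcongr
      linarith
    · have hz0 : z ≠ 0 := fun h => by rw [h] at hz; simp at hz
      have h2 : (z ^ 2)⁻¹ = z ^ (((-2 : ℝ)) : ℂ) := by
        rw [← Complex.cpow_natCast, ← Complex.cpow_neg]; norm_num
      have h3 := cpow_ofReal_mul_eq hz0 (α := α) (γ := -2) (β := -(1 + α + 1)) (by ring)
      rw [h2, hLdef, hL₂]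
      simp only [mlfLaplace]
      rw [← h3]
      ring
    · have hζ := norm_cexp_neg_lt_one hz
      rw [toC, map_mul, psum_mul hrc hlc hζ, hrs z hz, ← psum_quadSeries s hz, mul_assoc]
  · intro θ hθ
    have hv0 := norm_vline_pos hc0 θ
    have hv1 : 1 ≤ ‖vline (1 / n) θ‖ := by
      have h6 := Complex.abs_im_le_norm (vline (1 / n) θ)
      rw [vline_im] at h6
      linarith [Real.pi_gt_three]
    have hre : 0 < (vline (1 / n) θ).re := by rw [vline_re]; exact hc0
    have h0 : ‖L₂ (vline (1 / n) θ)‖ ≤ D (1 + α) 0 * ‖vline (1 / n) θ‖ ^ (-(1 + α + 1)) := by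
      simpa using hLb 0 _ hre
    have h1 : ‖iteratedDeriv 1 L₂ (vline (1 / n) θ)‖ ≤
        D (1 + α) 1 * ‖vline (1 / n) θ‖ ^ (-(1 + α + 1)) := by
      refine (hLb 1 _ hre).trans ?_
      gcongr
      · push_cast; linarith
    have h2 : ‖Complex.exp (-(s * vline (1 / n) θ))‖ ≤ 1 := by
      rw [hexps, norm_cexp_vline, Real.exp_le_one_iff]
      nlinarith
    rw [hLderiv, norm_mul]
    calc _ ≤ 1 * (‖iteratedDeriv 1 L₂ (vline (1 / n) θ)‖ + s * ‖L₂ (vline (1 / n) θ)‖) := by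
          gcongr
          refine (norm_sub_le _ _).trans ?_
          rw [norm_mul, Complex.norm_real, Real.norm_of_nonneg hs0]
      _ ≤ ‖iteratedDeriv 1 L₂ (vline (1 / n) θ)‖ + 1 * ‖L₂ (vline (1 / n) θ)‖ := by
          rw [one_mul]; gcongr
      _ ≤ _ := by linarith

/-! ### Variation of constants for the fractional equation -/

/-- Euler's Beta integral: the convolution of powers. -/
theorem beta_kernel {p q x : ℝ} (hp : 0 < p) (hq : 0 < q) (hx : 0 < x) :
    IntervalIntegrable (fun r => (x - r) ^ (p - 1) * r ^ (q - 1)) volume 0 x ∧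
    ∫ r in 0..x, (x - r) ^ (p - 1) * r ^ (q - 1) =
      x ^ (p + q - 1) * (Real.Gamma p * Real.Gamma q / Real.Gamma (p + q)) := by
  have hcast : ∀ r ∈ uIoc 0 x, (r : ℂ) ^ ((q : ℂ) - 1) * ((x : ℂ) - r) ^ ((p : ℂ) - 1) =
      (((x - r) ^ (p - 1) * r ^ (q - 1) : ℝ) : ℂ) := by
    intro r hr
    rw [uIoc_of_le hx.le] at hr
    push_cast [Complex.ofReal_cpow (sub_nonneg.2 hr.2), Complex.ofReal_cpow hr.1.le]
    ring
  have hb := Complex.betaIntegral_scaled (q : ℂ) (p : ℂ) hx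
  have hI : ∫ r in 0..x, (((x - r) ^ (p - 1) * r ^ (q - 1) : ℝ) : ℂ) =
      ((x ^ (p + q - 1) * (Real.Gamma p * Real.Gamma q / Real.Gamma (p + q)) : ℝ) : ℂ) := by
    rw [← intervalIntegral.integral_congr_ae (Eventually.of_forall hcast), hb,
      Complex.betaIntegral_eq_Gamma_mul_div _ _ (by simpa using hq) (by simpa using hp)]
    rw [← Complex.ofReal_add, Complex.Gamma_ofReal, Complex.Gamma_ofReal, Complex.Gamma_ofReal,
      ← Complex.ofReal_one, ← Complex.ofReal_sub, ← Complex.ofReal_cpow hx.le, add_comm q p]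
    push_cast
    ring
  rw [intervalIntegral.integral_ofReal, Complex.ofReal_inj] at hI
  refine ⟨?_, hI⟩
  refine intervalIntegral.intervalIntegrable_of_integral_ne_zero ?_
  rw [hI]
  have := Real.Gamma_pos_of_pos hp
  have := Real.Gamma_pos_of_pos hq
  have := Real.Gamma_pos_of_pos (add_pos hp hq)
  positivity

/-- The Mittag-Leffler series for the exponent `β = α - 1`, whose sum has an integrable singularity
at zero: a termwise bound on `(0, T]`. -/
theorem exists_mlf_resolvent_bound {α : ℝ} (hα : 0 < α) (μ : ℝ) {T : ℝ} (hT : 0 < T) :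
    ∃ b : ℕ → ℝ, Summable b ∧ ∀ t ∈ Ioc 0 T, ∀ k : ℕ,
      ‖(-μ) ^ k * (t ^ (α * k + (α - 1)) / Real.Gamma (α * k + (α - 1) + 1))‖
        ≤ t ^ (α - 1) * b k := by
  refine ⟨fun k => α * T ^ (-α) *
    ((-(-(2 * |μ|))) ^ k * (T ^ (α * k + α) / Real.Gamma (α * k + α + 1))),
    (mlf_hasSum hα hα.le _ hT.le).summable.mul_left _, fun t ht k => ?_⟩
  have ht0 : 0 < t := ht.1
  have hs : 0 < α * k + α := by positivity
  have hG : 0 < Real.Gamma (α * k + α) := Real.Gamma_pos_of_pos hs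
  have e : α * k + (α - 1) + 1 = α * k + α := by ring
  simp only
  rw [e, Real.Gamma_add_one hs.ne', neg_neg, norm_mul, norm_pow, norm_neg, Real.norm_eq_abs,
    Real.norm_of_nonneg (by positivity), add_comm (α * (k : ℝ)) (α - 1), Real.rpow_add ht0,
    Real.rpow_add hT]
  have h1 : t ^ (α * k) ≤ T ^ (α * k) := Real.rpow_le_rpow ht0.le ht.2 (by positivity)
  have h2 : (k : ℝ) + 1 ≤ 2 ^ k := by exact_mod_cast Nat.lt_two_pow_self
  have h3 : T ^ (-α) * T ^ α = 1 := by rw [← Real.rpow_add hT]; simp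
  calc |μ| ^ k * (t ^ (α - 1) * t ^ (α * k) / Real.Gamma (α * k + α))
      ≤ |μ| ^ k * (t ^ (α - 1) * T ^ (α * k) / Real.Gamma (α * k + α)) := by gcongr
    _ = t ^ (α - 1) * (α * (T ^ (-α) * T ^ α) * (((k : ℝ) + 1) * |μ| ^ k *
          (T ^ (α * k) / ((α * k + α) * Real.Gamma (α * k + α))))) := by
        rw [h3]; field_simp
    _ ≤ t ^ (α - 1) * (α * (T ^ (-α) * T ^ α) * (2 ^ k * |μ| ^ k *
          (T ^ (α * k) / ((α * k + α) * Real.Gamma (α * k + α))))) := by gcongr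
    _ = _ := by rw [mul_pow]; ring

theorem mlf_resolvent_hasSum {α : ℝ} (hα : 0 < α) (μ : ℝ) {t : ℝ} (ht : 0 < t) :
    HasSum (fun k : ℕ => (-μ) ^ k * (t ^ (α * k + (α - 1)) / Real.Gamma (α * k + (α - 1) + 1)))
      (mlf α (α - 1) μ t) := by
  obtain ⟨b, hb, h⟩ := exists_mlf_resolvent_bound hα μ ht
  exact (Summable.of_norm_bounded (hb.mul_left (t ^ (α - 1))) fun k => h t ⟨ht, le_rfl⟩ k).hasSum

theorem exists_norm_mlf_resolvent_le {α : ℝ} (hα : 0 < α) (μ : ℝ) {T : ℝ} (hT : 0 < T) :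
    ∃ M : ℝ, 0 ≤ M ∧ ∀ t ∈ Ioc 0 T, ‖mlf α (α - 1) μ t‖ ≤ M * t ^ (α - 1) := by
  obtain ⟨b, hb, h⟩ := exists_mlf_resolvent_bound hα μ hT
  have hb0 : ∀ k, 0 ≤ b k := fun k => by
    have h1 := (norm_nonneg _).trans (h T ⟨hT, le_rfl⟩ k)
    exact nonneg_of_mul_nonneg_right h1 (by positivity)
  refine ⟨∑' k, b k, tsum_nonneg hb0, fun t ht => ?_⟩
  rw [mul_comm, ← tsum_mul_left]
  exact tsum_of_norm_bounded (hb.mul_left _).hasSum fun k => h t ht k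

theorem measurable_mlf (α β μ : ℝ) : Measurable (mlf α β μ) := by
  unfold mlf
  exact Measurable.tsum fun k => by fun_prop

/-- Convolution with a power maps Mittag-Leffler functions to Mittag-Leffler functions. -/
theorem integral_mlf_resolvent_mul_rpow {α γ : ℝ} (hα : 0 < α) (hγ : 0 < γ) (μ : ℝ) {x : ℝ}
    (hx : 0 < x) :
    ∫ r in 0..x, mlf α (α - 1) μ (x - r) * r ^ (γ - 1) =
      Real.Gamma γ * mlf α (α - 1 + γ) μ x := by
  obtain ⟨b, hb, h⟩ := exists_mlf_resolvent_bound hα μ hx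
  have hβ := fun k : ℕ => beta_kernel (p := α * k + α) (q := γ) (by positivity) hγ hx
  have hae : ∀ᵐ r : ℝ, r ≠ x := by simp [ae_iff]
  have hsum := intervalIntegral.hasSum_integral_of_dominated_convergence (μ := volume) (a := 0)
    (b := x) (F := fun (k : ℕ) r => (-μ) ^ k * ((x - r) ^ (α * k + (α - 1)) /
      Real.Gamma (α * k + (α - 1) + 1)) * r ^ (γ - 1))
    (f := fun r => mlf α (α - 1) μ (x - r) * r ^ (γ - 1))
    (fun k r => ((x - r) ^ (α - 1) * r ^ (γ - 1)) * b k)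
    (fun k => by
      refine Measurable.aestronglyMeasurable ?_
      fun_prop)
    (fun k => by
      filter_upwards [hae] with r hr hr'
      rw [uIoc_of_le hx.le] at hr'
      have h1 : x - r ∈ Ioc 0 x := ⟨sub_pos.2 (lt_of_le_of_ne hr'.2 hr), by linarith [hr'.1]⟩
      have h2 := h (x - r) h1 k
      have h3 := hr'.1
      rw [norm_mul, Real.norm_of_nonneg (by positivity : 0 ≤ r ^ (γ - 1)), mul_right_comm]
      gcongr)
    (Eventually.of_forall fun r _ => hb.mul_left _)
    (by
      simp only [tsum_mul_left]
      exact (beta_kernel hα hγ hx).1.mul_const _)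
    (by
      filter_upwards [hae] with r hr hr'
      rw [uIoc_of_le hx.le] at hr'
      exact (mlf_resolvent_hasSum hα μ (sub_pos.2 (lt_of_le_of_ne hr'.2 hr))).mul_right _)
  rw [← hsum.tsum_eq, mlf, ← tsum_mul_left]
  congr 1
  ext k
  have e1 : ∀ r, (-μ) ^ k * ((x - r) ^ (α * k + (α - 1)) /
      Real.Gamma (α * k + (α - 1) + 1)) * r ^ (γ - 1) =
      ((-μ) ^ k / Real.Gamma (α * k + α)) * ((x - r) ^ (α * k + α - 1) * r ^ (γ - 1)) := fun r => by
    rw [show α * k + (α - 1) + 1 = α * k + α by ring, ← add_sub_assoc]; ring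
  simp only [e1]
  rw [intervalIntegral.integral_const_mul, (hβ k).2]
  have hG : Real.Gamma (α * k + α) ≠ 0 := (Real.Gamma_pos_of_pos (by positivity)).ne'
  rw [show α * k + (α - 1 + γ) + 1 = α * k + α + γ by ring,
    show α * k + (α - 1 + γ) = α * k + α + γ - 1 by ring]
  field_simp

theorem mlf_zero_exponent {α : ℝ} (hα : 0 < α) (μ : ℝ) {t : ℝ} (ht : 0 ≤ t) :
    mlf α 0 μ t = 1 - μ * mlf α α μ t := by
  have h := (mlf_hasSum hα le_rfl μ ht).summable
  rw [mlf, h.tsum_eq_zero_add, mlf, ← tsum_mul_left, sub_eq_add_neg, ← tsum_neg]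
  congr 1
  · simp
  · congr 1
    ext k
    push_cast
    rw [show α * ((k : ℝ) + 1) + 0 = α * k + α by ring, pow_succ]
    ring

/-- Associativity of the convolution of the resolvent, a power `r ^ (γ - 1)` and an integrable
function. As `α + γ ≥ 1`, the convolution of the first two is bounded, so that the identity holds
at every point. -/
theorem integral_mlf_resolvent_mul_riemannLiouville {α γ : ℝ} (hα : 0 < α) (hγ : 0 < γ)
    (hαγ : 1 ≤ α + γ) (μ : ℝ) {t : ℝ} (ht : 0 < t) {φ : ℝ → ℝ}
    (hφ : IntervalIntegrable φ volume 0 t) :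
    IntervalIntegrable
      (fun s => mlf α (α - 1) μ (t - s) * ∫ ζ in 0..s, (s - ζ) ^ (γ - 1) * φ ζ) volume 0 t ∧
    ∫ s in 0..t, mlf α (α - 1) μ (t - s) * ∫ ζ in 0..s, (s - ζ) ^ (γ - 1) * φ ζ =
      Real.Gamma γ * ∫ ζ in 0..t, mlf α (α - 1 + γ) μ (t - ζ) * φ ζ := by
  obtain ⟨M, hM, hρ⟩ := exists_norm_mlf_resolvent_le hα μ ht
  set ρ := mlf α (α - 1) μ with hρdef
  set W : ℝ → ℝ := (Ioc 0 t).indicator φ with hW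
  have hWi : Integrable W := by
    rw [hW, integrable_indicator_iff measurableSet_Ioc]
    exact (intervalIntegrable_iff_integrableOn_Ioc_of_le ht.le).1 hφ
  -- the integrand on the triangle `0 < ζ < s < t`
  set k : ℝ → ℝ → ℝ := fun ζ s => (Ioo ζ t).indicator (fun s => ρ (t - s) * (s - ζ) ^ (γ - 1)) s
    with hk
  set B := Real.Gamma α * Real.Gamma γ / Real.Gamma (α + γ) with hB
  have hB0 : 0 ≤ B := by
    have := Real.Gamma_pos_of_pos hα
    have := Real.Gamma_pos_of_pos hγ
    have := Real.Gamma_pos_of_pos (add_pos hα hγ)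
    positivity
  have hρm : Measurable ρ := measurable_mlf _ _ _
  have hkm : Measurable (Function.uncurry fun ζ s => k ζ s) := by
    have hset : MeasurableSet {p : ℝ × ℝ | p.1 < p.2 ∧ p.2 < t} :=
      (measurableSet_lt measurable_fst measurable_snd).inter
        (measurableSet_lt measurable_snd measurable_const)
    have : (Function.uncurry fun ζ s => k ζ s) =
        {p : ℝ × ℝ | p.1 < p.2 ∧ p.2 < t}.indicator
          fun p => ρ (t - p.2) * (p.2 - p.1) ^ (γ - 1) := by
      ext ⟨ζ, s⟩
      rfl
    rw [this]
    refine Measurable.indicator ?_ hset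
    exact (hρm.comp (measurable_const.sub measurable_snd)).mul
      ((measurable_snd.sub measurable_fst).pow_const _)
  have hmaj : ∀ ζ ∈ Ioo 0 t, IntegrableOn (fun s => M * ((t - s) ^ (α - 1) * (s - ζ) ^ (γ - 1)))
      (Ioo ζ t) ∧ ∫ s in Ioo ζ t, M * ((t - s) ^ (α - 1) * (s - ζ) ^ (γ - 1)) =
        M * ((t - ζ) ^ (α + γ - 1) * B) := by
    intro ζ hζ
    obtain ⟨h1, h2⟩ := beta_kernel hα hγ (sub_pos.2 hζ.2)
    have h3 := (h1.comp_sub_right ζ)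
    simp only [zero_add, sub_add_cancel] at h3
    have e : ∀ s, t - ζ - (s - ζ) = t - s := fun s => by ring
    simp only [e] at h3
    rw [intervalIntegrable_iff_integrableOn_Ioo_of_le hζ.2.le] at h3
    refine ⟨h3.const_mul M, ?_⟩
    rw [integral_const_mul, ← integral_Ioc_eq_integral_Ioo,
      ← intervalIntegral.integral_of_le hζ.2.le, hB, ← h2]
    have := intervalIntegral.integral_comp_sub_right (a := ζ) (b := t)
      (fun r => (t - ζ - r) ^ (α - 1) * r ^ (γ - 1)) ζ
    simp only [e, sub_self] at this
    rw [this]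
  have hle : ∀ ζ ∈ Ioo 0 t, ∀ s ∈ Ioo ζ t, ‖ρ (t - s) * (s - ζ) ^ (γ - 1)‖ ≤
      M * ((t - s) ^ (α - 1) * (s - ζ) ^ (γ - 1)) := by
    intro ζ hζ s hs
    have h1 : 0 ≤ s - ζ := by linarith [hs.1]
    rw [norm_mul, Real.norm_of_nonneg (by positivity : 0 ≤ (s - ζ) ^ (γ - 1)), ← mul_assoc]
    gcongr
    exact hρ _ ⟨by linarith [hs.2], by linarith [hs.1, hζ.1]⟩
  have hki : ∀ ζ ∈ Ioo 0 t, Integrable (k ζ) := by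
    intro ζ hζ
    rw [hk, integrable_indicator_iff measurableSet_Ioo]
    refine (hmaj ζ hζ).1.mono' (Measurable.aestronglyMeasurable ?_) ?_
    · exact (hρm.comp (measurable_const.sub measurable_id)).mul
        ((measurable_id.sub_const ζ).pow_const _)
    · filter_upwards [ae_restrict_mem measurableSet_Ioo] with s hs using hle ζ hζ s hs
  have hkn : ∀ ζ ∈ Ioo 0 t, ∫ s, ‖k ζ s‖ ≤ M * (t ^ (α + γ - 1) * B) := by
    intro ζ hζ
    have : ∀ s, ‖k ζ s‖ = (Ioo ζ t).indicator (fun s => ‖ρ (t - s) * (s - ζ) ^ (γ - 1)‖) s :=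
      fun s => norm_indicator_eq_indicator_norm _ _
    simp only [this]
    rw [integral_indicator measurableSet_Ioo]
    refine (setIntegral_mono_on ?_ (hmaj ζ hζ).1 measurableSet_Ioo (hle ζ hζ)).trans ?_
    · have := (hki ζ hζ).norm
      simp only [‹∀ s, ‖k ζ s‖ = _›] at this
      exact (integrable_indicator_iff measurableSet_Ioo).1 this
    · rw [(hmaj ζ hζ).2]
      have := hζ.1
      have := hζ.2
      gcongr
      · linarith
  have hζae : ∀ᵐ ζ : ℝ, ζ ≠ t := by simp [ae_iff]
  have hHi : Integrable (Function.uncurry fun ζ s => k ζ s * W ζ) (volume.prod volume) := by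
    have hm : AEStronglyMeasurable (Function.uncurry fun ζ s => k ζ s * W ζ)
        (volume.prod volume) :=
      hkm.aestronglyMeasurable.mul hWi.aestronglyMeasurable.comp_fst
    rw [integrable_prod_iff hm]
    constructor
    · filter_upwards [hζae] with ζ hζ
      by_cases h : ζ ∈ Ioc 0 t
      · simpa only [Function.uncurry] using (hki ζ ⟨h.1, lt_of_le_of_ne h.2 hζ⟩).mul_const (W ζ)
      · simp [Function.uncurry, hW, indicator_of_notMem h]
    · refine (hWi.norm.const_mul (M * (t ^ (α + γ - 1) * B))).mono'
        hm.norm.integral_prod_right' ?_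
      filter_upwards [hζae] with ζ hζ
      simp only [Function.uncurry, norm_mul]
      rw [integral_mul_const, Real.norm_of_nonneg (by positivity)]
      by_cases h : ζ ∈ Ioc 0 t
      · gcongr
        exact hkn ζ ⟨h.1, lt_of_le_of_ne h.2 hζ⟩
      · simp [hW, indicator_of_notMem h]
  have hs1 : ∀ s ∈ Ioo 0 t, ∫ ζ, k ζ s * W ζ =
      ρ (t - s) * ∫ ζ in 0..s, (s - ζ) ^ (γ - 1) * φ ζ := by
    intro s hs
    rw [intervalIntegral.integral_of_le hs.1.le, integral_Ioc_eq_integral_Ioo, ← integral_const_mul,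
      ← integral_indicator measurableSet_Ioo]
    congr 1
    ext ζ
    by_cases h : ζ ∈ Ioo 0 s
    · rw [indicator_of_mem h, hk, hW, indicator_of_mem (show ζ ∈ Ioc 0 t from
        ⟨h.1, (h.2.trans hs.2).le⟩)]
      simp only
      rw [indicator_of_mem (show s ∈ Ioo ζ t from ⟨h.2, hs.2⟩)]
      ring
    · rw [indicator_of_notMem h]
      rw [mem_Ioo, not_and_or, not_lt, not_lt] at h
      rcases h with h | h
      · rw [hW, indicator_of_notMem (fun h' => absurd h'.1 (not_lt.2 h)), mul_zero]
      · simp only [hk]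
        rw [indicator_of_notMem (fun h' => absurd h'.1 (not_lt.2 h)), zero_mul]
  have hs0 : ∀ s ∉ Ioo 0 t, ∫ ζ, k ζ s * W ζ = 0 := by
    intro s hs
    refine integral_eq_zero_of_ae (Eventually.of_forall fun ζ => ?_)
    simp only [hk, hW, Pi.zero_apply]
    by_cases h : s ∈ Ioo ζ t
    · rw [indicator_of_notMem (s := Ioc 0 t) fun h' => hs ⟨h'.1.trans h.1, h.2⟩, mul_zero]
    · rw [indicator_of_notMem h, zero_mul]
  have hfun : (fun s => ∫ ζ, k ζ s * W ζ) = (Ioo 0 t).indicator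
      (fun s => ρ (t - s) * ∫ ζ in 0..s, (s - ζ) ^ (γ - 1) * φ ζ) := by
    ext s
    by_cases h : s ∈ Ioo 0 t
    · rw [indicator_of_mem h, hs1 s h]
    · rw [indicator_of_notMem h, hs0 s h]
  constructor
  · rw [intervalIntegrable_iff_integrableOn_Ioo_of_le ht.le,
      ← integrable_indicator_iff measurableSet_Ioo, ← hfun]
    exact hHi.integral_prod_right
  · rw [intervalIntegral.integral_of_le ht.le, integral_Ioc_eq_integral_Ioo,
      ← integral_indicator measurableSet_Ioo, ← hfun, ← integral_integral_swap hHi,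
      intervalIntegral.integral_of_le ht.le, integral_Ioc_eq_integral_Ioo, ← integral_const_mul,
      ← integral_indicator measurableSet_Ioo]
    refine integral_congr_ae ?_
    filter_upwards [hζae] with ζ hζ
    rw [integral_mul_const]
    by_cases h : ζ ∈ Ioo 0 t
    · rw [indicator_of_mem h, hW, indicator_of_mem (Ioo_subset_Ioc_self h), ← mul_assoc,
        ← integral_mlf_resolvent_mul_rpow hα hγ μ (sub_pos.2 h.2), hk]
      congr 1
      rw [integral_indicator measurableSet_Ioo, ← integral_Ioc_eq_integral_Ioo,
        ← intervalIntegral.integral_of_le h.2.le]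
      have := intervalIntegral.integral_comp_sub_right (a := ζ) (b := t)
        (fun r => ρ (t - ζ - r) * r ^ (γ - 1)) ζ
      rw [sub_self] at this
      rw [← this]
      refine intervalIntegral.integral_congr fun s _ => ?_
      rw [sub_sub_sub_cancel_right]
    · rw [indicator_of_notMem h, hW,
        indicator_of_notMem (fun h' => h ⟨h'.1, lt_of_le_of_ne h'.2 hζ⟩),
        mul_zero]

/-- The solution of a scalar fractional equation in terms of Mittag-Leffler functions. Convolving
the equation with the resolvent `t ^ (α - 1) E_{α, α}(-μ t ^ α)` turns the Caputo derivative of `v`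
into `v` itself. -/
theorem variation_of_constants {α μ T t : ℝ} (hα0 : 0 < α) (hα1 : α < 1) (ht : t ∈ Ioc 0 T)
    {v w g h : ℝ → ℝ} {v₀ g₀ g₁ : ℝ} (hw : IntervalIntegrable w volume 0 T)
    (hv : ∀ s ∈ Icc 0 T, v s = v₀ + ∫ ζ in 0..s, w ζ)
    (heq : ∀ᵐ s ∂volume.restrict (Ioc 0 T),
      (Real.Gamma (1 - α))⁻¹ * (∫ ζ in 0..s, (s - ζ) ^ (-α) * w ζ) + μ * v s = g s)
    (hh : IntervalIntegrable h volume 0 T)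
    (hg : ∀ s ∈ Icc 0 T, g s = g₀ + s * g₁ + ∫ ζ in 0..s, (s - ζ) * h ζ) :
    v t = v₀ * (1 - μ * mlf α α μ t) + g₀ * mlf α α μ t + g₁ * mlf α (1 + α) μ t
      + ∫ ζ in 0..t, mlf α (1 + α) μ (t - ζ) * h ζ := by
  have ht0 : 0 < t := ht.1
  have hsub : uIcc 0 t ⊆ uIcc 0 T := by
    rw [uIcc_of_le ht0.le, uIcc_of_le (ht0.le.trans ht.2)]
    exact Icc_subset_Icc_right ht.2
  have hwt := hw.mono_set hsub
  have hht := hh.mono_set hsub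
  set ρ := mlf α (α - 1) μ with hρ
  obtain ⟨i1, e1⟩ := integral_mlf_resolvent_mul_riemannLiouville (γ := 1 - α) hα0 (by linarith)
    (by linarith) μ ht0 hwt
  obtain ⟨i2, e2⟩ := integral_mlf_resolvent_mul_riemannLiouville (γ := 1) hα0 one_pos
    (by linarith) μ ht0 hwt
  obtain ⟨i3, e3⟩ := integral_mlf_resolvent_mul_riemannLiouville (γ := 2) hα0 two_pos
    (by linarith) μ ht0 hht
  have hG := Real.Gamma_pos_of_pos (by linarith : 0 < 1 - α)
  rw [show 1 - α - 1 = -α by ring] at i1 e1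
  rw [show (2 : ℝ) - 1 = 1 by norm_num] at i3 e3
  rw [show α - 1 + (1 - α) = 0 by ring] at e1
  simp only [sub_self, Real.rpow_zero, one_mul, Real.Gamma_one, sub_add_cancel, Real.rpow_one,
    show α - 1 + 2 = 1 + α by ring, Real.Gamma_two] at i2 e2 i3 e3
  rw [← hρ] at i1 e1 i2 e2 i3 e3
  have e5 := integral_mlf_resolvent_mul_rpow hα0 one_pos μ ht0
  have e6 := integral_mlf_resolvent_mul_rpow hα0 two_pos μ ht0
  simp only [sub_self, Real.rpow_zero, mul_one, Real.Gamma_one, sub_add_cancel, one_mul, ← hρ,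
    show (2 : ℝ) - 1 = 1 by norm_num, Real.rpow_one, show α - 1 + 2 = 1 + α by ring,
    Real.Gamma_two] at e5 e6
  have i5 : IntervalIntegrable (fun s => ρ (t - s)) volume 0 t := by
    obtain ⟨M, hM, hb⟩ := exists_norm_mlf_resolvent_le hα0 μ ht0
    have h1 := (beta_kernel hα0 one_pos ht0).1
    simp only [sub_self, Real.rpow_zero, mul_one] at h1
    refine (h1.const_mul M).mono_fun' ((measurable_mlf _ _ _).comp
      (measurable_const.sub measurable_id)).aestronglyMeasurable ?_
    have hae : ∀ᵐ r : ℝ, r ≠ t := by simp [ae_iff]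
    filter_upwards [ae_restrict_mem measurableSet_uIoc, ae_restrict_of_ae hae] with s hs hst
    rw [uIoc_of_le ht0.le] at hs
    exact hb _ ⟨sub_pos.2 (lt_of_le_of_ne hs.2 hst), by linarith [hs.1]⟩
  have i6 : IntervalIntegrable (fun s => ρ (t - s) * s) volume 0 t :=
    i5.mul_continuousOn continuousOn_id
  -- the equation, multiplied by `ρ (t - s)`
  have hint : ∫ s in 0..t, ((Real.Gamma (1 - α))⁻¹ *
        (ρ (t - s) * ∫ ζ in 0..s, (s - ζ) ^ (-α) * w ζ) +
        (μ * (v₀ * ρ (t - s)) + μ * (ρ (t - s) * ∫ ζ in 0..s, w ζ))) =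
      ∫ s in 0..t, ((g₀ * ρ (t - s) + g₁ * (ρ (t - s) * s)) +
        ρ (t - s) * ∫ ζ in 0..s, (s - ζ) * h ζ) := by
    refine intervalIntegral.integral_congr_ae ?_
    rw [uIoc_of_le ht0.le]
    have := (ae_restrict_iff' measurableSet_Ioc).1 heq
    filter_upwards [this] with s hs hs'
    have hsT : s ∈ Ioc 0 T := ⟨hs'.1, hs'.2.trans ht.2⟩
    have h1 := hs hsT
    rw [hv s (Ioc_subset_Icc_self hsT), hg s (Ioc_subset_Icc_self hsT)] at h1
    linear_combination ρ (t - s) * h1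
  rw [intervalIntegral.integral_add (i1.const_mul _) (((i5.const_mul v₀).const_mul μ).add
      (i2.const_mul μ)),
    intervalIntegral.integral_add ((i5.const_mul v₀).const_mul μ) (i2.const_mul μ),
    intervalIntegral.integral_add ((i5.const_mul g₀).add (i6.const_mul g₁)) i3,
    intervalIntegral.integral_add (i5.const_mul g₀) (i6.const_mul g₁)] at hint
  simp only [intervalIntegral.integral_const_mul] at hint
  have hy : ContinuousOn (fun ζ => mlf α α μ (t - ζ)) (uIcc 0 t) := by
    rw [uIcc_of_le ht0.le]
    exact (continuousOn_mlf hα0 hα0 μ t).comp (by fun_prop) fun s hs =>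
      ⟨by linarith [hs.2], by linarith [hs.1]⟩
  have e7 : ∫ ζ in 0..t, mlf α 0 μ (t - ζ) * w ζ =
      (∫ ζ in 0..t, w ζ) - μ * ∫ ζ in 0..t, mlf α α μ (t - ζ) * w ζ := by
    rw [← intervalIntegral.integral_const_mul, ← intervalIntegral.integral_sub hwt
      ((hwt.continuousOn_mul hy).const_mul μ)]
    refine intervalIntegral.integral_congr fun ζ hζ => ?_
    rw [uIcc_of_le ht0.le] at hζ
    rw [mlf_zero_exponent hα0 μ (sub_nonneg.2 hζ.2)]
    ring
  rw [e1, e2, e3, e5, e6, e7, ← mul_assoc, inv_mul_cancel₀ hG.ne', one_mul] at hint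
  rw [hv t ⟨ht0.le, ht.2⟩]
  linarith

/-! ### Taylor expansions with integral remainder -/

/-- Cauchy's formula for repeated integration. -/
theorem integral_integral_sub_pow_mul {h : ℝ → ℝ} {x : ℝ} (hx : 0 ≤ x)
    (hh : IntervalIntegrable h volume 0 x) (k : ℕ) :
    IntervalIntegrable (fun ξ => ∫ ζ in 0..ξ, (ξ - ζ) ^ k * h ζ) volume 0 x ∧
    ∫ ξ in 0..x, ∫ ζ in 0..ξ, (ξ - ζ) ^ k * h ζ =
      ∫ ζ in 0..x, (x - ζ) ^ (k + 1) / (k + 1) * h ζ := by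
  set ν := volume.restrict (Ioc 0 x) with hν
  set H : ℝ × ℝ → ℝ := {p : ℝ × ℝ | p.2 ≤ p.1}.indicator (fun p => (p.1 - p.2) ^ k) with hH
  have hHm : Measurable H :=
    Measurable.indicator (by fun_prop) (measurableSet_le measurable_snd measurable_fst)
  have hi : Integrable (Function.uncurry fun ξ ζ => H (ξ, ζ) * h ζ) (ν.prod ν) := by
    have h1 : Integrable h ν := (intervalIntegrable_iff_integrableOn_Ioc_of_le hx).1 hh
    refine (h1.comp_snd ν).bdd_mul (c := x ^ k) hHm.aestronglyMeasurable ?_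
    rw [hν, Measure.prod_restrict]
    filter_upwards [ae_restrict_mem (measurableSet_Ioc.prod measurableSet_Ioc)] with p hp
    rw [hH]
    by_cases hq : p.2 ≤ p.1
    · rw [indicator_of_mem (show p ∈ {p : ℝ × ℝ | p.2 ≤ p.1} from hq), norm_pow, Real.norm_eq_abs,
        abs_of_nonneg (sub_nonneg.2 hq)]
      have h2 := hp.1.2
      have h3 := hp.2.1
      have h4 : 0 ≤ p.1 - p.2 := sub_nonneg.2 hq
      gcongr
      linarith
    · rw [indicator_of_notMem (show p ∉ {p : ℝ × ℝ | p.2 ≤ p.1} from hq), norm_zero]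
      positivity
  have hinner : ∀ ξ ∈ Ioc 0 x, ∫ ζ, H (ξ, ζ) * h ζ ∂ν = ∫ ζ in 0..ξ, (ξ - ζ) ^ k * h ζ := by
    intro ξ hξ
    have e : ∀ ζ, H (ξ, ζ) * h ζ = (Iic ξ).indicator (fun ζ => (ξ - ζ) ^ k * h ζ) ζ := by
      intro ζ
      simp only [hH, indicator, mem_ofPred_eq, mem_Iic]
      split_ifs <;> simp
    simp only [e]
    rw [integral_indicator measurableSet_Iic, hν, Measure.restrict_restrict measurableSet_Iic,
      inter_comm, Ioc_inter_Iic, inf_of_le_right hξ.2, intervalIntegral.integral_of_le hξ.1.le]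
  have houter : ∀ ζ ∈ Ioc 0 x, ∫ ξ, H (ξ, ζ) * h ζ ∂ν = (x - ζ) ^ (k + 1) / (k + 1) * h ζ := by
    intro ζ hζ
    rw [integral_mul_const]
    congr 1
    have e : ∀ ξ, H (ξ, ζ) = (Ici ζ).indicator (fun ξ => (ξ - ζ) ^ k) ξ := by
      intro ξ
      simp only [hH, indicator, mem_ofPred_eq, mem_Ici]
    simp only [e]
    rw [integral_indicator measurableSet_Ici, integral_Ici_eq_integral_Ioi, hν,
      Measure.restrict_restrict measurableSet_Ioi, inter_comm, Ioc_inter_Ioi,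
      sup_of_le_right hζ.1.le,
      ← intervalIntegral.integral_of_le hζ.2,
      intervalIntegral.integral_comp_sub_right (fun r => r ^ k) ζ, integral_pow, sub_self]
    simp
  have hi1 := hi.integral_prod_left
  simp only [Function.uncurry] at hi1
  constructor
  · rw [intervalIntegrable_iff_integrableOn_Ioc_of_le hx]
    exact hi1.congr (by
      filter_upwards [ae_restrict_mem measurableSet_Ioc] with ξ hξ using hinner ξ hξ)
  · rw [intervalIntegral.integral_of_le hx, intervalIntegral.integral_of_le hx,
      ← setIntegral_congr_fun measurableSet_Ioc hinner,
      ← setIntegral_congr_fun measurableSet_Ioc houter]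
    exact integral_integral_swap hi

/-! ### The discrete solution as a convolution -/

/-- The sequence `((m τ - ζ)₊)² / 2`. -/
noncomputable def truncSqSeries (τ ζ : ℝ) : PowerSeries ℝ :=
  PowerSeries.mk fun m => max (m * τ - ζ) 0 ^ 2 / 2

theorem coeff_bdfSeries_mul (f : PowerSeries ℝ) (u : ℤ → ℝ) (hu : ∀ n : ℤ, n ≤ 0 → u n = 0)
    (hf : ∀ n : ℕ, PowerSeries.coeff n f = u n) (n : ℕ) :
    PowerSeries.coeff n (bdfSeries * f) = 3 / 2 * u n - 2 * u (n - 1) + 1 / 2 * u (n - 2) := by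
  have h1 : ∀ n : ℕ, PowerSeries.coeff n (PowerSeries.X * f) = u (n - 1) := by
    intro n
    rcases n with _ | n
    · simp [hu]
    · rw [PowerSeries.coeff_succ_X_mul, hf]; push_cast; congr 1; ring
  have h2 : PowerSeries.coeff n (PowerSeries.X * (PowerSeries.X * f)) = u (n - 2) := by
    rcases n with _ | n
    · simp [hu]
    · rw [PowerSeries.coeff_succ_X_mul, h1]; push_cast; congr 1; ring
  rw [bdfSeries, add_mul, add_mul, mul_assoc, mul_assoc, mul_assoc, map_add, map_add,
    PowerSeries.coeff_C_mul, PowerSeries.coeff_C_mul, PowerSeries.coeff_C_mul, hf, h1, h2]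
  ring

theorem coeff_shiftSeries_mul (α : ℝ) (f : PowerSeries ℝ) (n : ℕ) :
    PowerSeries.coeff (n + 1) (shiftSeries α * f) =
      (1 - α / 2) * PowerSeries.coeff (n + 1) f + α / 2 * PowerSeries.coeff n f := by
  rw [shiftSeries, add_mul, map_add, mul_assoc, PowerSeries.coeff_C_mul, PowerSeries.coeff_C_mul,
    PowerSeries.coeff_succ_X_mul]

/-- The backward difference of `t ^ (2 - α) / Γ(3 - α)` is homogeneous in the step size. -/
theorem bdfPower_eq_coeff {α τ : ℝ} (hα1 : α < 1) (hτ : 0 < τ) (n : ℕ) :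
    bdfPower α τ (n * τ) = τ ^ (1 - α) * PowerSeries.coeff n (bdfSeries * powSeries α) := by
  have h0 : (2 - α) ≠ 0 := by linarith
  rw [coeff_bdfSeries_mul (powSeries α)
    (fun n : ℤ => max (n : ℝ) 0 ^ (2 - α) / Real.Gamma (3 - α)) (fun n hn => ?_) (fun n => ?_)]
  · have e : ∀ x : ℝ, max (x * τ) 0 ^ (2 - α) = τ ^ (2 - α) * max x 0 ^ (2 - α) := by
      intro x
      rw [← Real.mul_rpow hτ.le (le_max_right _ _), mul_max_of_nonneg _ _ hτ.le, mul_zero, mul_comm]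
    have e1 : (n : ℝ) * τ - τ = ((n : ℝ) - 1) * τ := by ring
    have e2 : (n : ℝ) * τ - 2 * τ = ((n : ℝ) - 2) * τ := by ring
    have e3 : τ ^ (2 - α) = τ * τ ^ (1 - α) := by
      rw [← Real.rpow_one_add' hτ.le (by linarith)]; congr 1; ring
    rw [bdfPower, e1, e2, e, e, e, e3]
    push_cast
    field_simp
  · have : max (n : ℝ) 0 = 0 := max_eq_right (by exact_mod_cast hn)
    simp only [this, Real.zero_rpow h0, zero_div]
  · rw [powSeries, PowerSeries.coeff_mk]
    simp

/-- Power series division depends only on the coefficients up to the order in question. -/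
theorem coeff_eq_of_mul_eq {q q' u r : PowerSeries ℝ} (hq : q * q' = 1) {N : ℕ}
    (h : ∀ m ≤ N, PowerSeries.coeff m (q * u) = PowerSeries.coeff m r) {n : ℕ} (hn : n ≤ N) :
    PowerSeries.coeff n u = PowerSeries.coeff n (q' * r) := by
  have : u = q' * (q * u) := by rw [← mul_assoc, mul_comm q', hq, one_mul]
  conv_lhs => rw [this]
  rw [PowerSeries.coeff_mul, PowerSeries.coeff_mul]
  refine Finset.sum_congr rfl fun p hp => ?_
  rw [h p.2 ((Finset.HasAntidiagonal.mem_antidiagonal.1 hp ▸ Nat.le_add_left _ _).trans hn)]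

/-- The scheme is a convolution equation for the sequence `U`. Multiplied by `τ ^ α` it depends on
`τ` and `μ` through `μ τ ^ α` only, apart from the data. -/
theorem IsCrankNicolson.eq_coeff {α τ μ : ℝ} (hα0 : 0 < α) (hα1 : α < 1) (hτ : 0 < τ) (hμ : 0 ≤ μ)
    {N : ℕ} {g : ℝ → ℝ} {u₀ : ℝ} {U : ℤ → ℝ} {u : ℕ → ℝ}
    (h : IsCrankNicolson α τ N (fun x => μ * x) g u₀ U u) {n : ℕ} (hn1 : 1 ≤ n) (hn : n ≤ N) :
    u n = τ ^ (α - 1) * PowerSeries.coeff n (respSeries α (μ * τ ^ α) *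
      PowerSeries.mk fun m => ∫ ξ in 0..((m : ℝ) * τ), g ξ) +
      u₀ * PowerSeries.coeff n (respSeries α (μ * τ ^ α) * (bdfSeries * powSeries α)) := by
  set μ' := μ * τ ^ α with hμ'
  have hμ0 : 0 ≤ μ' := by positivity
  set F : PowerSeries ℝ := PowerSeries.mk fun m => ∫ ξ in 0..((m : ℝ) * τ), g ξ with hF
  set φ : PowerSeries ℝ := F + PowerSeries.C (u₀ * τ ^ (1 - α)) * (bdfSeries * powSeries α) with hφ
  set V : PowerSeries ℝ := PowerSeries.mk fun n => U n with hV
  have hφc : ∀ m : ℕ, PowerSeries.coeff m φ =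
      (∫ ξ in 0..((m : ℝ) * τ), g ξ) + bdfPower α τ (m * τ) * u₀ := by
    intro m
    rw [hφ, map_add, PowerSeries.coeff_C_mul, bdfPower_eq_coeff hα1 hτ, hF, PowerSeries.coeff_mk]
    ring
  have hτα : τ ^ α * τ ^ (-α) = 1 := by rw [← Real.rpow_add hτ]; simp
  have hkey : ∀ m ≤ N, PowerSeries.coeff m (schemeSeries α μ' * V) =
      PowerSeries.coeff m (PowerSeries.C (τ ^ α) * (shiftSeries α * φ)) := by
    intro m hm
    rcases m with _ | m
    · have h1 : PowerSeries.constantCoeff V = 0 := by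
        rw [← PowerSeries.coeff_zero_eq_constantCoeff_apply, hV, PowerSeries.coeff_mk]
        exact h.nonpos _ (by simp)
      have h2 : PowerSeries.constantCoeff φ = 0 := by
        rw [← PowerSeries.coeff_zero_eq_constantCoeff_apply, hφc]
        have h2α : (2 - α) ≠ 0 := by linarith
        simp [bdfPower, hτ.le, Real.zero_rpow h2α]
      simp [h1, h2]
    · have hs := h.step (m + 1) (by omega) hm
      simp only [smul_eq_mul] at hs
      have e1 : ((m + 1 : ℕ) : ℤ) - 1 = m := by push_cast; ring
      have e2 : ((m + 1 : ℕ) : ℝ) - 1 = m := by push_cast; ring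
      rw [e1, e2] at hs
      have hgl : PowerSeries.coeff (m + 1) (glSeries α * V) =
          ∑ j ∈ Finset.range (m + 1 + 1), glCoeff α j * U (((m + 1 : ℕ) : ℤ) - j) := by
        rw [PowerSeries.coeff_mul, Finset.Nat.sum_antidiagonal_eq_sum_range_succ_mk]
        refine Finset.sum_congr rfl fun j hj => ?_
        have : j ≤ m + 1 := by simpa [Nat.lt_succ_iff] using hj
        rw [glSeries, hV, PowerSeries.coeff_mk, PowerSeries.coeff_mk, Nat.cast_sub this]
      rw [schemeSeries, add_mul, map_add, mul_assoc, PowerSeries.coeff_C_mul,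
        PowerSeries.coeff_C_mul,
        coeff_shiftSeries_mul, coeff_shiftSeries_mul, hφc, hφc, hgl]
      have e3 : ∀ k : ℕ, PowerSeries.coeff k V = U k := fun k => by rw [hV, PowerSeries.coeff_mk]
      rw [e3, e3, hμ']
      linear_combination τ ^ α * hs - (∑ j ∈ Finset.range (m + 1 + 1),
        glCoeff α j * U (((m + 1 : ℕ) : ℤ) - j)) * hτα
  have hinv := schemeSeries_mul_inv (α := α) hα1 hμ0
  have hVn : ∀ m ≤ N, PowerSeries.coeff m V = PowerSeries.coeff m
      (PowerSeries.C (τ ^ α) * ((schemeSeries α μ')⁻¹ * (shiftSeries α * φ))) := by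
    intro m hm
    rw [coeff_eq_of_mul_eq hinv hkey hm]
    congr 1
    ring
  have hbdf : PowerSeries.coeff n (bdfSeries * V) = PowerSeries.coeff n (bdfSeries *
      (PowerSeries.C (τ ^ α) * ((schemeSeries α μ')⁻¹ * (shiftSeries α * φ)))) := by
    rw [PowerSeries.coeff_mul, PowerSeries.coeff_mul]
    refine Finset.sum_congr rfl fun p hp => ?_
    rw [hVn p.2 ((Finset.HasAntidiagonal.mem_antidiagonal.1 hp ▸ Nat.le_add_left _ _).trans hn)]
  have hval := h.value n hn1 hn
  simp only [smul_eq_mul] at hval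
  rw [coeff_bdfSeries_mul V U h.nonpos (fun k => by rw [hV, PowerSeries.coeff_mk])] at hbdf
  rw [hval, hbdf]
  have e5 : bdfSeries * (PowerSeries.C (τ ^ α) * ((schemeSeries α μ')⁻¹ * (shiftSeries α * φ))) =
      PowerSeries.C (τ ^ α) * (respSeries α μ' * F) + PowerSeries.C (τ ^ α * (u₀ * τ ^ (1 - α))) *
        (respSeries α μ' * (bdfSeries * powSeries α)) := by
    rw [hφ, respSeries, map_mul PowerSeries.C (τ ^ α)]
    ring
  rw [e5, map_add, PowerSeries.coeff_C_mul, PowerSeries.coeff_C_mul]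
  have e6 : τ ^ α = τ ^ (α - 1) * τ := by
    rw [Real.rpow_sub_one hτ.ne']; field_simp
  have e7 : τ ^ α * τ ^ (1 - α) = τ := by rw [← Real.rpow_add hτ]; simp
  have e8 : τ⁻¹ * (τ ^ α * PowerSeries.coeff n (respSeries α μ' * F)) =
      τ ^ (α - 1) * PowerSeries.coeff n (respSeries α μ' * F) := by
    rw [e6]; field_simp
  rw [mul_add, e8]
  congr 1
  have e9 : τ ^ α * (u₀ * τ ^ (1 - α)) = u₀ * τ := by rw [mul_left_comm, e7]
  rw [e9]
  field_simp

/-! ### The error of the scalar scheme -/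

/-- The error at `t_n = n τ` for the initial value `1`. -/
noncomputable def initError (α τ μ : ℝ) (n : ℕ) : ℝ :=
  (1 - μ * mlf α α μ (n * τ)) -
    PowerSeries.coeff n (respSeries α (μ * τ ^ α) * (bdfSeries * powSeries α))

/-- The error at `t_n = n τ` for the source `1`. -/
noncomputable def constError (α τ μ : ℝ) (n : ℕ) : ℝ :=
  mlf α α μ (n * τ) - τ ^ α * PowerSeries.coeff n (respSeries α (μ * τ ^ α) * linSeries)

/-- The error at `t_n = n τ` for the source `(t - ζ)₊`. -/
noncomputable def rampError (α τ μ : ℝ) (n : ℕ) (ζ : ℝ) : ℝ :=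
  mlf α (1 + α) μ (n * τ - ζ) -
    τ ^ (α - 1) * PowerSeries.coeff n (respSeries α (μ * τ ^ α) * truncSqSeries τ ζ)

/-- Up to a shift by full steps and a rescaling, `(t - ζ)₊` sets in within the first step. -/
theorem truncSqSeries_eq {τ ζ : ℝ} (hτ : 0 < τ) (hζ : 0 ≤ ζ) :
    truncSqSeries τ ζ = PowerSeries.C (τ ^ 2) *
      (PowerSeries.X ^ ⌊ζ / τ⌋₊ * quadSeries (ζ / τ - ⌊ζ / τ⌋₊)) := by
  have hq : 0 ≤ ζ / τ := by positivity
  have h1 := Nat.floor_le hq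
  have h2 := Nat.lt_floor_add_one (ζ / τ)
  set j := ⌊ζ / τ⌋₊
  ext m
  rw [PowerSeries.coeff_C_mul, PowerSeries.coeff_X_pow_mul', truncSqSeries, PowerSeries.coeff_mk]
  have e : (m : ℝ) * τ - ζ = τ * (m - ζ / τ) := by field_simp
  rw [e]
  split_ifs with h
  · rw [quadSeries, PowerSeries.coeff_mk]
    split_ifs with h3
    · have : m = j := by omega
      rw [this, max_eq_right (by nlinarith)]
      simp
    · have h4 : (j : ℝ) + 1 ≤ m := by exact_mod_cast (by omega : j + 1 ≤ m)
      rw [max_eq_left (by apply mul_nonneg hτ.le; linarith), Nat.cast_sub h]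
      ring
  · have h4 : (m : ℝ) ≤ j := by exact_mod_cast (by omega : m ≤ j)
    rw [max_eq_right (by nlinarith)]
    simp

/-- The kernel bounds with step size `τ`, by rescaling from `τ = 1` and shifting by full steps. All
three carry the factor `τ ^ 2`. -/
theorem exists_error_bounds {α : ℝ} (hα0 : 0 < α) (hα1 : α < 1) :
    ∃ C : ℝ, 0 < C ∧ ∀ τ μ : ℝ, 0 < τ → 0 ≤ μ → ∀ n : ℕ, 1 ≤ n →
      |initError α τ μ n| ≤ C * τ ^ 2 * (n * τ) ^ (-2 : ℝ) ∧
      |constError α τ μ n| ≤ C * τ ^ 2 * (n * τ) ^ (α - 2) ∧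
      ∀ ζ ∈ Ico 0 (n * τ), |rampError α τ μ n ζ| ≤ C * τ ^ 2 * (n * τ - ζ) ^ (α - 1) := by
  obtain ⟨C₁, hC₁, h1⟩ := abs_sub_coeff_powSeries_le hα0 hα1
  obtain ⟨C₂, hC₂, h2⟩ := abs_sub_coeff_linSeries_le hα0 hα1
  obtain ⟨C₃, hC₃, h3⟩ := abs_sub_coeff_quadSeries_le hα0 hα1
  refine ⟨C₁ + C₂ + C₃, by positivity, fun τ μ hτ hμ n hn => ?_⟩
  have hn0 : (0 : ℝ) < n := by exact_mod_cast hn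
  set μ' := μ * τ ^ α with hμ'
  have hμ0 : 0 ≤ μ' := by positivity
  have hτ2 : τ ^ 2 * τ ^ (-2 : ℝ) = 1 := by
    rw [← Real.rpow_natCast, ← Real.rpow_add hτ]; simp
  refine ⟨?_, ?_, fun ζ hζ => ?_⟩
  · have e : initError α τ μ n = (1 - μ' * mlf α α μ' n) -
        PowerSeries.coeff n (respSeries α μ' * (bdfSeries * powSeries α)) := by
      rw [initError, mul_comm (n : ℝ) τ, mlf_scale hτ _ _ hn0.le, ← hμ', hμ']
      ring_nf
    rw [e]
    refine (h1 μ' hμ0 n hn).trans ?_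
    rw [Real.mul_rpow hn0.le hτ.le]
    calc C₁ * (n : ℝ) ^ (-2 : ℝ) ≤ (C₁ + C₂ + C₃) * (n : ℝ) ^ (-2 : ℝ) := by gcongr; linarith
      _ = (C₁ + C₂ + C₃) * (n : ℝ) ^ (-2 : ℝ) * (τ ^ 2 * τ ^ (-2 : ℝ)) := by rw [hτ2, mul_one]
      _ = _ := by ring
  · have e : constError α τ μ n = τ ^ α * (mlf α α μ' n -
        PowerSeries.coeff n (respSeries α μ' * linSeries)) := by
      rw [constError, mul_comm (n : ℝ) τ, mlf_scale hτ _ _ hn0.le, ← hμ']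
      ring
    rw [e, abs_mul, abs_of_nonneg (by positivity : 0 ≤ τ ^ α), Real.mul_rpow hn0.le hτ.le]
    have e2 : τ ^ 2 * τ ^ (α - 2) = τ ^ α := by
      rw [← Real.rpow_natCast, ← Real.rpow_add hτ]; congr 1; push_cast; ring
    calc _ ≤ τ ^ α * (C₂ * (n : ℝ) ^ (α - 2)) := by gcongr; exact h2 μ' hμ0 n hn
      _ ≤ τ ^ α * ((C₁ + C₂ + C₃) * (n : ℝ) ^ (α - 2)) := by gcongr; linarith
      _ = _ := by rw [← e2]; ring
  · have hq : 0 ≤ ζ / τ := div_nonneg hζ.1 hτ.le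
    have h4 := Nat.floor_le hq
    have h5 := Nat.lt_floor_add_one (ζ / τ)
    have htr := truncSqSeries_eq hτ hζ.1
    set j := ⌊ζ / τ⌋₊
    set s := ζ / τ - j with hs
    have hs0 : 0 ≤ s := by linarith
    have hs1 : s < 1 := by linarith
    have hζn : ζ / τ < n := by rw [div_lt_iff₀ hτ]; exact hζ.2
    have hjn : j < n := by exact_mod_cast h4.trans_lt hζn
    have hcast : ((n - j : ℕ) : ℝ) = n - j := Nat.cast_sub hjn.le
    have hpos : 0 < ((n - j : ℕ) : ℝ) - s := by rw [hcast, hs]; linarith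
    have et : n * τ - ζ = τ * (((n - j : ℕ) : ℝ) - s) := by
      rw [hcast, hs]; field_simp; ring
    have e2 : τ ^ (α - 1) * τ ^ 2 = τ ^ (1 + α) := by
      rw [← Real.rpow_natCast, ← Real.rpow_add hτ]; congr 1; push_cast; ring
    have e : rampError α τ μ n ζ = τ ^ (1 + α) * (mlf α (1 + α) μ' (((n - j : ℕ) : ℝ) - s) -
        PowerSeries.coeff (n - j) (respSeries α μ' * quadSeries s)) := by
      have e3 : respSeries α μ' * truncSqSeries τ ζ = PowerSeries.C (τ ^ 2) *
          (PowerSeries.X ^ j * (respSeries α μ' * quadSeries s)) := by rw [htr]; ring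
      rw [rampError, et, mlf_scale hτ _ _ hpos.le, ← hμ', e3, PowerSeries.coeff_C_mul,
        PowerSeries.coeff_X_pow_mul', if_pos hjn.le, ← mul_assoc, e2]
      ring
    rw [e, abs_mul, abs_of_nonneg (by positivity : 0 ≤ τ ^ (1 + α)), et,
      Real.mul_rpow hτ.le hpos.le]
    have e4 : τ ^ 2 * τ ^ (α - 1) = τ ^ (1 + α) := by rw [mul_comm, e2]
    have h6 := h3 μ' hμ0 s hs0 hs1 (n - j) (by omega)
    have h7 : ((n - j : ℕ) : ℝ) ^ (α - 1) ≤ (((n - j : ℕ) : ℝ) - s) ^ (α - 1) :=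
      Real.rpow_le_rpow_of_nonpos hpos (by linarith) (by linarith)
    calc _ ≤ τ ^ (1 + α) * (C₃ * (((n - j : ℕ) : ℝ) - s) ^ (α - 1)) := by
          gcongr; exact h6.trans (by gcongr)
      _ ≤ τ ^ (1 + α) * ((C₁ + C₂ + C₃) * (((n - j : ℕ) : ℝ) - s) ^ (α - 1)) := by
          gcongr; linarith
      _ = _ := by rw [← e4]; ring

theorem continuous_coeff_mul_truncSqSeries (r : PowerSeries ℝ) (τ : ℝ) (n : ℕ) :
    Continuous fun ζ => PowerSeries.coeff n (r * truncSqSeries τ ζ) := by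
  simp only [PowerSeries.coeff_mul, truncSqSeries, PowerSeries.coeff_mk]
  fun_prop

theorem continuousOn_mlf_const_sub {α β : ℝ} (hα : 0 < α) (hβ : 0 < β) (μ t : ℝ) :
    ContinuousOn (fun ζ => mlf α β μ (t - ζ)) (Icc 0 t) :=
  (continuousOn_mlf hα hβ μ t).comp (by fun_prop) fun s hs =>
    ⟨by linarith [hs.2], by linarith [hs.1]⟩

theorem continuousOn_rampError {α : ℝ} (hα : 0 < α) (τ μ : ℝ) (n : ℕ) :
    ContinuousOn (rampError α τ μ n) (Icc 0 (n * τ)) :=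
  (continuousOn_mlf_const_sub hα (by linarith) μ _).sub
    ((continuous_coeff_mul_truncSqSeries _ _ _).const_mul _).continuousOn

/-- The discrete response to the integral `∫₀^t g` of a function `g`, given by its Taylor expansion
with integral remainder. -/
theorem coeff_mul_integral_taylor {r : PowerSeries ℝ} {τ : ℝ} (hτ : 0 < τ) {n : ℕ} {g h : ℝ → ℝ}
    {g₀ g₁ : ℝ} (hh : IntervalIntegrable h volume 0 (n * τ))
    (hg : ∀ s ∈ Icc 0 (n * τ), g s = g₀ + s * g₁ + ∫ ζ in 0..s, (s - ζ) * h ζ) :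
    PowerSeries.coeff n (r * PowerSeries.mk fun m => ∫ ξ in 0..((m : ℝ) * τ), g ξ) =
      g₀ * (τ * PowerSeries.coeff n (r * linSeries)) +
      g₁ * PowerSeries.coeff n (r * truncSqSeries τ 0) +
      ∫ ζ in 0..(n * τ), PowerSeries.coeff n (r * truncSqSeries τ ζ) * h ζ := by
  have hF : ∀ m ≤ n, ∫ ξ in 0..((m : ℝ) * τ), g ξ =
      g₀ * (τ * m) + g₁ * (max (m * τ - 0) 0 ^ 2 / 2) +
        ∫ ζ in 0..(n * τ), max (m * τ - ζ) 0 ^ 2 / 2 * h ζ := by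
    intro m hm
    have hmτ : (0 : ℝ) ≤ m * τ := by positivity
    have hmn : (m : ℝ) * τ ≤ n * τ := by gcongr
    have hhm : IntervalIntegrable h volume 0 (m * τ) := hh.mono_set (by
      rw [uIcc_of_le hmτ, uIcc_of_le (hmτ.trans hmn)]; exact Icc_subset_Icc_right hmn)
    obtain ⟨i1, e1⟩ := integral_integral_sub_pow_mul hmτ hhm 1
    simp only [pow_one] at i1 e1
    have e2 : ∫ ξ in 0..((m : ℝ) * τ), g ξ =
        ∫ ξ in 0..((m : ℝ) * τ), (g₀ + ξ * g₁ + ∫ ζ in 0..ξ, (ξ - ζ) * h ζ) := by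
      refine intervalIntegral.integral_congr fun ξ hξ => ?_
      rw [uIcc_of_le hmτ] at hξ
      exact hg ξ ⟨hξ.1, hξ.2.trans hmn⟩
    have i2 : ∀ a b : ℝ, IntervalIntegrable (fun ξ : ℝ => g₀ + ξ * g₁) volume a b := fun a b =>
      (by fun_prop : Continuous fun ξ : ℝ => g₀ + ξ * g₁).intervalIntegrable _ _
    have e3 : ∫ ξ in 0..((m : ℝ) * τ), (g₀ + ξ * g₁) = g₀ * (τ * m) + g₁ * ((m * τ) ^ 2 / 2) := by
      rw [intervalIntegral.integral_add intervalIntegrable_const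
        ((by fun_prop : Continuous fun ξ : ℝ => ξ * g₁).intervalIntegrable _ _),
        intervalIntegral.integral_const, intervalIntegral.integral_mul_const, integral_id]
      simp only [smul_eq_mul]
      ring
    have i3 : ∀ a b : ℝ, IntervalIntegrable h volume a b →
        IntervalIntegrable (fun ζ => max (m * τ - ζ) 0 ^ 2 / 2 * h ζ) volume a b := fun a b hab =>
      hab.continuousOn_mul (by fun_prop)
    have hh' : IntervalIntegrable h volume (m * τ) (n * τ) := hh.mono_set (by
      rw [uIcc_of_le hmn, uIcc_of_le (hmτ.trans hmn)]; exact Icc_subset_Icc_left hmτ)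
    rw [e2, intervalIntegral.integral_add (i2 _ _) i1, e3, e1, sub_zero, max_eq_left hmτ,
      ← intervalIntegral.integral_add_adjacent_intervals (i3 _ _ hhm) (i3 _ _ hh')]
    have e4 : ∫ ζ in ((m : ℝ) * τ)..(n * τ), max (m * τ - ζ) 0 ^ 2 / 2 * h ζ = 0 := by
      rw [intervalIntegral.integral_congr (g := fun _ => (0 : ℝ)) fun ζ hζ => ?_]
      · simp
      · rw [uIcc_of_le hmn] at hζ
        simp [max_eq_right (sub_nonpos.2 hζ.1)]
    rw [e4, add_zero]
    congr 1
    refine intervalIntegral.integral_congr fun ζ hζ => ?_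
    rw [uIcc_of_le hmτ] at hζ
    rw [max_eq_left (sub_nonneg.2 hζ.2)]
    norm_num
  simp only [PowerSeries.coeff_mul, truncSqSeries, linSeries, PowerSeries.coeff_mk, Finset.sum_mul,
    Finset.mul_sum]
  rw [intervalIntegral.integral_finsetSum fun p _ => hh.continuousOn_mul (by fun_prop),
    ← Finset.sum_add_distrib, ← Finset.sum_add_distrib]
  refine Finset.sum_congr rfl fun p hp => ?_
  rw [hF p.2 (Finset.HasAntidiagonal.mem_antidiagonal.1 hp ▸ Nat.le_add_left _ _), mul_add, mul_add,
    ← intervalIntegral.integral_const_mul]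
  congr 1
  · ring
  · congr 1
    ext ζ
    ring

/-- The error of the scheme for a scalar equation, represented by the errors for the sources
`1` and `(t - ζ)₊` and for the initial value `1`. -/
theorem scalar_error_eq {α τ T μ : ℝ} (hα0 : 0 < α) (hα1 : α < 1) (hτ : 0 < τ) (hμ : 0 ≤ μ)
    {N : ℕ} {v w g h : ℝ → ℝ} {v₀ g₀ g₁ : ℝ} {U : ℤ → ℝ} {u : ℕ → ℝ}
    (hw : IntervalIntegrable w volume 0 T)
    (hv : ∀ s ∈ Icc 0 T, v s = v₀ + ∫ ζ in 0..s, w ζ)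
    (heq : ∀ᵐ s ∂volume.restrict (Ioc 0 T),
      (Real.Gamma (1 - α))⁻¹ * (∫ ζ in 0..s, (s - ζ) ^ (-α) * w ζ) + μ * v s = g s)
    (hh : IntervalIntegrable h volume 0 T)
    (hg : ∀ s ∈ Icc 0 T, g s = g₀ + s * g₁ + ∫ ζ in 0..s, (s - ζ) * h ζ)
    (hU : IsCrankNicolson α τ N (fun x => μ * x) g v₀ U u) {n : ℕ} (hn1 : 1 ≤ n) (hn : n ≤ N)
    (hnT : n * τ ≤ T) :
    v (n * τ) - u n = v₀ * initError α τ μ n + g₀ * constError α τ μ n +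
      g₁ * rampError α τ μ n 0 + ∫ ζ in 0..(n * τ), rampError α τ μ n ζ * h ζ := by
  have hn0 : (0 : ℝ) < n := by exact_mod_cast hn1
  have ht0 : 0 < n * τ := by positivity
  have hhn : IntervalIntegrable h volume 0 (n * τ) := hh.mono_set (by
    rw [uIcc_of_le ht0.le, uIcc_of_le (ht0.le.trans hnT)]; exact Icc_subset_Icc_right hnT)
  have hgn : ∀ s ∈ Icc 0 (n * τ), g s = g₀ + s * g₁ + ∫ ζ in 0..s, (s - ζ) * h ζ :=
    fun s hs => hg s ⟨hs.1, hs.2.trans hnT⟩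
  rw [variation_of_constants hα0 hα1 ⟨ht0, hnT⟩ hw hv heq hh hg,
    hU.eq_coeff hα0 hα1 hτ hμ hn1 hn, coeff_mul_integral_taylor hτ hhn hgn]
  have e1 : ∫ ζ in 0..(n * τ), rampError α τ μ n ζ * h ζ =
      (∫ ζ in 0..(n * τ), mlf α (1 + α) μ (n * τ - ζ) * h ζ) - τ ^ (α - 1) *
        ∫ ζ in 0..(n * τ), PowerSeries.coeff n
          (respSeries α (μ * τ ^ α) * truncSqSeries τ ζ) * h ζ := by
    rw [← intervalIntegral.integral_const_mul, ← intervalIntegral.integral_sub]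
    · refine intervalIntegral.integral_congr fun ζ _ => ?_
      simp only [rampError]
      ring
    · refine hhn.continuousOn_mul ?_
      rw [uIcc_of_le ht0.le]
      exact continuousOn_mlf_const_sub hα0 (by linarith) μ _
    · exact (hhn.continuousOn_mul
        (continuous_coeff_mul_truncSqSeries _ _ _).continuousOn).const_mul _
  have e2 : τ ^ α = τ ^ (α - 1) * τ := by
    rw [Real.rpow_sub_one hτ.ne']; field_simp
  rw [e1, initError, constError, rampError, e2, sub_zero]
  ring

/-! ### Reduction to scalar equations by an eigenbasis -/

theorem HasWeakDeriv.mono {G : Type*} [NormedAddCommGroup G] [NormedSpace ℝ G] {T t : ℝ}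
    {g g' : ℝ → G} (h : HasWeakDeriv T g g') (ht : t ∈ Icc 0 T) :
    IntervalIntegrable g' volume 0 t :=
  h.1.mono_set (by
    rw [uIcc_of_le ht.1, uIcc_of_le (ht.1.trans ht.2)]; exact Icc_subset_Icc_right ht.2)

theorem HasWeakDeriv.clm_apply {G : Type*} [NormedAddCommGroup G] [NormedSpace ℝ G]
    [CompleteSpace G] {T : ℝ} {g g' : ℝ → G} (h : HasWeakDeriv T g g') (L : G →L[ℝ] ℝ) :
    HasWeakDeriv T (fun t => L (g t)) (fun t => L (g' t)) := by
  refine ⟨⟨L.integrable_comp h.1.1, L.integrable_comp h.1.2⟩, fun t ht => ?_⟩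
  rw [L.intervalIntegral_comp_comm (h.mono ht), ← map_add, ← h.2 t ht]

theorem HasWeakDeriv.continuousOn {G : Type*} [NormedAddCommGroup G] [NormedSpace ℝ G]
    {T : ℝ} (hT : 0 ≤ T) {g g' : ℝ → G} (h : HasWeakDeriv T g g') : ContinuousOn g (Icc 0 T) := by
  have h1 : ContinuousOn (fun t => g 0 + ∫ ζ in 0..t, g' ζ) (Icc 0 T) := by
    have := intervalIntegral.continuousOn_primitive_interval' (μ := volume) h.1 left_mem_uIcc
    rw [uIcc_of_le hT] at this
    exact continuousOn_const.add this
  exact h1.congr h.2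

/-- Taylor's formula of order one with integral remainder. -/
theorem HasWeakDeriv.taylor {T : ℝ} {g g' h : ℝ → ℝ} (h1 : HasWeakDeriv T g g')
    (h2 : HasWeakDeriv T g' h) {t : ℝ} (ht : t ∈ Icc 0 T) :
    g t = g 0 + t * g' 0 + ∫ ζ in 0..t, (t - ζ) * h ζ := by
  obtain ⟨i1, e1⟩ := integral_integral_sub_pow_mul ht.1 (h2.mono ht) 0
  simp only [pow_zero, one_mul, zero_add, pow_one, Nat.cast_zero, div_one] at i1 e1
  have e2 : ∫ ζ in 0..t, g' ζ = ∫ ζ in 0..t, (g' 0 + ∫ ξ in 0..ζ, h ξ) := by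
    refine intervalIntegral.integral_congr fun ζ hζ => ?_
    rw [uIcc_of_le ht.1] at hζ
    exact h2.2 ζ ⟨hζ.1, hζ.2.trans ht.2⟩
  rw [h1.2 t ht, e2, intervalIntegral.integral_add intervalIntegrable_const i1, e1,
    intervalIntegral.integral_const]
  simp [add_assoc]

/-- The integral in the Caputo derivative of an absolutely continuous function converges at almost
every point. -/
theorem ae_intervalIntegrable_caputo {V : Type*} [NormedAddCommGroup V] [NormedSpace ℝ V]
    {α T : ℝ} (hα : α < 1) (hT : 0 ≤ T) {w : ℝ → V} (hw : IntervalIntegrable w volume 0 T) :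
    ∀ᵐ s ∂volume.restrict (Ioc 0 T),
      IntervalIntegrable (fun ζ => (s - ζ) ^ (-α) • w ζ) volume 0 s := by
  have h1 : Integrable ((Ioc 0 T).indicator w) := by
    rw [integrable_indicator_iff measurableSet_Ioc]
    exact (intervalIntegrable_iff_integrableOn_Ioc_of_le hT).1 hw
  have h2 : Integrable ((Ioc 0 T).indicator fun r : ℝ => r ^ (-α)) := by
    rw [integrable_indicator_iff measurableSet_Ioc]
    exact (intervalIntegrable_iff_integrableOn_Ioc_of_le hT).1
      (intervalIntegral.intervalIntegrable_rpow' (by linarith))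
  have h3 := h1.ae_convolution_exists (ContinuousLinearMap.lsmul ℝ ℝ).flip h2
  filter_upwards [ae_restrict_mem measurableSet_Ioc, ae_restrict_of_ae h3] with s hs hs'
  rw [intervalIntegrable_iff_integrableOn_Ioo_of_le hs.1.le]
  refine (hs'.integrableOn (s := Ioo 0 s)).congr_fun (fun ζ hζ => ?_) measurableSet_Ioo
  have e1 : ζ ∈ Ioc 0 T := ⟨hζ.1, hζ.2.le.trans hs.2⟩
  have e2 : s - ζ ∈ Ioc 0 T := ⟨sub_pos.2 hζ.2, by linarith [hζ.1, hs.2]⟩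
  simp [indicator_of_mem e1, indicator_of_mem e2]

/-- A multiplier `κ` of the coefficients in an orthonormal basis is bounded by `sup |κ|`. -/
theorem abs_sum_multiplier_le {H : Type*} [NormedAddCommGroup H] [InnerProductSpace ℝ H]
    {V : Submodule ℝ H} {ι : Type*} [Fintype ι] (b : OrthonormalBasis ι ℝ V) (κ : ι → ℝ) {K : ℝ}
    (hκ : ∀ i, |κ i| ≤ K) (E : V) (x : H) :
    |∑ i, inner ℝ (b i) E * (κ i * inner ℝ (b i : H) x)| ≤ K * ‖E‖ * ‖x‖ := by
  set y : V := ∑ i, (κ i * inner ℝ (b i) E) • b i with hy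
  have h1 : ∑ i, inner ℝ (b i) E * (κ i * inner ℝ (b i : H) x) = inner ℝ (y : H) x := by
    rw [hy, Submodule.coe_sum, sum_inner]
    refine Finset.sum_congr rfl fun i _ => ?_
    rw [Submodule.coe_smul, real_inner_smul_left]
    ring
  rw [h1]
  refine (abs_real_inner_le_norm _ _).trans (mul_le_mul_of_nonneg_right ?_ (norm_nonneg x))
  change ‖y‖ ≤ K * ‖E‖
  by_cases hι : Nonempty ι
  · have hK : 0 ≤ K := (abs_nonneg _).trans (hκ hι.some)
    refine le_of_sq_le_sq ?_ (by positivity)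
    rw [← b.sum_sq_norm_inner_right, mul_pow, ← b.sum_sq_norm_inner_right E, Finset.mul_sum]
    refine Finset.sum_le_sum fun i _ => ?_
    have h2 : inner ℝ (b i) y = κ i * inner ℝ (b i) E := by
      rw [hy, b.orthonormal.inner_right_fintype]
    rw [h2, norm_mul, mul_pow, Real.norm_eq_abs]
    gcongr
    exact hκ i
  · have : IsEmpty ι := not_nonempty_iff.1 hι
    have h3 : E = 0 := by
      rw [← b.sum_repr' E]; simp
    simp [hy, h3]

/-- The error estimate for a symmetric positive semidefinite operator on a finite-dimensional
subspace of a Hilbert space. -/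
theorem exists_norm_error_le {α : ℝ} (hα0 : 0 < α) (hα1 : α < 1) :
    ∃ C : ℝ, 0 < C ∧ ∀ {H : Type*} [NormedAddCommGroup H] [InnerProductSpace ℝ H]
      [CompleteSpace H] (V : Submodule ℝ H) [FiniteDimensional ℝ V] (A : V →ₗ[ℝ] V)
      (_ : A.IsSymmetric) (_ : ∀ x, 0 ≤ inner ℝ (A x) x) (T τ : ℝ) (_ : 0 < τ) (N : ℕ)
      (_ : N * τ = T) (u₀ : H) (f f' f'' : ℝ → H) (_ : HasWeakDeriv T f f')
      (_ : HasWeakDeriv T f' f'')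
      (_ : ∀ t ∈ Ioc 0 T, IntervalIntegrable (fun ζ => (t - ζ) ^ (α - 1) * ‖f'' ζ‖) volume 0 t)
      (u : ℝ → V)
      (_ : IsSemidiscreteSolution α T A (fun t => V.orthogonalProjectionOnto (f t))
        (V.orthogonalProjectionOnto u₀) u)
      (U : ℤ → V) (ut : ℕ → V)
      (_ : IsCrankNicolson α τ N A (fun t => V.orthogonalProjectionOnto (f t))
        (V.orthogonalProjectionOnto u₀) U ut)
      (n : ℕ) (_ : 1 ≤ n) (_ : n ≤ N),
      ‖u (n * τ) - ut n‖ ≤ C * τ ^ 2 * ((n * τ) ^ (-2 : ℝ) * ‖u₀‖ + (n * τ) ^ (α - 2) * ‖f 0‖ +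
        (n * τ) ^ (α - 1) * ‖f' 0‖ +
        ∫ ζ in 0..(n * τ), (n * τ - ζ) ^ (α - 1) * ‖f'' ζ‖) := by
  obtain ⟨C, hC, hbd⟩ := exists_error_bounds hα0 hα1
  refine ⟨C, hC, ?_⟩
  intro H _ _ _ V _ A hA hpos T τ hτ N hN u₀ f f' f'' hf hf' hint u hu U ut hU n hn1 hn
  have hn0 : (0 : ℝ) < n := by exact_mod_cast hn1
  set t : ℝ := n * τ with ht
  have ht0 : 0 < t := by positivity
  have htT : t ≤ T := by rw [← hN, ht]; gcongr
  have hT : 0 ≤ T := ht0.le.trans htT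
  set P := V.orthogonalProjectionOnto with hP
  set b := hA.eigenvectorBasis rfl with hb
  set l := hA.eigenvalues rfl with hl
  have hAb : ∀ i, A (b i) = l i • b i := fun i => hA.apply_eigenvectorBasis rfl i
  have hAi : ∀ i x, inner ℝ (b i) (A x) = l i * inner ℝ (b i) x := by
    intro i x
    rw [← hA (b i) x, hAb, real_inner_smul_left]
  have hl0 : ∀ i, 0 ≤ l i := by
    intro i
    have h1 := hpos (b i)
    rw [hAb, real_inner_smul_left, real_inner_self_eq_norm_sq, b.norm_eq_one i] at h1
    simpa using h1
  have hPi : ∀ i x, inner ℝ (b i) (P x) = inner ℝ (b i : H) x := fun i x =>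
    Submodule.inner_orthogonalProjectionOnto_eq_of_mem_left (b i) x
  -- the components in the eigenbasis solve scalar problems
  set E : V := u t - ut n with hE
  have hcomp : ∀ i, inner ℝ (b i) E =
      inner ℝ (b i : H) u₀ * initError α τ (l i) n +
      inner ℝ (b i : H) (f 0) * constError α τ (l i) n +
      inner ℝ (b i : H) (f' 0) * rampError α τ (l i) n 0 +
      ∫ ζ in 0..t, rampError α τ (l i) n ζ * inner ℝ (b i : H) (f'' ζ) := by
    intro i
    set L : V →L[ℝ] ℝ := innerSL ℝ (b i) with hL
    have hLx : ∀ x, L x = inner ℝ (b i) x := fun x => rfl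
    set L' : H →L[ℝ] ℝ := innerSL ℝ (b i : H) with hL'
    have hLP : ∀ x, L (P x) = L' x := hPi i
    have hLA : ∀ x, L (A x) = l i * L x := hAi i
    have h1 := hu.abs_cont.clm_apply L
    have h2 := hf.clm_apply L'
    have h3 := hf'.clm_apply L'
    have hPf : ∀ a ∈ Icc 0 T, IntervalIntegrable (fun ξ => P (f ξ)) volume 0 a := by
      intro a ha
      refine ContinuousOn.intervalIntegrable ?_
      rw [uIcc_of_le ha.1]
      exact P.continuous.comp_continuousOn
        ((hf.continuousOn hT).mono (Icc_subset_Icc_right ha.2))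
    have heq : ∀ᵐ s ∂volume.restrict (Ioc 0 T),
        (Real.Gamma (1 - α))⁻¹ * (∫ ζ in 0..s, (s - ζ) ^ (-α) * L (deriv u ζ)) + l i * L (u s) =
          L' (f s) := by
      filter_upwards [hu.eqn, ae_intervalIntegrable_caputo hα1 hT hu.abs_cont.1] with s hs hs'
      have h4 := congrArg L hs
      rw [map_add, caputo, map_smul, ← L.intervalIntegral_comp_comm hs', hLA, hLP] at h4
      simpa only [map_smul, smul_eq_mul] using h4
    have hCN : IsCrankNicolson α τ N (fun x => l i * x) (fun s => L' (f s)) (L' u₀)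
        (fun k => L (U k)) (fun k => L (ut k)) := by
      refine ⟨fun k hk => by rw [hU.nonpos k hk, map_zero], fun k hk1 hk => ?_, fun k hk1 hk => ?_⟩
      · have hk0 : (1 : ℝ) ≤ k := by exact_mod_cast hk1
        have hkN : (k : ℝ) ≤ N := by exact_mod_cast hk
        have h4 := congrArg L (hU.step k hk1 hk)
        have e1 : L (∫ ξ in 0..((k : ℝ) * τ), P (f ξ)) = ∫ ξ in 0..((k : ℝ) * τ), L' (f ξ) := by
          rw [← L.intervalIntegral_comp_comm (hPf _ ⟨by positivity, by rw [← hN]; gcongr⟩)]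
          simp only [hLP]
        have e2 : L (∫ ξ in 0..(((k : ℝ) - 1) * τ), P (f ξ)) =
            ∫ ξ in 0..(((k : ℝ) - 1) * τ), L' (f ξ) := by
          rw [← L.intervalIntegral_comp_comm (hPf _ ⟨mul_nonneg (by linarith) hτ.le, by
            rw [← hN]; gcongr; linarith⟩)]
          simp only [hLP]
        simp only [map_add, map_smul, map_sum, hLA, hLP, e2] at h4
        rw [e1] at h4
        exact h4
      · have h4 := congrArg L (hU.value k hk1 hk)
        simpa only [map_add, map_sub, map_smul] using h4
    have key := scalar_error_eq (v := fun s => L (u s)) (g := fun s => L' (f s))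
      (h := fun s => L' (f'' s)) (v₀ := L' u₀) (g₀ := L' (f 0)) (g₁ := L' (f' 0)) hα0 hα1 hτ (hl0 i)
      h1.1 (fun s hs => by simpa only [hu.init, hLP] using h1.2 s hs) heq h3.1
      (fun s hs => h2.taylor h3 hs) hCN hn1 hn htT
    rw [hE, inner_sub_right]
    exact key
  have hrampi : ∀ i, IntervalIntegrable
      (fun ζ => rampError α τ (l i) n ζ * inner ℝ (b i : H) (f'' ζ)) volume 0 t := by
    intro i
    refine ((hf'.clm_apply (innerSL ℝ (b i : H))).mono ⟨ht0.le, htT⟩).continuousOn_mul ?_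
    rw [uIcc_of_le ht0.le]
    exact continuousOn_rampError hα0 τ (l i) n
  -- the error paired with itself, in which the data enter through multipliers in the eigenbasis
  have hself : ‖E‖ ^ 2 =
      (∑ i, inner ℝ (b i) E * (initError α τ (l i) n * inner ℝ (b i : H) u₀)) +
      (∑ i, inner ℝ (b i) E * (constError α τ (l i) n * inner ℝ (b i : H) (f 0))) +
      (∑ i, inner ℝ (b i) E * (rampError α τ (l i) n 0 * inner ℝ (b i : H) (f' 0))) +
      ∫ ζ in 0..t, ∑ i, inner ℝ (b i) E *
        (rampError α τ (l i) n ζ * inner ℝ (b i : H) (f'' ζ)) := by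
    rw [intervalIntegral.integral_finsetSum fun i _ => (hrampi i).const_mul _,
      ← b.sum_sq_norm_inner_right E, ← Finset.sum_add_distrib, ← Finset.sum_add_distrib,
      ← Finset.sum_add_distrib]
    refine Finset.sum_congr rfl fun i _ => ?_
    rw [intervalIntegral.integral_const_mul, Real.norm_eq_abs, sq_abs, sq]
    nth_rewrite 2 [hcomp i]
    ring
  have hb1 := abs_sum_multiplier_le b (fun i => initError α τ (l i) n)
    (fun i => (hbd τ (l i) hτ (hl0 i) n hn1).1) E u₀
  have hb2 := abs_sum_multiplier_le b (fun i => constError α τ (l i) n)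
    (fun i => (hbd τ (l i) hτ (hl0 i) n hn1).2.1) E (f 0)
  have hb3 := abs_sum_multiplier_le b (fun i => rampError α τ (l i) n 0)
    (fun i => (hbd τ (l i) hτ (hl0 i) n hn1).2.2 0 ⟨le_rfl, ht0⟩) E (f' 0)
  have hb4 : |∫ ζ in 0..t, ∑ i, inner ℝ (b i) E *
        (rampError α τ (l i) n ζ * inner ℝ (b i : H) (f'' ζ))| ≤
      C * τ ^ 2 * ‖E‖ * ∫ ζ in 0..t, (t - ζ) ^ (α - 1) * ‖f'' ζ‖ := by
    rw [← intervalIntegral.integral_const_mul, ← Real.norm_eq_abs]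
    refine intervalIntegral.norm_integral_le_of_norm_le ht0.le ?_
      ((hint t ⟨ht0, htT⟩).const_mul _)
    have hae : ∀ᵐ r : ℝ, r ≠ t := by simp [ae_iff]
    filter_upwards [hae] with ζ hζ hζ'
    refine (abs_sum_multiplier_le b (fun i => rampError α τ (l i) n ζ)
      (fun i => (hbd τ (l i) hτ (hl0 i) n hn1).2.2 ζ
        ⟨hζ'.1.le, lt_of_le_of_ne hζ'.2 hζ⟩) E (f'' ζ)).trans_eq ?_
    ring
  rw [sub_zero] at hb3
  set I := ∫ ζ in 0..t, (t - ζ) ^ (α - 1) * ‖f'' ζ‖ with hI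
  have hI0 : 0 ≤ I := intervalIntegral.integral_nonneg ht0.le fun ζ hζ => by
    have := sub_nonneg.2 hζ.2
    positivity
  have hle : ‖E‖ * ‖E‖ ≤ ‖E‖ * (C * τ ^ 2 * (t ^ (-2 : ℝ) * ‖u₀‖ + t ^ (α - 2) * ‖f 0‖ +
      t ^ (α - 1) * ‖f' 0‖ + I)) := by
    rw [← sq, hself]
    refine (add_le_add (add_le_add (add_le_add ((le_abs_self _).trans hb1)
      ((le_abs_self _).trans hb2)) ((le_abs_self _).trans hb3))
      ((le_abs_self _).trans hb4)).trans_eq ?_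
    ring
  rcases (norm_nonneg E).eq_or_lt with h0 | h0
  · rw [← h0]; positivity
  · exact le_of_mul_le_mul_left hle h0

/-! ### The discrete elliptic operator -/

section discreteOp

variable {d : ℕ} {Ω : Set (EuclideanSpace ℝ (Fin d))} {𝒯 : Triangulation Ω}
  {a : EuclideanSpace ℝ (Fin d) → Matrix (Fin d) (Fin d) ℝ} {q : EuclideanSpace ℝ (Fin d) → ℝ}

theorem ellipticForm_comm (hΩ : IsOpen Ω) (hA : IsElliptic Ω a q)
    (u v : EuclideanSpace ℝ (Fin d) → ℝ) : ellipticForm Ω a q u v = ellipticForm Ω a q v u := by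
  refine setIntegral_congr_fun hΩ.measurableSet fun x hx => ?_
  congr 1
  · rw [Finset.sum_comm]
    refine Finset.sum_congr rfl fun i _ => Finset.sum_congr rfl fun j _ => ?_
    rw [(hA.symm x hx).apply i j]
    ring
  · ring

theorem inner_discreteOp_comm (hΩ : IsOpen Ω) (hb : Bornology.IsBounded Ω) (hA : IsElliptic Ω a q)
    (φ ψ : femSpace 𝒯) : inner ℝ (discreteOp 𝒯 a q φ) ψ = inner ℝ φ (discreteOp 𝒯 a q ψ) := by
  rw [real_inner_comm (discreteOp 𝒯 a q ψ) φ, inner_discreteOp hΩ hb hA, inner_discreteOp hΩ hb hA,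
    ellipticForm_comm hΩ hA]

/-- The discrete operator `A_h` as a linear map. -/
noncomputable def discreteOpₗ (hΩ : IsOpen Ω) (hb : Bornology.IsBounded Ω)
    (hA : IsElliptic Ω a q) : femSpace 𝒯 →ₗ[ℝ] femSpace 𝒯 where
  toFun := discreteOp 𝒯 a q
  map_add' φ ψ := ext_inner_right ℝ fun χ => by
    simp only [inner_add_left, inner_discreteOp_comm hΩ hb hA]
  map_smul' r φ := ext_inner_right ℝ fun χ => by
    simp only [real_inner_smul_left, inner_discreteOp_comm hΩ hb hA, RingHom.id_apply]

theorem inner_discreteOp_self_nonneg (hΩ : IsOpen Ω) (hb : Bornology.IsBounded Ω)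
    (hA : IsElliptic Ω a q) (φ : femSpace 𝒯) : 0 ≤ inner ℝ (discreteOp 𝒯 a q φ) φ := by
  by_cases h : ((rep φ : plSpace 𝒯) : EuclideanSpace ℝ (Fin d) → ℝ) = 0
  · have h1 : rep φ = 0 := Subtype.ext h
    have h2 : φ = 0 := by
      ext1
      rw [← plToL2_rep φ, h1, map_zero]
      rfl
    rw [h2, inner_zero_right]
  · rw [inner_discreteOp hΩ hb hA]
    exact (hA.posDef _ (plSpace_lipschitz (rep φ).2) (rep φ).2.2.1 h).le

end discreteOp

end SubDiff

theorem mainTheorem2 (α : ℝ) (hα0 : 0 < α) (hα1 : α < 1) :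
    ∃ c : ℝ, 0 < c ∧
      ∀ (d : ℕ) (_ : d = 1 ∨ d = 2)
        (Ω : Set (EuclideanSpace ℝ (Fin d))) (_ : IsOpen Ω) (_ : IsConnected Ω)
        (_ : Bornology.IsBounded Ω)
        (a : EuclideanSpace ℝ (Fin d) → Matrix (Fin d) (Fin d) ℝ)
        (q : EuclideanSpace ℝ (Fin d) → ℝ) (_ : SubDiff.IsElliptic Ω a q)
        (𝒯 : SubDiff.Triangulation Ω)
        (T : ℝ) (_ : 0 < T)
        (u₀ : SubDiff.L2 Ω) (f f' f'' : ℝ → SubDiff.L2 Ω)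
        (_ : SubDiff.HasWeakDeriv T f f')
        (_ : MemLp f' ⊤ (volume.restrict (Set.Ioc 0 T)))
        (_ : SubDiff.HasWeakDeriv T f' f'')
        (_ : ∀ t ∈ Set.Ioc 0 T,
          IntervalIntegrable (fun ζ => (t - ζ) ^ (α - 1) * ‖f'' ζ‖) volume 0 t)
        (uh : ℝ → SubDiff.femSpace 𝒯)
        (_ : SubDiff.IsSemidiscreteSolution α T (SubDiff.discreteOp 𝒯 a q)
          (fun t => (SubDiff.femSpace 𝒯).orthogonalProjectionOnto (f t))
          ((SubDiff.femSpace 𝒯).orthogonalProjectionOnto u₀) uh)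
        (N : ℕ) (U : ℤ → SubDiff.femSpace 𝒯) (ut : ℕ → SubDiff.femSpace 𝒯)
        (_ : SubDiff.IsCrankNicolson α (T / N) N (SubDiff.discreteOp 𝒯 a q)
          (fun t => (SubDiff.femSpace 𝒯).orthogonalProjectionOnto (f t))
          ((SubDiff.femSpace 𝒯).orthogonalProjectionOnto u₀) U ut)
        (n : ℕ) (_ : 1 ≤ n) (_ : n ≤ N) (τ t : ℝ) (_ : τ = T / N) (_ : t = n * τ),
        ‖uh t - ut n‖ ≤ c * τ ^ 2 *
          (t ^ (-2 : ℝ) * ‖u₀‖ + t ^ (α - 2) * ‖f 0‖ + t ^ (α - 1) * ‖f' 0‖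
            + ∫ ζ in 0..t, (t - ζ) ^ (α - 1) * ‖f'' ζ‖) := by
  obtain ⟨C, hC, h⟩ := SubDiff.exists_norm_error_le hα0 hα1
  refine ⟨C, hC, ?_⟩
  intro d _ Ω hΩ _ hb a q hA 𝒯 T hT u₀ f f' f'' hf _ hf' hint uh hu N U ut hU n hn1 hn τ t hτ ht
  have hN : (0 : ℝ) < N := by exact_mod_cast hn1.trans hn
  subst hτ ht
  exact h (SubDiff.femSpace 𝒯) (SubDiff.discreteOpₗ hΩ hb hA)
    (SubDiff.inner_discreteOp_comm hΩ hb hA) (SubDiff.inner_discreteOp_self_nonneg hΩ hb hA) T _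
    (by positivity) N (by field_simp) u₀ f f' f'' hf hf' hint uh hu U ut hU n hn1 hn
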